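/- **Setting.** Let $V=(S_1,\dots,S_m)$ be a collection of $m$ subsets of a universe $U$ of $n$ elements; subcollections are sets of indices (IDs). The cover $\psi(\mathcal C)$ of a subcollection $\mathcal C$ is the union of its sets, its unique cover $\tilde\psi(\mathcal C)$ is the set of elements lying in exactly one of its sets, and its unique coverage is $|\tilde\psi(\mathcal C)|$. In Max Unique Coverage one seeks a subcollection $\mathcal B$ with $|\mathcal B|\le k$ maximizing $|\tilde\psi(\mathcal B)|$; let $\mathrm{OPT}$ be the maximum. A $(1-\varepsilon)$-approximation is a $\mathcal B$ with $|\mathcal B|\le k$ and $|\tilde\psi(\mathcal B)|\ge(1-\varepsilon)\mathrm{OPT}$. The unique coverage ratio of $\mathcal C$ is $|\psi(\mathcal C)|$ divided by the largest unique coverage of a subcollection of $\mathcal C$ with at most $k$ members (read as $0$ if $\psi(\mathcal C)=\emptyset$). **Theorem.** Let $2\le k\le m$, let $r\ge 2$ be the maximum number of sets of $V$ that contain a common element, let $\varepsilon\in(0,1)$, and let the real number $\varphi$ be such that every subcollection of $V$ with at most $k$ members has unique coverage ratio at most $\varphi$. Put $K=\lceil kr(\varphi+1)/\varepsilon\rceil$.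 1. (UniqueTopSets.) Let $\mathcal A$ consist of $K$ largest sets of $V$ by size (ties broken arbitrarily; of all sets if $m\le K$). Every $\mathcal B\subseteq\mathcal A$ with $|\mathcal B|\le k$ that has maximum unique coverage among such subcollections of $\mathcal A$ is a $(1-\varepsilon)$-approximation. Moreover there are one program and one constant $c$ such that, for all $V,k,r,\varphi,\varepsilon$ as above, the program, given $n$, $m$, $k$, $K$ and the incidence matrix of $V$, outputs such a $\mathcal B$ in time at most $$\Bigl(\frac{e\,r(\varphi+1)}{\varepsilon}\Bigr)^{k}\cdot c\,\Bigl(\frac{mn}{\varepsilon}\Bigr)^{c},$$ that is, in time $(er(\varphi+1)/\varepsilon)^k\,\mathrm{poly}(m,n,1/\varepsilon)$. 2. (Streaming.) For every $a\in\mathbb N$ there are a randomized one-pass streaming algorithm and a constant $c$ such that, for all $V,k,r,\varphi,\varepsilon$ as above, the algorithm, knowing $n,m,k,r,\lceil\varphi\rceil,\lceil1/\varepsilon\rceil$ in advance and receiving the sets of $V$ one after the other, outputs a $(1-\varepsilon)$-approximation with probability at least $1-m^{-a}$, and always uses at most $$c\cdot\frac{\varphi k^2 r}{\varepsilon^3}\cdot(\ln(mn)+1)^{c}$$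 bits of space, that is, $\tilde O(\varphi k^2r/\varepsilon^3)$ space. Here programs are written in a fixed first-order language with natural numbers, pairs, lists and bounded loops, and with random access to a read-only input. An arithmetic operation on numbers of $p$ and $q$ binary digits takes time $(p+1)(q+1)$, reading an input cell takes time linear in the lengths of its address and content, and every other elementary step takes constant time. A streaming algorithm consists of such programs (setting up the memory, updating it at each arrival, computing the output); its randomness is a list of independent uniform numbers from a range $\{0,\dots,N-1\}$, drawn at the start, where the algorithm computes $N$ and the length of the list; its space counts all variables and intermediate values, the random numbers included, but not the read-only representation of the set currently arriving. -/

import Mathlib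

/-! ### Set systems and Max Unique Coverage

A collection of `m` subsets of a universe of `n` elements is a family
`V : Fin m → Finset (Fin n)`; the indices `i : Fin m` are the IDs of the sets, and a
subcollection is a finite set of IDs. -/

namespace MUC

/-- The cover of the subcollection `C`: the union of its sets. -/
def cover {m n : ℕ} (V : Fin m → Finset (Fin n)) (C : Finset (Fin m)) : Finset (Fin n) :=
  C.biUnion V

/-- The non-unique cover of `C`: the elements lying in two different members of `C`. -/
def nonUniqueCover {m n : ℕ} (V : Fin m → Finset (Fin n))
    (C : Finset (Fin m)) : Finset (Fin n) :=
  C.offDiag.biUnion fun p => V p.1 ∩ V p.2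

/-- The unique cover of `C`: the elements lying in exactly one member of `C`. -/
def uniqueCover {m n : ℕ} (V : Fin m → Finset (Fin n)) (C : Finset (Fin m)) : Finset (Fin n) :=
  cover V C \ nonUniqueCover V C

/-- The maximum unique coverage of `C`: the largest unique coverage of a subcollection of `C`
with at most `k` members. -/
def maxUniqueCoverage {m n : ℕ} (V : Fin m → Finset (Fin n))
    (k : ℕ) (C : Finset (Fin m)) : ℕ :=
  (C.powerset.filter fun Q => Q.card ≤ k).sup fun Q => (uniqueCover V Q).card

/-- The optimal value of the instance `V` with cardinality constraint `k`. -/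
def opt {m n : ℕ} (V : Fin m → Finset (Fin n)) (k : ℕ) : ℕ :=
  maxUniqueCoverage V k Finset.univ

/-- The unique coverage ratio of `C`: its coverage over its maximum unique coverage. (For
`k ≥ 1` the denominator vanishes only if the numerator does, and the value is then `0`.) -/
noncomputable def uniqueCoverageRatio {m n : ℕ} (V : Fin m → Finset (Fin n)) (k : ℕ)
    (C : Finset (Fin m)) : ℝ :=
  ((cover V C).card : ℝ) / (maxUniqueCoverage V k C : ℝ)

/-- The maximum frequency: the largest number of sets that an element belongs to. -/
def maxFrequency {m n : ℕ} (V : Fin m → Finset (Fin n)) : ℕ :=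
  Finset.univ.sup fun x : Fin n => (Finset.univ.filter fun i : Fin m => x ∈ V i).card

/-- An instance of Max Unique Coverage with `2 ≤ k ≤ m`, with maximum frequency `r ≥ 2`, with
error parameter `ε ∈ (0, 1)`, and such that every collection of at most `k` of its sets has
unique coverage ratio at most `φ`. -/
structure IsInstance {m n : ℕ} (V : Fin m → Finset (Fin n))
    (k r : ℕ) (φ ε : ℝ) : Prop where
  two_le_k : 2 ≤ k
  k_le : k ≤ m
  r_eq : r = maxFrequency V
  two_le_r : 2 ≤ r
  eps_pos : 0 < ε
  eps_lt_one : ε < 1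
  ratio_le : ∀ C : Finset (Fin m), C.card ≤ k → uniqueCoverageRatio V k C ≤ φ

/-- `B` is a `(1 - ε)`-approximate solution of the instance. -/
def IsApprox {m n : ℕ} (V : Fin m → Finset (Fin n))
    (k : ℕ) (ε : ℝ) (B : Finset (Fin m)) : Prop :=
  B.card ≤ k ∧ (1 - ε) * (opt V k : ℝ) ≤ ((uniqueCover V B).card : ℝ)

/-- The size `⌈k r (φ + 1) / ε⌉` of the kernel. -/
noncomputable def kernelSize (k r : ℕ) (φ ε : ℝ) : ℕ :=
  ⌈(k : ℝ) * (r : ℝ) * (φ + 1) / ε⌉₊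

/-- `A` consists of `K` largest sets of `V` (of all sets if there are at most `K`). -/
def IsTopSets {m n : ℕ} (V : Fin m → Finset (Fin n)) (K : ℕ) (A : Finset (Fin m)) : Prop :=
  A.card = min K m ∧ ∀ i ∈ A, ∀ j ∉ A, (V j).card ≤ (V i).card

/-- `B` is a possible result of UniqueTopSets with kernel size `K`: keep `K` largest sets
(ties being broken arbitrarily), and among the subcollections of at most `k` of these take one
of maximum unique coverage. -/
def IsUniqueTopSetsOutput {m n : ℕ} (V : Fin m → Finset (Fin n))
    (k K : ℕ) (B : Finset (Fin m)) : Prop :=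
  ∃ A : Finset (Fin m), IsTopSets V K A ∧ B ⊆ A ∧ B.card ≤ k ∧
    ∀ Q : Finset (Fin m), Q ⊆ A → Q.card ≤ k → (uniqueCover V Q).card ≤ (uniqueCover V B).card

/-- The list `L` of numbers lists the IDs of the members of `B`, without repetition. -/
def Lists {m : ℕ} (L : List ℕ) (B : Finset (Fin m)) : Prop :=
  L.Nodup ∧ ∀ a : ℕ, a ∈ L ↔ ∃ i ∈ B, (i : ℕ) = a

/-- The incidence matrix of `V` (and `0` outside its range). -/
def incidence {m n : ℕ} (V : Fin m → Finset (Fin n)) (i x : ℕ) : ℕ :=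
  if h : i < m ∧ x < n then (if (⟨x, h.2⟩ : Fin n) ∈ V ⟨i, h.1⟩ then 1 else 0) else 0

end MUC

/-! ### Programs, running time and space

A small imperative-style first-order language with natural numbers of arbitrary size, pairs and
lists, `for` loops, and random access to a read-only input tape. A program is a finite piece of
syntax. Arithmetic is charged by the bit lengths of its operands. -/

namespace Machine

/-- Data types. -/
inductive Ty : Type
  | nat : Ty
  | list : Ty → Ty
  | prod : Ty → Ty → Ty

/-- The values of a data type. -/
@[reducible] def Ty.Val : Ty → Type
  | .nat => ℕ
  | .list τ => List τ.Val
  | .prod σ τ => σ.Val × τ.Val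

/-- The number of bits of a value in a prefix-free binary code: each binary digit of a number,
and each entry of a list, is preceded by a bit `1`, and the end is marked by a bit `0`. -/
def Ty.bits : (τ : Ty) → τ.Val → ℕ
  | .nat, a => 2 * Nat.size a + 1
  | .list τ, l => (l.map fun x => 1 + τ.bits x).sum + 1
  | .prod σ τ, p => σ.bits p.1 + τ.bits p.2

/-- A variable of type `τ` in the context `Γ` (a typed de Bruijn index). -/
inductive Var : List Ty → Ty → Type
  | zero {Γ : List Ty} {τ : Ty} : Var (τ :: Γ) τ
  | succ {Γ : List Ty} {σ τ : Ty} : Var Γ τ → Var (σ :: Γ) τ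

/-- The values of the variables of a context. -/
@[reducible] def Env : List Ty → Type
  | [] => Unit
  | τ :: Γ => τ.Val × Env Γ

/-- The number of bits of the values of all variables. -/
def Env.bits : {Γ : List Ty} → Env Γ → ℕ
  | [], _ => 0
  | τ :: _, e => τ.bits e.1 + Env.bits e.2

/-- The value of a variable. -/
def Var.get : {Γ : List Ty} → {τ : Ty} → Var Γ τ → Env Γ → τ.Val
  | _, _, .zero, e => e.1
  | _, _, .succ v, e => v.get e.2

/-- Arithmetic operations: addition, truncated subtraction, multiplication, integer division,
remainder, and the tests `<` and `=`. -/
inductive Op : Type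
  | add | sub | mul | div | mod | lt | eq

/-- The value of an arithmetic operation; a test has value `1` (true) or `0` (false). -/
def Op.eval : Op → ℕ → ℕ → ℕ
  | .add, a, b => a + b
  | .sub, a, b => a - b
  | .mul, a, b => a * b
  | .div, a, b => a / b
  | .mod, a, b => a % b
  | .lt, a, b => if a < b then 1 else 0
  | .eq, a, b => if a = b then 1 else 0

/-- `Tm Γ τ`: programs with variables from `Γ` and with a result of type `τ`. -/
inductive Tm : List Ty → Ty → Type
  /-- a variable -/
  | var {Γ : List Ty} {τ : Ty} : Var Γ τ → Tm Γ τ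
  /-- a numeral -/
  | lit {Γ : List Ty} : ℕ → Tm Γ .nat
  /-- an arithmetic operation -/
  | op {Γ : List Ty} : Op → Tm Γ .nat → Tm Γ .nat → Tm Γ .nat
  /-- the content of the cell of the input tape with the given address -/
  | read {Γ : List Ty} : Tm Γ .nat → Tm Γ .nat
  /-- compute the first, and bind it to a new variable in the second -/
  | bind {Γ : List Ty} {σ τ : Ty} : Tm Γ σ → Tm (σ :: Γ) τ → Tm Γ τ
  /-- the second if the first is nonzero, and else the third -/
  | ite {Γ : List Ty} {τ : Ty} : Tm Γ .nat → Tm Γ τ → Tm Γ τ → Tm Γ τ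
  | pair {Γ : List Ty} {σ τ : Ty} : Tm Γ σ → Tm Γ τ → Tm Γ (.prod σ τ)
  | fst {Γ : List Ty} {σ τ : Ty} : Tm Γ (.prod σ τ) → Tm Γ σ
  | snd {Γ : List Ty} {σ τ : Ty} : Tm Γ (.prod σ τ) → Tm Γ τ
  | nil {Γ : List Ty} {τ : Ty} : Tm Γ (.list τ)
  | cons {Γ : List Ty} {τ : Ty} : Tm Γ τ → Tm Γ (.list τ) → Tm Γ (.list τ)
  /-- distinguish whether a list is empty; if not, bind its head and its tail -/
  | lcase {Γ : List Ty} {σ τ : Ty} :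
      Tm Γ (.list σ) → Tm Γ τ → Tm (σ :: .list σ :: Γ) τ → Tm Γ τ
  /-- run through a list, updating an accumulator: list, initial accumulator, body
  (with variables for the entry and the accumulator) -/
  | fold {Γ : List Ty} {σ τ : Ty} :
      Tm Γ (.list σ) → Tm Γ τ → Tm (σ :: τ :: Γ) τ → Tm Γ τ
  /-- repeat: number of rounds, initial accumulator, body (with a variable for the
  accumulator) -/
  | loop {Γ : List Ty} {τ : Ty} : Tm Γ .nat → Tm Γ τ → Tm (τ :: Γ) τ → Tm Γ τ

/-- The result of a program on the input tape `inp` with values `e` of its variables. -/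
def Tm.eval (inp : ℕ → ℕ) : {Γ : List Ty} → {τ : Ty} → Tm Γ τ → Env Γ → τ.Val
  | _, _, .var v, e => v.get e
  | _, _, .lit a, _ => a
  | _, _, .op o s t, e => o.eval (s.eval inp e) (t.eval inp e)
  | _, _, .read t, e => inp (t.eval inp e)
  | _, _, .bind s t, e => t.eval inp (s.eval inp e, e)
  | _, _, .ite c s t, e => if c.eval inp e ≠ 0 then s.eval inp e else t.eval inp e
  | _, _, .pair s t, e => (s.eval inp e, t.eval inp e)
  | _, _, .fst t, e => (t.eval inp e).1
  | _, _, .snd t, e => (t.eval inp e).2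
  | _, _, .nil, _ => []
  | _, _, .cons s t, e => s.eval inp e :: t.eval inp e
  | _, _, .lcase l s t, e =>
      match l.eval inp e with
      | [] => s.eval inp e
      | x :: xs => t.eval inp (x, xs, e)
  | _, _, .fold l s t, e => (l.eval inp e).foldl (fun a x => t.eval inp (x, a, e)) (s.eval inp e)
  | _, _, .loop c s t, e => (fun a => t.eval inp (a, e))^[c.eval inp e] (s.eval inp e)

/-- The total cost of a run through a list: `f` updates the accumulator, and `c` is the cost of
one round. -/
def foldSum {σ τ : Type} (f : τ → σ → τ) (c : τ → σ → ℕ) : τ → List σ → ℕ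
  | _, [] => 0
  | a, x :: xs => c a x + foldSum f c (f a x) xs

/-- The largest cost of a round of a run through a list. -/
def foldMax {σ τ : Type} (f : τ → σ → τ) (c : τ → σ → ℕ) : τ → List σ → ℕ
  | _, [] => 0
  | a, x :: xs => max (c a x) (foldMax f c (f a x) xs)

/-- The running time. An arithmetic operation on numbers with `p` and `q` binary digits takes
time `(p + 1) (q + 1)`, reading a cell takes time linear in the lengths of its address and of its
content, every other elementary step (on pointers to immutable data) takes time `1`. -/
def Tm.time (inp : ℕ → ℕ) : {Γ : List Ty} → {τ : Ty} → Tm Γ τ → Env Γ → ℕ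
  | _, _, .var _, _ => 1
  | _, _, .lit _, _ => 1
  | _, _, .op _ s t, e =>
      s.time inp e + t.time inp e +
        (Nat.size (s.eval inp e) + 1) * (Nat.size (t.eval inp e) + 1)
  | _, _, .read t, e =>
      t.time inp e + Nat.size (t.eval inp e) + Nat.size (inp (t.eval inp e)) + 1
  | _, _, .bind s t, e => s.time inp e + t.time inp (s.eval inp e, e) + 1
  | _, _, .ite c s t, e =>
      c.time inp e + (if c.eval inp e ≠ 0 then s.time inp e else t.time inp e) + 1
  | _, _, .pair s t, e => s.time inp e + t.time inp e + 1
  | _, _, .fst t, e => t.time inp e + 1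
  | _, _, .snd t, e => t.time inp e + 1
  | _, _, .nil, _ => 1
  | _, _, .cons s t, e => s.time inp e + t.time inp e + 1
  | _, _, .lcase l s t, e =>
      l.time inp e + 1 +
        match l.eval inp e with
        | [] => s.time inp e
        | x :: xs => t.time inp (x, xs, e)
  | _, _, .fold l s t, e =>
      l.time inp e + s.time inp e + 1 +
        foldSum (fun a x => t.eval inp (x, a, e)) (fun a x => t.time inp (x, a, e) + 1)
          (s.eval inp e) (l.eval inp e)
  | _, _, .loop c s t, e =>
      c.time inp e + s.time inp e + Nat.size (c.eval inp e) + 1 +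
        ∑ j ∈ Finset.range (c.eval inp e),
          (t.time inp ((fun a => t.eval inp (a, e))^[j] (s.eval inp e), e) + 1)

/-- The largest number of bits of a value computed during the run (intermediate results and
accumulators included). -/
def Tm.peak (inp : ℕ → ℕ) : {Γ : List Ty} → {τ : Ty} → Tm Γ τ → Env Γ → ℕ
  | _, τ, .var v, e => τ.bits (v.get e)
  | _, _, .lit a, _ => Ty.nat.bits a
  | _, _, .op o s t, e =>
      max (Ty.nat.bits (o.eval (s.eval inp e) (t.eval inp e))) (max (s.peak inp e) (t.peak inp e))
  | _, _, .read t, e => max (Ty.nat.bits (inp (t.eval inp e))) (t.peak inp e)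
  | _, _, .bind s t, e => max (s.peak inp e) (t.peak inp (s.eval inp e, e))
  | _, _, .ite c s t, e =>
      max (c.peak inp e) (if c.eval inp e ≠ 0 then s.peak inp e else t.peak inp e)
  | _, .prod σ τ, .pair s t, e =>
      max (σ.bits (s.eval inp e) + τ.bits (t.eval inp e)) (max (s.peak inp e) (t.peak inp e))
  | _, _, .fst t, e => t.peak inp e
  | _, _, .snd t, e => t.peak inp e
  | _, .list τ, .nil, _ => (Ty.list τ).bits []
  | _, .list τ, .cons s t, e =>
      max ((Ty.list τ).bits (s.eval inp e :: t.eval inp e)) (max (s.peak inp e) (t.peak inp e))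
  | _, _, .lcase l s t, e =>
      max (l.peak inp e)
        (match l.eval inp e with
        | [] => s.peak inp e
        | x :: xs => t.peak inp (x, xs, e))
  | _, _, .fold l s t, e =>
      max (max (l.peak inp e) (s.peak inp e))
        (foldMax (fun a x => t.eval inp (x, a, e)) (fun a x => t.peak inp (x, a, e))
          (s.eval inp e) (l.eval inp e))
  | _, _, .loop c s t, e =>
      max (max (c.peak inp e) (s.peak inp e))
        ((Finset.range (c.eval inp e)).sup fun j =>
          t.peak inp ((fun a => t.eval inp (a, e))^[j] (s.eval inp e), e))

/-- The number of nodes of a program, a loop counting twice (for its counter). There is no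
recursion, so this bounds the number of values that are held at the same time. -/
def Tm.nodes : {Γ : List Ty} → {τ : Ty} → Tm Γ τ → ℕ
  | _, _, .var _ => 1
  | _, _, .lit _ => 1
  | _, _, .op _ s t => s.nodes + t.nodes + 1
  | _, _, .read t => t.nodes + 1
  | _, _, .bind s t => s.nodes + t.nodes + 1
  | _, _, .ite c s t => c.nodes + s.nodes + t.nodes + 1
  | _, _, .pair s t => s.nodes + t.nodes + 1
  | _, _, .fst t => t.nodes + 1
  | _, _, .snd t => t.nodes + 1
  | _, _, .nil => 1
  | _, _, .cons s t => s.nodes + t.nodes + 1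
  | _, _, .lcase l s t => l.nodes + s.nodes + t.nodes + 1
  | _, _, .fold l s t => l.nodes + s.nodes + t.nodes + 2
  | _, _, .loop c s t => c.nodes + s.nodes + t.nodes + 2

/-- The working space of a run in bits: the variables, and all values that can be held at the same
time during the run, each counted with the size of the largest value that occurs. The read-only
input tape is not counted. -/
def Tm.space (inp : ℕ → ℕ) {Γ : List Ty} {τ : Ty} (t : Tm Γ τ) (e : Env Γ) : ℕ :=
  Env.bits e + t.nodes * t.peak inp e

/-! ### Streaming algorithms -/

/-- The numbers known to a streaming algorithm in advance: `n`, `m`, `k`, `r`, `⌈φ⌉` and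
`⌈1 / ε⌉`. -/
abbrev Params : List Ty := [.nat, .nat, .nat, .nat, .nat, .nat]

/-- A randomized one-pass streaming algorithm in the set-streaming model. At the start it draws
`seedLen` independent numbers, uniform in `{0, …, seedMod - 1}`, and sets up its memory; then it
updates its memory on the arrival of each set (the ID of the set is a variable, and the tape gives
the indicator function of the set); at the end it computes a list of IDs from its memory. -/
structure StreamAlg where
  /-- the type of the content of the memory -/
  mem : Ty
  seedLen : Tm Params .nat
  seedMod : Tm Params .nat
  /-- set up the memory, given the random numbers -/
  start : Tm (.list .nat :: Params) mem
  /-- update the memory, given the ID of the set and the present memory -/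
  step : Tm (.nat :: mem :: Params) mem
  /-- the list of IDs computed from the final memory -/
  output : Tm (mem :: Params) (.list .nat)

/-- The empty input tape. -/
def blank : ℕ → ℕ := fun _ => 0

namespace StreamAlg

/-- How many random numbers are drawn. -/
def numSeeds (A : StreamAlg) (p : Env Params) : ℕ := A.seedLen.eval blank p

/-- The random numbers are uniform in `{0, …, seedRange - 1}`. -/
def seedRange (A : StreamAlg) (p : Env Params) : ℕ := A.seedMod.eval blank p

/-- The random strings of the algorithm. -/
abbrev Seed (A : StreamAlg) (p : Env Params) : Type := Fin (A.numSeeds p) → Fin (A.seedRange p)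

/-- A random string as a list of numbers. -/
def seedList (A : StreamAlg) (p : Env Params) (s : A.Seed p) : List ℕ :=
  (List.ofFn s).map Fin.val

/-- The memory after the arrival of the first `j` sets. -/
def memory (A : StreamAlg) (p : Env Params) {m n : ℕ} (V : Fin m → Finset (Fin n))
    (s : A.Seed p) : ℕ → A.mem.Val
  | 0 => A.start.eval blank (A.seedList p s, p)
  | j + 1 => A.step.eval (MUC.incidence V j) (j, memory A p V s j, p)

/-- The output on the stream `V`. -/
def result (A : StreamAlg) (p : Env Params) {m n : ℕ} (V : Fin m → Finset (Fin n))
    (s : A.Seed p) : List ℕ :=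
  A.output.eval blank (A.memory p V s m, p)

/-- The space in bits used on the stream `V` with the random string `s`: the maximum over all
parts of the run. -/
def space (A : StreamAlg) (p : Env Params) {m n : ℕ} (V : Fin m → Finset (Fin n))
    (s : A.Seed p) : ℕ :=
  max (max (A.seedLen.space blank p) (A.seedMod.space blank p))
    (max (A.start.space blank (A.seedList p s, p))
      (max ((Finset.range m).sup fun j =>
          A.step.space (MUC.incidence V j) (j, A.memory p V s j, p))
        (A.output.space blank (A.memory p V s m, p))))

open Classical in
/-- The probability, over the uniformly random string, that the output has the property `Q`. -/
noncomputable def prob (A : StreamAlg) (p : Env Params) {m n : ℕ} (V : Fin m → Finset (Fin n))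
    (Q : List ℕ → Prop) : ℝ :=
  ((Finset.univ.filter fun s : A.Seed p => Q (A.result p V s)).card : ℝ) /
    (Fintype.card (A.Seed p) : ℝ)

end StreamAlg

end Machine

/-!
Both parts rest on an exchange argument. Let `C` be a subcollection with at most `k` members, at
first an optimal one. It covers at most `φ * opt` elements, and each element lies in at most `r`
sets, so the overlaps of the members of a kernel `A` with the cover and the unique cover of `C`
add up to at most `r (φ + 1) * opt`. If `A` has at least `k r (φ + 1) / δ` members, one of them
has overlaps of at most `δ * opt / k` (`MUC.IsInstance.exists_small_overlap`). If moreover `A`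
consists of largest sets, this member can replace a member of `C` outside `A` at a loss of at most
`δ * opt / k` (`MUC.card_uniqueCover_exchange`), and after at most `k` replacements `C` lies in
`A`. Thus `A` contains a `(1 - δ)`-approximation (`MUC.IsInstance.exists_approx_of_isTopSets`).

The program UniqueTopSets ranks the sets by size and ID, and builds the list of all subcollections
with at most `k` members of the kernel, one set at a time. It compares their unique coverages
(`Machine.uniqueTopSets_correct`). There are at most `(e K / k) ^ k` such subcollections
(`MUC.sum_choose_le`), rounding in `K` costs a constant factor, and each of them takes polynomial
time (`Machine.exists_uniqueTopSets_time`).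

The streaming algorithm keeps a kernel of `2 k r (⌈φ⌉ + 1) ⌈1 / ε⌉` largest sets, good for the
error `ε / 2`, and of each set only those elements that are sampled by a random hash function: a
polynomial with `t` coefficients modulo a prime `q ≥ n`. If `M` is the largest size so far,
elements are sampled with probability about `T / M`, where `T = 576 t ⌈1 / ε⌉ ^ 2` (all of them,
while `M ≤ T`); as `M` grows, fewer elements are sampled. Since a single set shows `opt ≥ M`, at least `T` sampled elements are
expected in the unique cover of an optimal subcollection. The hash values are `t`-wise independent
(`Hashing.isWiseUniform_horner`), so the moment of order `t` gives tail bounds with failure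
probability `2 / 2 ^ t` (`Hashing.IsWiseUniform.tail_le`). They are applied to the unique covers
of all subcollections with at most `k` members, whose sampled parts then estimate unique coverages
up to `opt * ε / 4`, and to each set, of which then at most `4 T` elements need to be stored. A
multiple of `k log m` as `t` makes up for the number of these events (`Machine.failure_le`). In
the end, a search over all subcollections of the kernel finds one with the largest estimate
(`Machine.exists_isApprox_search`, `Machine.streamAlg_prob`).

The space is dominated by the stored elements: the capacity `2 k r (⌈φ⌉ + 1) ⌈1 / ε⌉` times `4 T`
numbers less than `n` (`Machine.streamAlg_space_le`, `Machine.exists_valueBits_le`). The search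
holds only one subcollection at a time, selected by the binary digits of a counter, whose length
is the capacity.
-/

/-! ### Covers, and the exchange of sets -/

namespace MUC

open Finset

variable {m n : ℕ} (V : Fin m → Finset (Fin n))

theorem mem_uniqueCover {C : Finset (Fin m)} {x : Fin n} :
    x ∈ uniqueCover V C ↔ ∃ i ∈ C, x ∈ V i ∧ ∀ j ∈ C, x ∈ V j → j = i := by
  simp only [uniqueCover, cover, nonUniqueCover, mem_sdiff, mem_biUnion, mem_offDiag, mem_inter,
    Prod.exists]
  constructor
  · rintro ⟨⟨i, hi, hx⟩, h⟩
    refine ⟨i, hi, hx, fun j hj hxj => ?_⟩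
    by_contra hne
    exact h ⟨j, i, ⟨hj, hi, hne⟩, hxj, hx⟩
  · rintro ⟨i, hi, hx, h⟩
    refine ⟨⟨i, hi, hx⟩, ?_⟩
    rintro ⟨a, b, ⟨ha, hb, hne⟩, hxa, hxb⟩
    exact hne ((h a ha hxa).trans (h b hb hxb).symm)

theorem mem_uniqueCover_iff_card {C : Finset (Fin m)} {x : Fin n} :
    x ∈ uniqueCover V C ↔ (C.filter fun i => x ∈ V i).card = 1 := by
  rw [mem_uniqueCover, card_eq_one]
  constructor
  · rintro ⟨i, hi, hx, h⟩
    refine ⟨i, ?_⟩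
    ext j
    simp only [mem_filter, mem_singleton]
    exact ⟨fun hj => h j hj.1 hj.2, fun hj => hj ▸ ⟨hi, hx⟩⟩
  · rintro ⟨i, h⟩
    have hi : i ∈ C.filter fun i => x ∈ V i := h ▸ mem_singleton_self i
    rw [mem_filter] at hi
    exact ⟨i, hi.1, hi.2, fun j hj hxj => mem_singleton.1 (h ▸ mem_filter.2 ⟨hj, hxj⟩)⟩

theorem uniqueCover_singleton (i : Fin m) : uniqueCover V {i} = V i := by
  ext x
  simp [mem_uniqueCover]

theorem card_uniqueCover_le_opt {k : ℕ} {C : Finset (Fin m)} (hC : C.card ≤ k) :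
    (uniqueCover V C).card ≤ opt V k := by
  unfold opt maxUniqueCoverage
  exact le_sup (f := fun Q => (uniqueCover V Q).card) (by simp [hC])

theorem exists_card_uniqueCover_eq_opt (k : ℕ) :
    ∃ C : Finset (Fin m), C.card ≤ k ∧ (uniqueCover V C).card = opt V k := by
  obtain ⟨C, hC, h⟩ := exists_mem_eq_sup ((univ : Finset (Fin m)).powerset.filter
    fun Q => Q.card ≤ k) ⟨∅, by simp⟩ (fun Q => (uniqueCover V Q).card)
  exact ⟨C, (mem_filter.1 hC).2, h.symm⟩

theorem maxUniqueCoverage_le_opt (k : ℕ) (C : Finset (Fin m)) :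
    maxUniqueCoverage V k C ≤ opt V k := by
  unfold opt maxUniqueCoverage
  exact sup_mono (filter_subset_filter _ (powerset_mono.2 (subset_univ C)))

theorem card_le_opt {k : ℕ} (hk : 1 ≤ k) (i : Fin m) : (V i).card ≤ opt V k := by
  have := card_uniqueCover_le_opt V (k := k) (C := {i}) (by simpa using hk)
  rwa [uniqueCover_singleton] at this

/-- Each element of `X` lies in at most `maxFrequency V` sets. -/
theorem sum_card_inter_le (A : Finset (Fin m)) (X : Finset (Fin n)) :
    ∑ i ∈ A, (V i ∩ X).card ≤ maxFrequency V * X.card := by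
  have h : ∀ i, (V i ∩ X).card = ∑ x ∈ X, if x ∈ V i then 1 else 0 := fun i => by
    rw [inter_comm, ← filter_mem_eq_inter, card_filter]
  simp_rw [h]
  rw [sum_comm, mul_comm, ← smul_eq_mul]
  refine sum_le_card_nsmul _ _ _ fun x _ => ?_
  rw [← card_filter]
  refine (card_le_card (filter_subset_filter _ (subset_univ A))).trans ?_
  exact le_sup (f := fun x : Fin n => (univ.filter fun i : Fin m => x ∈ V i).card) (mem_univ x)

/-- The exchange step: replacing `T` by `S` costs at most `|T| - |S|` and the number of elements
of `S` in the cover and in the unique cover. -/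
theorem card_uniqueCover_exchange (C : Finset (Fin m)) (S T : Fin m) :
    (uniqueCover V C).card + (V S).card ≤
      (uniqueCover V (insert S (C.erase T))).card + (V T).card +
        ((V S ∩ cover V C).card + (V S ∩ uniqueCover V C).card) := by
  have hsub : (uniqueCover V C \ V T) \ V S ∪ V S \ cover V C ⊆
      uniqueCover V (insert S (C.erase T)) := by
    intro x hx
    rw [mem_uniqueCover]
    rcases mem_union.1 hx with hx | hx
    · simp only [mem_sdiff] at hx
      obtain ⟨⟨hu, hT⟩, hS⟩ := hx
      obtain ⟨i, hi, hxi, h⟩ := (mem_uniqueCover V).1 hu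
      refine ⟨i, mem_insert_of_mem (mem_erase.2 ⟨fun h => hT (h ▸ hxi), hi⟩), hxi, ?_⟩
      intro j hj hxj
      rcases mem_insert.1 hj with rfl | hj
      · exact absurd hxj hS
      · exact h j (mem_of_mem_erase hj) hxj
    · simp only [mem_sdiff, cover, mem_biUnion, not_exists, not_and] at hx
      refine ⟨S, mem_insert_self _ _, hx.1, fun j hj hxj => ?_⟩
      rcases mem_insert.1 hj with rfl | hj
      · rfl
      · exact absurd hxj (hx.2 j (mem_of_mem_erase hj))
  have h1 := card_le_card hsub
  rw [card_union_of_disjoint (disjoint_left.2 fun x hx hx' =>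
    (mem_sdiff.1 hx).2 (mem_sdiff.1 hx').1)] at h1
  have h2 := le_card_sdiff (V T) (uniqueCover V C)
  have h3 := card_sdiff_add_card_inter (uniqueCover V C \ V T) (V S)
  have h4 := card_sdiff_add_card_inter (V S) (cover V C)
  have h5 : ((uniqueCover V C \ V T) ∩ V S).card ≤ (V S ∩ uniqueCover V C).card := by
    rw [inter_comm]
    exact card_le_card (inter_subset_inter_left sdiff_subset)
  omega

variable {V}

theorem IsInstance.pos {k r : ℕ} {φ ε : ℝ} (h : IsInstance V k r φ ε) : 0 < n ∧
    ∃ i : Fin m, (V i).Nonempty := by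
  have hr := h.two_le_r
  rw [h.r_eq] at hr
  have : ∃ x : Fin n, 1 < (univ.filter fun i : Fin m => x ∈ V i).card := by
    by_contra hcon
    push Not at hcon
    have : maxFrequency V ≤ 1 := Finset.sup_le fun x _ => hcon x
    omega
  obtain ⟨x, hx⟩ := this
  refine ⟨x.pos, ?_⟩
  obtain ⟨i, hi⟩ := card_pos.1 (by omega : 0 < (univ.filter fun i : Fin m => x ∈ V i).card)
  exact ⟨i, x, (mem_filter.1 hi).2⟩

/-- A nonempty set on its own has unique coverage ratio `1`. -/
theorem IsInstance.one_le_ratio {k r : ℕ} {φ ε : ℝ} (h : IsInstance V k r φ ε) : 1 ≤ φ := by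
  obtain ⟨-, i, hi⟩ := h.pos
  have hk := h.two_le_k
  refine le_trans ?_ (h.ratio_le {i} (by rw [card_singleton]; omega))
  have hcov : cover V {i} = V i := by simp [cover]
  have hmax : maxUniqueCoverage V k {i} ≤ (V i).card := by
    refine Finset.sup_le fun Q hQ => card_le_card ?_
    have hQ := mem_powerset.1 (mem_filter.1 hQ).1
    intro x hx
    obtain ⟨j, hj, hxj, -⟩ := (mem_uniqueCover V).1 hx
    exact mem_singleton.1 (hQ hj) ▸ hxj
  have hpos : (V i).card ≤ maxUniqueCoverage V k {i} := by
    rw [← uniqueCover_singleton V i]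
    exact le_sup (f := fun Q => (uniqueCover V Q).card)
      (by rw [mem_filter, mem_powerset, card_singleton]; exact ⟨Subset.rfl, by omega⟩)
  unfold uniqueCoverageRatio
  rw [hcov, le_antisymm hmax hpos, div_self]
  have := card_pos.2 hi
  positivity

/-- A small subcollection covers at most `φ * opt` elements. If none of its subcollections has
unique coverage, its ratio is the junk value `0` and gives no bound, but then its cover is empty.
-/
theorem IsInstance.card_cover_le {k r : ℕ} {φ ε : ℝ} (h : IsInstance V k r φ ε)
    {C : Finset (Fin m)} (hC : C.card ≤ k) : ((cover V C).card : ℝ) ≤ φ * opt V k := by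
  have h1 := h.ratio_le C hC
  have hφ := h.one_le_ratio
  unfold uniqueCoverageRatio at h1
  rcases Nat.eq_zero_or_pos (maxUniqueCoverage V k C) with h0 | h0
  · have : cover V C = ∅ := by
      rw [eq_empty_iff_forall_notMem]
      intro x hx
      obtain ⟨i, hi, hxi⟩ := mem_biUnion.1 hx
      have hk := h.two_le_k
      have : (uniqueCover V {i}).card ≤ maxUniqueCoverage V k C :=
        le_sup (f := fun Q => (uniqueCover V Q).card)
          (by rw [mem_filter, mem_powerset, card_singleton]
              exact ⟨singleton_subset_iff.2 hi, by omega⟩)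
      rw [uniqueCover_singleton] at this
      have := card_pos.2 ⟨x, hxi⟩
      omega
    rw [this]
    simp only [card_empty, Nat.cast_zero]
    positivity
  · rw [div_le_iff₀ (by exact_mod_cast h0)] at h1
    refine h1.trans (mul_le_mul_of_nonneg_left ?_ (by linarith))
    exact_mod_cast maxUniqueCoverage_le_opt V k C

/-- Some member of `A` has few elements in common with the cover and the unique cover of `C`, by
averaging over `A`: each element of these covers is counted at most `r` times. -/
theorem IsInstance.exists_small_overlap {k r : ℕ} {φ ε δ : ℝ} (h : IsInstance V k r φ ε)
    {A C : Finset (Fin m)} (hC : C.card ≤ k) (hA : A.Nonempty) (hδ : 0 < δ)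
    (hK : (k : ℝ) * r * (φ + 1) / δ ≤ A.card) :
    ∃ S ∈ A, (((V S ∩ cover V C).card + (V S ∩ uniqueCover V C).card : ℕ) : ℝ) ≤
      δ * opt V k / k := by
  have hk : (0 : ℝ) < k := by have := h.two_le_k; positivity
  have hKpos : (0 : ℝ) < A.card := by exact_mod_cast card_pos.2 hA
  by_contra hcon
  push Not at hcon
  have h1 : (A.card : ℝ) * (δ * opt V k / k) <
      ∑ S ∈ A, (((V S ∩ cover V C).card + (V S ∩ uniqueCover V C).card : ℕ) : ℝ) := by
    rw [← nsmul_eq_mul, ← sum_const]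
    exact sum_lt_sum_of_nonempty hA hcon
  have h2 : (∑ S ∈ A, (((V S ∩ cover V C).card + (V S ∩ uniqueCover V C).card : ℕ) : ℝ)) ≤
      r * (φ * opt V k + opt V k) := by
    rw [← Nat.cast_sum, sum_add_distrib]
    have e1 := sum_card_inter_le V A (cover V C)
    have e2 := sum_card_inter_le V A (uniqueCover V C)
    rw [← h.r_eq] at e1 e2
    have e3 := h.card_cover_le hC
    have e4 : ((uniqueCover V C).card : ℝ) ≤ opt V k := by
      exact_mod_cast card_uniqueCover_le_opt V hC
    push_cast
    have e1' : (∑ i ∈ A, ((V i ∩ cover V C).card : ℝ)) ≤ r * (cover V C).card := by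
      exact_mod_cast e1
    have e2' : (∑ i ∈ A, ((V i ∩ uniqueCover V C).card : ℝ)) ≤ r * (uniqueCover V C).card := by
      exact_mod_cast e2
    have hr : (0 : ℝ) ≤ r := by positivity
    have := mul_le_mul_of_nonneg_left e3 hr
    have := mul_le_mul_of_nonneg_left e4 hr
    linarith
  have h3 : (r : ℝ) * (φ * opt V k + opt V k) ≤ A.card * (δ * opt V k / k) := by
    have := mul_le_mul_of_nonneg_right hK (by positivity : (0 : ℝ) ≤ δ * opt V k / k)
    refine le_trans (le_of_eq ?_) this
    field_simp
  linarith

/-- The `d` members of `C` outside `A` can be exchanged one by one for members of `A`, with a loss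
of at most `δ * opt / k` each time. -/
theorem IsInstance.exists_subset_of_exchange {k r : ℕ} {φ ε δ : ℝ} (h : IsInstance V k r φ ε)
    {A : Finset (Fin m)} (hA : A.Nonempty) (hδ : 0 < δ)
    (hK : (k : ℝ) * r * (φ + 1) / δ ≤ A.card)
    (htop : ∀ i ∈ A, ∀ j ∉ A, (V j).card ≤ (V i).card) (d : ℕ) :
    ∀ C : Finset (Fin m), C.card ≤ k → (C \ A).card = d →
      ∃ B ⊆ A, B.card ≤ k ∧
        ((uniqueCover V C).card : ℝ) - d * (δ * opt V k / k) ≤ (uniqueCover V B).card := by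
  induction d with
  | zero =>
    intro C hC hd
    rw [card_eq_zero, sdiff_eq_empty_iff_subset] at hd
    exact ⟨C, hd, hC, by simp⟩
  | succ d ih =>
    intro C hC hd
    obtain ⟨T, hT⟩ := card_pos.1 (by omega : 0 < (C \ A).card)
    obtain ⟨hTC, hTA⟩ := mem_sdiff.1 hT
    obtain ⟨S, hS, hov⟩ := h.exists_small_overlap hC hA hδ hK
    have hex := card_uniqueCover_exchange V C S T
    have hle := htop S hS T hTA
    obtain ⟨B, hBA, hBk, hB⟩ := ih (insert S (C.erase T))
      ((card_insert_le _ _).trans (by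
        rw [card_erase_of_mem hTC]
        have := card_pos.2 ⟨T, hTC⟩
        omega))
      (by rw [insert_sdiff_of_mem _ hS, erase_sdiff_comm, card_erase_of_mem hT, hd]; rfl)
    refine ⟨B, hBA, hBk, le_trans ?_ hB⟩
    have h1 : ((uniqueCover V C).card : ℝ) ≤ (uniqueCover V (insert S (C.erase T))).card +
        ((V S ∩ cover V C).card + (V S ∩ uniqueCover V C).card : ℕ) := by
      exact_mod_cast (by omega : (uniqueCover V C).card ≤
        (uniqueCover V (insert S (C.erase T))).card +
        ((V S ∩ cover V C).card + (V S ∩ uniqueCover V C).card))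
    push_cast at h1 hov ⊢
    linarith

/-- A kernel of `K ≥ k r (φ + 1) / δ` largest sets contains a `(1 - δ)`-approximation. -/
theorem IsInstance.exists_approx_of_isTopSets {k r K : ℕ} {φ ε δ : ℝ} (h : IsInstance V k r φ ε)
    (hδ : 0 < δ) (hK : (k : ℝ) * r * (φ + 1) / δ ≤ K) {A : Finset (Fin m)}
    (hA : IsTopSets V K A) : ∃ B ⊆ A, IsApprox V k δ B := by
  obtain ⟨C, hC, hopt⟩ := exists_card_uniqueCover_eq_opt V k
  have hk : (0 : ℝ) < k := by have := h.two_le_k; positivity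
  have hr : (0 : ℝ) < r := by have := h.two_le_r; positivity
  have hφ := h.one_le_ratio
  rcases le_total m K with hm | hm
  · have : A = univ := by
      rw [← card_eq_iff_eq_univ, hA.1, min_eq_right hm, Fintype.card_fin]
    refine ⟨C, this ▸ subset_univ C, hC, ?_⟩
    rw [hopt]
    have : (0 : ℝ) ≤ δ * opt V k := by positivity
    linarith
  · have hcard : A.card = K := by rw [hA.1, min_eq_left hm]
    rw [← hcard] at hK
    have hpos : (0 : ℝ) < A.card := lt_of_lt_of_le (by positivity) hK
    obtain ⟨B, hBA, hBk, hB⟩ := h.exists_subset_of_exchange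
      (card_pos.1 (by exact_mod_cast hpos)) hδ hK hA.2 _ C hC rfl
    refine ⟨B, hBA, hBk, le_trans ?_ hB⟩
    have hd : ((C \ A).card : ℝ) ≤ k := by
      exact_mod_cast (card_le_card sdiff_subset).trans hC
    have := mul_le_mul_of_nonneg_right hd (by positivity : (0 : ℝ) ≤ δ * opt V k / k)
    rw [mul_div_cancel₀ _ hk.ne'] at this
    rw [hopt]
    linarith

theorem IsInstance.isApprox_of_isUniqueTopSetsOutput {k r : ℕ} {φ ε : ℝ}
    (h : IsInstance V k r φ ε) {B : Finset (Fin m)}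
    (hB : IsUniqueTopSetsOutput V k (kernelSize k r φ ε) B) : IsApprox V k ε B := by
  obtain ⟨A, hA, -, hBk, hmax⟩ := hB
  obtain ⟨Q, hQA, hQk, hQ⟩ := h.exists_approx_of_isTopSets h.eps_pos (Nat.le_ceil _) hA
  exact ⟨hBk, hQ.trans (by exact_mod_cast hmax Q hQA hQk)⟩

/-! ### Counting small subcollections -/

/-- `∑_{i ≤ k} C(N, i) ≤ (e N / k)^k`, by comparing with the expansion of `(1 + k / N)^N`. -/
theorem sum_choose_le {N k : ℕ} (hk : 0 < k) (hkN : k ≤ N) :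
    ((∑ i ∈ range (k + 1), N.choose i : ℕ) : ℝ) ≤ (Real.exp 1 * N / k) ^ k := by
  have hk' : (0 : ℝ) < k := by positivity
  have hN : (0 : ℝ) < N := by exact_mod_cast hk.trans_le hkN
  have hq : (k : ℝ) / N ≤ 1 := by
    rw [div_le_one hN]
    exact_mod_cast hkN
  have h1 : ((k : ℝ) / N) ^ k * ((∑ i ∈ range (k + 1), N.choose i : ℕ) : ℝ) ≤
      (1 + (k : ℝ) / N) ^ N := by
    rw [add_comm (1 : ℝ), add_pow, Nat.cast_sum, mul_sum]
    refine (sum_le_sum fun i hi => ?_).trans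
      (sum_le_sum_of_subset_of_nonneg (range_mono (by omega : k + 1 ≤ N + 1))
        fun _ _ _ => by positivity)
    rw [one_pow, mul_one]
    exact mul_le_mul_of_nonneg_right (pow_le_pow_of_le_one (by positivity) hq
      (by have := mem_range.1 hi; omega)) (by positivity)
  have h2 : (1 + (k : ℝ) / N) ^ N ≤ Real.exp 1 ^ k := by
    have : 1 + (k : ℝ) / N ≤ Real.exp (k / N) := by
      have := Real.add_one_le_exp ((k : ℝ) / N)
      linarith
    refine (pow_le_pow_left₀ (by positivity) this N).trans (le_of_eq ?_)
    rw [← Real.exp_nat_mul, ← Real.exp_nat_mul]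
    congr 1
    field_simp
  have h3 := h1.trans h2
  rw [mul_div_assoc, mul_pow, ← inv_div (k : ℝ) N, inv_pow, ← div_eq_mul_inv,
    le_div_iff₀ (by positivity)]
  linarith

theorem card_filter_powerset_card_le {α : Type*} [DecidableEq α] (A : Finset α) (k : ℕ) :
    (A.powerset.filter fun Q => Q.card ≤ k).card = ∑ i ∈ range (k + 1), A.card.choose i := by
  rw [card_eq_sum_card_fiberwise (f := card) (t := range (k + 1))
    (fun Q hQ => by
      have := (mem_filter.1 (mem_coe.1 hQ)).2
      simp only [coe_range, Set.mem_Iio]; omega)]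
  refine sum_congr rfl fun i hi => ?_
  rw [← card_powersetCard]
  congr 1
  ext Q
  have := mem_range.1 hi
  simp only [mem_filter, mem_powerset, mem_powersetCard]
  exact ⟨fun h => ⟨h.1.1, h.2⟩, fun h => ⟨⟨h.1, by omega⟩, h.2⟩⟩

end MUC

/-! ### Tail bounds for limited independence -/

namespace Hashing

open Finset

variable {Ω ι K : Type} [Fintype Ω] [Fintype ι] [DecidableEq ι] [Fintype K] [DecidableEq K]

/-- The family of functions `h ω : ι → K`, for uniformly random `ω`, is `t`-wise independent with
uniform values: every pattern of values on at most `t` points is taken equally often. -/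
def IsWiseUniform (t : ℕ) (h : Ω → ι → K) : Prop :=
  ∀ D : Finset ι, D.card ≤ t → ∀ y : D → K,
    (univ.filter fun ω => ∀ i : D, h ω i = y i).card * Fintype.card K ^ D.card = Fintype.card Ω

/-- A uniformly random function is `t`-wise independent for every `t`. -/
theorem isWiseUniform_id (t : ℕ) : IsWiseUniform t (fun g : ι → K => g) := by
  intro D _ y
  have e : (univ.filter fun g : ι → K => ∀ i : D, g i = y i) =
      Fintype.piFinset fun i => if h : i ∈ D then {y ⟨i, h⟩} else univ := by
    ext g
    simp only [mem_filter, mem_univ, true_and, Fintype.mem_piFinset]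
    constructor
    · intro h i
      split_ifs with hi
      · exact mem_singleton.2 (h ⟨i, hi⟩)
      · exact mem_univ _
    · rintro h ⟨i, hi⟩
      have := h i
      rw [dif_pos hi] at this
      exact mem_singleton.1 this
  rw [e, Fintype.card_piFinset]
  have : ∀ i, (if h : i ∈ D then ({y ⟨i, h⟩} : Finset K) else univ).card =
      if i ∈ D then 1 else Fintype.card K := fun i => by split_ifs <;> simp [card_univ]
  simp_rw [this]
  rw [prod_ite]
  simp only [prod_const_one, one_mul, prod_const, Fintype.card_fun]
  rw [← pow_add]
  congr 1
  have := card_filter_add_card_filter_not (s := (univ : Finset ι)) (fun i => i ∈ D)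
  rw [filter_mem_eq_inter, univ_inter, card_univ] at this
  omega

/-- The moments of order `t` are the same for all `t`-wise uniform families. -/
theorem IsWiseUniform.sum_pow_eq {t : ℕ} {h : Ω → ι → K} (hh : IsWiseUniform t h) (X : K → ℝ)
    (U : Finset ι) (hK : 0 < Fintype.card K) :
    (∑ ω, (∑ i ∈ U, X (h ω i)) ^ t) * (Fintype.card K : ℝ) ^ Fintype.card ι =
      (∑ g : ι → K, (∑ i ∈ U, X (g i)) ^ t) * Fintype.card Ω := by
  have key : ∀ {Ω' : Type} [Fintype Ω'] (h' : Ω' → ι → K), IsWiseUniform t h' →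
      ∀ p : Fin t → ι, (∑ ω, ∏ j, X (h' ω (p j))) *
        (Fintype.card K : ℝ) ^ (univ.image p).card = Fintype.card Ω' *
        ∑ y : univ.image p → K, ∏ j, X (y ⟨p j, mem_image_of_mem p (mem_univ j)⟩) := by
    intro Ω' _ h' hh' p
    have hc := hh' (univ.image p) (card_image_le.trans (by simp))
    rw [← sum_fiberwise univ (fun ω => fun i : univ.image p => h' ω i)
      (fun ω => ∏ j, X (h' ω (p j))), sum_mul, mul_sum]
    refine sum_congr rfl fun y _ => ?_
    rw [← hc y, sum_congr rfl (g := fun _ => ∏ j, X (y ⟨p j, mem_image_of_mem p (mem_univ j)⟩))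
      (fun ω hω => by
        refine prod_congr rfl fun j _ => ?_
        rw [← (mem_filter.1 hω).2])]
    rw [sum_const, nsmul_eq_mul]
    have : (univ.filter fun ω => (fun i : univ.image p => h' ω i) = y) =
        univ.filter fun ω => ∀ i : univ.image p, h' ω i = y i :=
      filter_congr fun ω _ => funext_iff
    rw [this]
    push_cast
    ring
  have hK' : (Fintype.card K : ℝ) ≠ 0 := by positivity
  simp_rw [sum_pow']
  rw [sum_comm, sum_comm (s := (univ : Finset (ι → K))), sum_mul, sum_mul]
  refine sum_congr rfl fun p _ => ?_
  have h1 := key h hh p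
  have h2 := key (fun g : ι → K => g) (isWiseUniform_id t) p
  rw [Fintype.card_fun] at h2
  refine mul_right_cancel₀ (pow_ne_zero (univ.image p).card hK') ?_
  push_cast at h2
  linear_combination (Fintype.card K : ℝ) ^ Fintype.card ι * h1 - (Fintype.card Ω : ℝ) * h2

/-- The moment generating function of a centered Bernoulli variable, by `e ^ x ≤ 1 + x + x ^ 2` for
`|x| ≤ 1`. -/
theorem sum_exp_centered_le (G : Finset K) (hK : 0 < Fintype.card K) {l : ℝ} (hl : |l| ≤ 1) :
    ∑ y, Real.exp (l * ((if y ∈ G then 1 else 0) - (G.card : ℝ) / Fintype.card K)) ≤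
      Fintype.card K * Real.exp (l ^ 2 * ((G.card : ℝ) / Fintype.card K)) := by
  set N : ℝ := ((Fintype.card K : ℕ) : ℝ) with hN
  have hN0 : 0 < N := by rw [hN]; exact_mod_cast hK
  set p : ℝ := (G.card : ℝ) / N with hp
  have hp0 : 0 ≤ p := by positivity
  have hp1 : p ≤ 1 := by
    rw [hp, div_le_one hN0, hN]
    exact_mod_cast card_le_univ G
  have hG : (G.card : ℝ) = p * N := (div_mul_cancel₀ _ hN0.ne').symm
  have hpt : ∀ y : K, Real.exp (l * ((if y ∈ G then 1 else 0) - p)) ≤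
      1 - l * p + l ^ 2 * p ^ 2 + (if y ∈ G then 1 else 0) * (l + l ^ 2 * (1 - 2 * p)) := by
    intro y
    have habs : |l * ((if y ∈ G then 1 else 0) - p)| ≤ 1 := by
      rw [abs_mul]
      refine mul_le_one₀ hl (abs_nonneg _) ?_
      rw [abs_le]
      split_ifs <;> constructor <;> linarith
    have := (abs_le.1 (Real.abs_exp_sub_one_sub_id_le habs)).2
    refine le_trans (by linarith : _ ≤ 1 + l * ((if y ∈ G then 1 else 0) - p) +
      (l * ((if y ∈ G then 1 else 0) - p)) ^ 2) (le_of_eq ?_)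
    split_ifs <;> ring
  clear_value p
  refine (sum_le_sum fun y _ => hpt y).trans ?_
  rw [sum_add_distrib, ← sum_mul, sum_const, sum_boole, nsmul_eq_mul, filter_mem_eq_inter,
    univ_inter, card_univ, ← hN, hG]
  have h1 : 1 + l ^ 2 * p ≤ Real.exp (l ^ 2 * p) := by
    have := Real.add_one_le_exp (l ^ 2 * p)
    linarith
  refine le_trans ?_ (mul_le_mul_of_nonneg_left h1 hN0.le)
  have : 0 ≤ N * (l ^ 2 * p ^ 2) := by positivity
  linarith

/-- The moment generating function of a sum of independent centered Bernoulli variables. -/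
theorem sum_exp_sum_centered_le (G : Finset K) (hK : 0 < Fintype.card K) (U : Finset ι) {l : ℝ}
    (hl : |l| ≤ 1) :
    ∑ g : ι → K, Real.exp (l * ∑ i ∈ U,
        ((if g i ∈ G then 1 else 0) - (G.card : ℝ) / Fintype.card K)) ≤
      (Fintype.card K : ℝ) ^ Fintype.card ι *
        Real.exp (l ^ 2 * ((G.card : ℝ) / Fintype.card K * U.card)) := by
  set p : ℝ := (G.card : ℝ) / Fintype.card K with hp
  have h1 : ∀ g : ι → K, Real.exp (l * ∑ i ∈ U, ((if g i ∈ G then 1 else 0) - p)) =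
      ∏ i, if i ∈ U then Real.exp (l * ((if g i ∈ G then 1 else 0) - p)) else 1 := by
    intro g
    rw [mul_sum, Real.exp_sum, prod_ite_mem, univ_inter]
  simp_rw [h1]
  have h2 := prod_univ_sum (fun _ : ι => (univ : Finset K))
    (fun i y => if i ∈ U then Real.exp (l * ((if y ∈ G then 1 else 0) - p)) else 1)
  rw [Fintype.piFinset_univ] at h2
  rw [← h2]
  have h3 : ∀ i : ι, (∑ y : K, if i ∈ U then Real.exp (l * ((if y ∈ G then 1 else 0) - p)) else 1) ≤
      Fintype.card K * if i ∈ U then Real.exp (l ^ 2 * p) else 1 := by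
    intro i
    split_ifs
    · exact sum_exp_centered_le G hK hl
    · simp [card_univ]
  refine (prod_le_prod (fun i _ => sum_nonneg fun y _ => by split_ifs <;> positivity)
    fun i _ => h3 i).trans (le_of_eq ?_)
  rw [prod_mul_distrib, prod_const, card_univ, prod_ite_mem, univ_inter, prod_const,
    ← Real.exp_nat_mul]
  congr 2
  ring

theorem pow_le_factorial_mul_exp {t : ℕ} (ht : Even t) (y : ℝ) :
    y ^ t ≤ t.factorial * (Real.exp y + Real.exp (-y)) := by
  have h1 := Real.pow_div_factorial_le_exp |y| (abs_nonneg y) t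
  rw [div_le_iff₀ (by positivity), ht.pow_abs, mul_comm] at h1
  refine h1.trans (mul_le_mul_of_nonneg_left ?_ (by positivity))
  rcases abs_cases y with h | h <;> rw [h.1] <;> have := Real.exp_pos y <;>
    have := Real.exp_pos (-y) <;> linarith

/-- The tail bound for `t`-wise independent sampling, by the moment of order `t`. This moment agrees
with that of the fully independent case, where exponential moments give an estimate. -/
theorem IsWiseUniform.tail_le {t : ℕ} (ht : Even t) (ht0 : 0 < t) {h : Ω → ι → K}
    (hh : IsWiseUniform t h)
    (hK : 0 < Fintype.card K) (G : Finset K) (U : Finset ι) {μ D : ℝ}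
    (hμ : (G.card : ℝ) / Fintype.card K * U.card ≤ μ) (hD : 6 * t ≤ D) (hDμ : 36 * t * μ ≤ D ^ 2) :
    ((univ.filter fun ω => D ≤ |((U.filter fun i => h ω i ∈ G).card : ℝ) -
      (G.card : ℝ) / Fintype.card K * U.card|).card : ℝ) ≤ 2 * (1 / 2) ^ t * Fintype.card Ω := by
  set p : ℝ := (G.card : ℝ) / Fintype.card K with hp
  have hK' : (0 : ℝ) < Fintype.card K := by exact_mod_cast hK
  have ht' : (0 : ℝ) < t := by exact_mod_cast ht0
  have hD0 : 0 < D := by linarith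
  -- scaled by `l`, a deviation of `D` becomes `6 t`, while the exponent `l ^ 2 * μ` is at most `t`
  set l : ℝ := 6 * t / D with hl
  have hl0 : 0 < l := by positivity
  have hlD : l * D = 6 * t := by rw [hl]; field_simp
  have hl1 : |l| ≤ 1 := by
    rw [abs_of_pos hl0, hl, div_le_one hD0]
    exact hD
  have hlμ : l ^ 2 * (p * U.card) ≤ t := by
    refine (mul_le_mul_of_nonneg_left hμ (by positivity)).trans ?_
    rw [hl, div_pow, div_mul_eq_mul_div, div_le_iff₀ (by positivity)]
    nlinarith
  set X : K → ℝ := fun y => l * ((if y ∈ G then 1 else 0) - p) with hX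
  have hY : ∀ g : ι → K, ∑ i ∈ U, X (g i) =
      l * (((U.filter fun i => g i ∈ G).card : ℝ) - p * U.card) := by
    intro g
    rw [hX, ← mul_sum, sum_sub_distrib, sum_boole, sum_const, nsmul_eq_mul, mul_comm p]
  -- the moment of order `t`
  have hmom : ∑ ω, (∑ i ∈ U, X (h ω i)) ^ t ≤
      t.factorial * (2 * Real.exp t) * Fintype.card Ω := by
    have heq := hh.sum_pow_eq X U hK
    have hfull : ∑ g : ι → K, (∑ i ∈ U, X (g i)) ^ t ≤
        t.factorial * (2 * Real.exp t) * (Fintype.card K : ℝ) ^ Fintype.card ι := by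
      refine (sum_le_sum fun g _ => pow_le_factorial_mul_exp ht _).trans ?_
      rw [← mul_sum, sum_add_distrib, mul_assoc]
      refine mul_le_mul_of_nonneg_left ?_ (by positivity)
      have e1 : ∑ g : ι → K, Real.exp (∑ i ∈ U, X (g i)) ≤
          (Fintype.card K : ℝ) ^ Fintype.card ι * Real.exp t := by
        simp_rw [hX, ← mul_sum]
        exact (sum_exp_sum_centered_le G hK U hl1).trans
          (mul_le_mul_of_nonneg_left (Real.exp_le_exp.2 hlμ) (by positivity))
      have e2 : ∑ g : ι → K, Real.exp (-∑ i ∈ U, X (g i)) ≤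
          (Fintype.card K : ℝ) ^ Fintype.card ι * Real.exp t := by
        simp_rw [hX, ← mul_sum, ← neg_mul]
        refine (sum_exp_sum_centered_le G hK U (l := -l) (by rwa [abs_neg])).trans
          (mul_le_mul_of_nonneg_left (Real.exp_le_exp.2 ?_) (by positivity))
        rwa [neg_sq]
      linarith
    have := mul_le_mul_of_nonneg_right hfull (by positivity : (0 : ℝ) ≤ Fintype.card Ω)
    rw [← heq] at this
    refine le_of_mul_le_mul_right (this.trans (le_of_eq (by ring)))
      (by positivity : (0 : ℝ) < (Fintype.card K : ℝ) ^ Fintype.card ι)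
  set S := univ.filter fun ω => D ≤ |((U.filter fun i => h ω i ∈ G).card : ℝ) - p * U.card| with hS
  have hmarkov : (S.card : ℝ) * (6 * t) ^ t ≤ ∑ ω, (∑ i ∈ U, X (h ω i)) ^ t := by
    rw [← nsmul_eq_mul, ← sum_const]
    refine (sum_le_sum fun ω hω => ?_).trans
      (sum_le_sum_of_subset_of_nonneg (subset_univ S) fun ω _ _ => ht.pow_nonneg _)
    rw [hY, ← ht.pow_abs (l * _), abs_mul, abs_of_pos hl0, ← hlD]
    exact pow_le_pow_left₀ (by positivity)
      (mul_le_mul_of_nonneg_left (mem_filter.1 hω).2 hl0.le) t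
  have hfac : (t.factorial : ℝ) ≤ (t : ℝ) ^ t := by exact_mod_cast Nat.factorial_le_pow t
  have hexp : Real.exp t ≤ 3 ^ t := by
    rw [← mul_one (t : ℝ), Real.exp_nat_mul]
    exact pow_le_pow_left₀ (by positivity) (by have := Real.exp_one_lt_d9; linarith) t
  -- `t! * (2 * e ^ t) / (6 t) ^ t ≤ 2 * (3 / 6) ^ t`
  have hfin : (S.card : ℝ) * (6 * t) ^ t ≤ (t : ℝ) ^ t * (2 * 3 ^ t) * Fintype.card Ω := by
    refine hmarkov.trans (hmom.trans ?_)
    gcongr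
  refine le_of_mul_le_mul_right (hfin.trans (le_of_eq ?_)) (by positivity : (0 : ℝ) < (6 * t) ^ t)
  rw [mul_pow, show (6 : ℝ) = 2 * 3 by norm_num, mul_pow 2 3, one_div, inv_pow]
  field_simp

/-! ### Polynomial hashing -/

/-- The value at `x` of the polynomial whose coefficients, leading one first, are listed in `l`,
modulo `q`, by the rule of Horner. -/
def horner (q : ℕ) (l : List ℕ) (x : ℕ) : ℕ := l.foldl (fun h c => (h * x + c) % q) 0

theorem horner_lt {q : ℕ} (hq : 0 < q) (l : List ℕ) (x : ℕ) : horner q l x < q := by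
  unfold horner
  rcases List.eq_nil_or_concat l with rfl | ⟨l, c, rfl⟩
  · exact hq
  · rw [List.concat_eq_append, List.foldl_append]
    exact Nat.mod_lt _ hq

theorem foldl_ofFn_eq_sum {R : Type} [CommSemiring R] {t : ℕ} (s : Fin t → R) (x : R) :
    (List.ofFn s).foldl (fun h c => h * x + c) 0 = ∑ j, s j * x ^ (j.rev : ℕ) := by
  induction t with
  | zero => simp
  | succ t ih =>
    rw [List.ofFn_succ', List.concat_eq_append, List.foldl_append, ih, Fin.sum_univ_castSucc]
    simp only [List.foldl_cons, List.foldl_nil, sum_mul, Fin.rev_castSucc, Fin.val_succ, pow_succ,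
      mul_assoc, Fin.rev_last, Fin.val_zero, pow_zero, mul_one]

theorem horner_cast (q : ℕ) (l : List ℕ) (x : ℕ) :
    ((horner q l x : ℕ) : ZMod q) = (l.map (Nat.cast : ℕ → ZMod q)).foldl
      (fun h c => h * (x : ZMod q) + c) 0 := by
  unfold horner
  have : ∀ (a : ℕ), ((l.foldl (fun h c => (h * x + c) % q) a : ℕ) : ZMod q) =
      (l.map (Nat.cast : ℕ → ZMod q)).foldl (fun h c => h * (x : ZMod q) + c) (a : ZMod q) := by
    induction l with
    | nil => intro a; rfl
    | cons c l ih =>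
      intro a
      rw [List.foldl_cons, ih, List.map_cons, List.foldl_cons, ZMod.natCast_mod]
      push_cast
      rfl
  simpa using this 0

/-- Polynomials of degree less than `t` over a field are `t`-wise independent: by Lagrange
interpolation, evaluation at `t` points or fewer is surjective. -/
theorem isWiseUniform_poly {F J : Type} [DecidableEq J] [Field F] [Fintype F] [DecidableEq F]
    {t : ℕ} (v : J → F)
    (hv : Function.Injective v) :
    IsWiseUniform t (fun (s : Fin t → F) (i : J) => ∑ j, s j * v i ^ (j.rev : ℕ)) := by
  intro D hD y
  set f : (Fin t → F) →+ (D → F) :=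
    { toFun := fun s i => ∑ j, s j * v i ^ (j.rev : ℕ)
      map_zero' := by ext i; simp
      map_add' := fun a b => by ext i; simp [add_mul, sum_add_distrib] } with hf
  have hsurj : Function.Surjective f := by
    intro z
    set P := Lagrange.interpolate (univ : Finset D) (fun i : D => v i) z with hP
    have hinj : Set.InjOn (fun i : D => v i) (univ : Finset D) :=
      fun a _ b _ hab => Subtype.ext (hv hab)
    have hdeg : P.degree < t := by
      refine (Lagrange.degree_interpolate_lt z hinj).trans_le ?_
      rw [card_univ, Fintype.card_coe]
      exact_mod_cast hD
    refine ⟨fun j => P.coeff (j.rev : ℕ), ?_⟩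
    funext i
    have hev := Lagrange.eval_interpolate_at_node z hinj (mem_univ i)
    rw [← hev, ← hP]
    change ∑ j : Fin t, P.coeff (j.rev : ℕ) * v i ^ (j.rev : ℕ) = _
    rw [Fintype.sum_equiv Fin.revPerm (fun j : Fin t => P.coeff (j.rev : ℕ) * v i ^ (j.rev : ℕ))
      (fun j : Fin t => P.coeff (j : ℕ) * v i ^ (j : ℕ)) (fun j => rfl),
      Fin.sum_univ_eq_sum_range (fun j => P.coeff j * v i ^ j) t]
    symm
    by_cases hP0 : P = 0
    · simp [hP0]
    · exact Polynomial.eval_eq_sum_range' ((Polynomial.natDegree_lt_iff_degree_lt hP0).2 hdeg) _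
  -- the fibres of a surjective homomorphism have equal size
  have hfib : ∀ z, (univ.filter fun s => f s = z).card = (univ.filter fun s => f s = 0).card := by
    intro z
    obtain ⟨s₀, rfl⟩ := hsurj z
    refine card_bij (fun s _ => s - s₀) ?_ ?_ ?_
    · intro s hs
      simp only [mem_filter, mem_univ, true_and] at hs ⊢
      rw [map_sub, hs, sub_self]
    · intro a _ b _ hab
      simpa using hab
    · intro b hb
      simp only [mem_filter, mem_univ, true_and] at hb
      exact ⟨b + s₀, by simp [hb], by simp⟩
  have htot := card_eq_sum_card_fiberwise (s := (univ : Finset (Fin t → F))) (f := f)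
    (t := univ) (fun _ _ => mem_coe.2 (mem_univ _))
  rw [sum_congr rfl fun z _ => hfib z, sum_const, card_univ, card_univ, ← hfib y,
    smul_eq_mul] at htot
  rw [htot, mul_comm, Fintype.card_fun, Fintype.card_coe]
  congr 2
  ext s
  simp only [mem_filter, mem_univ, true_and]
  exact funext_iff.symm

end Hashing

/-! ### Counted loops -/

namespace Machine

open Finset

variable {Γ : List Ty} {ρ σ τ υ : Ty}

/-- The variable `v`, seen inside the body of a counted loop. -/
abbrev Var.up3 (v : Var Γ τ) : Var (ρ :: σ :: υ :: Γ) τ := v.succ.succ.succ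

/-- The innermost variable, as a program. -/
abbrev v0 : Tm (τ :: Γ) τ := .var .zero

/-- The second innermost variable, as a program. -/
abbrev v1 : Tm (ρ :: τ :: Γ) τ := .var (.succ .zero)

/-- The third innermost variable, as a program. -/
abbrev v2 : Tm (ρ :: σ :: τ :: Γ) τ := .var (.succ (.succ .zero))

/-- `iter f a j` applies `f 0`, …, `f (j - 1)` in this order to `a`. -/
def iter {α : Type} (f : ℕ → α → α) (a : α) : ℕ → α
  | 0 => a
  | j + 1 => f j (iter f a j)

@[simp] theorem iter_zero {α : Type} (f : ℕ → α → α) (a : α) : iter f a 0 = a := rfl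

@[simp] theorem iter_succ {α : Type} (f : ℕ → α → α) (a : α) (j : ℕ) :
    iter f a (j + 1) = f j (iter f a j) := rfl

/-- A loop with a counter: `body` may use the counter, the accumulator and, as a third variable,
the pair of both. -/
def forN (N : Tm Γ .nat) (init : Tm Γ τ) (body : Tm (.nat :: τ :: .prod .nat τ :: Γ) τ) :
    Tm Γ τ :=
  .snd (.loop N (.pair (.lit 0) init)
    (.bind (.snd v0) (.bind (.fst v1) (.pair (.op .add v0 (.lit 1)) body))))

/-- The accumulator of a counted loop before round `j`. -/
def forAcc (inp : ℕ → ℕ) (init : Tm Γ τ) (body : Tm (.nat :: τ :: .prod .nat τ :: Γ) τ)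
    (e : Env Γ) (j : ℕ) : τ.Val :=
  iter (fun x a => body.eval inp (x, a, (x, a), e)) (init.eval inp e) j

/-- The state of the loop behind `forN`, after `j` rounds. -/
theorem forN_iterate (inp : ℕ → ℕ) (init : Tm Γ τ)
    (body : Tm (.nat :: τ :: .prod .nat τ :: Γ) τ) (e : Env Γ) (j : ℕ) :
    (fun a : ℕ × τ.Val => (Tm.bind (.snd v0) (.bind (.fst v1)
      (.pair (.op .add v0 (.lit 1)) body)) :
        Tm (.prod .nat τ :: Γ) (.prod .nat τ)).eval inp (a, e))^[j]
      (0, init.eval inp e) = (j, forAcc inp init body e j) := by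
  induction j with
  | zero => rfl
  | succ j ih =>
    rw [Function.iterate_succ_apply', ih]
    rfl

theorem forN_eval (inp : ℕ → ℕ) (N : Tm Γ .nat) (init : Tm Γ τ)
    (body : Tm (.nat :: τ :: .prod .nat τ :: Γ) τ) (e : Env Γ) :
    (forN N init body).eval inp e = forAcc inp init body e (N.eval inp e) := by
  have := forN_iterate inp init body e (N.eval inp e)
  simp only [forN, Tm.eval] at this ⊢
  rw [this]

/-! ### Bit lengths of values, and the space of counted loops -/

theorem bits_nat (a : ℕ) : Ty.nat.bits a = 2 * Nat.size a + 1 := rfl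

theorem bits_nat_mono {a b : ℕ} (h : a ≤ b) : Ty.nat.bits a ≤ Ty.nat.bits b := by
  rw [bits_nat, bits_nat]
  have := Nat.size_le_size h
  omega

theorem bits_prod (a : σ.Val) (b : τ.Val) :
    (Ty.prod σ τ).bits (a, b) = σ.bits a + τ.bits b := rfl

theorem bits_nil : (Ty.list τ).bits [] = 1 := rfl

theorem bits_cons (x : τ.Val) (l : List τ.Val) :
    (Ty.list τ).bits (x :: l) = 1 + τ.bits x + (Ty.list τ).bits l := by
  simp only [Ty.bits, List.map_cons, List.sum_cons]
  omega

theorem bits_append (l l' : List τ.Val) :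
    (Ty.list τ).bits (l ++ l') + 1 = (Ty.list τ).bits l + (Ty.list τ).bits l' := by
  simp only [Ty.bits, List.map_append, List.sum_append]
  omega

theorem one_le_bits_list (l : List τ.Val) : 1 ≤ (Ty.list τ).bits l := by
  simp only [Ty.bits]
  omega

theorem bits_le_of_mem {x : τ.Val} {l : List τ.Val} (h : x ∈ l) :
    τ.bits x ≤ (Ty.list τ).bits l := by
  obtain ⟨s, t, rfl⟩ := List.append_of_mem h
  have h1 := bits_append s (x :: t)
  have h2 := one_le_bits_list s
  have h3 := bits_cons x t
  omega

theorem bits_list_le {b : ℕ} {l : List τ.Val} (h : ∀ x ∈ l, τ.bits x ≤ b) :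
    (Ty.list τ).bits l ≤ l.length * (b + 1) + 1 := by
  induction l with
  | nil => exact le_of_eq (by simp [bits_nil])
  | cons x l ih =>
    have h1 := h x (by simp)
    have h2 := ih fun y hy => h y (by simp [hy])
    rw [bits_cons, List.length_cons, add_mul]
    omega

theorem bits_list_le_of_sublist {l l' : List τ.Val} (h : l.Sublist l') :
    (Ty.list τ).bits l ≤ (Ty.list τ).bits l' := by
  simp only [Ty.bits]
  exact Nat.add_le_add_right ((h.map _).sum_le_sum fun _ _ => Nat.zero_le _) 1

/-- A bound for the peak of a fold, from a bound for each round. The state before the round of `x`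
comes from a prefix `p` of the list. -/
theorem foldMax_le {α β : Type} (f : β → α → β) (c : β → α → ℕ) {W : ℕ} (a : β) (l : List α)
    (h : ∀ p x, (p ++ [x]) <+: l → c (p.foldl f a) x ≤ W) : foldMax f c a l ≤ W := by
  induction l generalizing a with
  | nil => exact Nat.zero_le _
  | cons x l ih =>
    refine max_le (h [] x (by simp)) (ih _ fun p y hp => ?_)
    exact h (x :: p) y (by simpa using hp)

/-- The space of a counted loop is bounded by that of its rounds. The counter and the accumulator
are held at the same time; the literal `1` is held as well, whence the maximum. -/
theorem forN_peak_le {inp : ℕ → ℕ} {N : Tm Γ .nat} {init : Tm Γ τ}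
    {body : Tm (.nat :: τ :: .prod .nat τ :: Γ) τ} {e : Env Γ} {W R : ℕ} (hR : N.eval inp e = R)
    (hN : N.peak inp e ≤ W) (hinit : init.peak inp e ≤ W)
    (hacc : ∀ j ≤ R,
      Ty.nat.bits (max j 1) + τ.bits (forAcc inp init body e j) ≤ W)
    (hbody : ∀ j < R, body.peak inp (j, forAcc inp init body e j,
      (j, forAcc inp init body e j), e) ≤ W) : (forN N init body).peak inp e ≤ W := by
  have hacc' : ∀ j ≤ R, Ty.nat.bits j + τ.bits (forAcc inp init body e j) ≤ W :=
    fun j hj => (Nat.add_le_add_right (bits_nat_mono (le_max_left _ _)) _).trans (hacc j hj)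
  have h1 : ∀ j ≤ R, Ty.nat.bits 1 ≤ W := fun j hj =>
    (bits_nat_mono (le_max_right j 1)).trans ((Nat.le_add_right _ _).trans (hacc j hj))
  have h0 := hacc' 0 (Nat.zero_le _)
  have hit := forN_iterate inp init body e
  simp only [Tm.eval, Var.get] at hit
  simp only [forN, Tm.peak, Tm.eval, Var.get, max_le_iff, Finset.sup_le_iff, Finset.mem_range,
    hit, hR]
  refine ⟨⟨hN, ?_, ?_, hinit⟩, fun j hj => ?_⟩
  · exact h0
  · exact (Nat.le_add_right _ _).trans h0
  · have hj' := hacc' j hj.le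
    have hj'' := hacc' (j + 1) hj
    have hj1 := h1 j hj.le
    refine ⟨hj', ⟨hj', ?_, ⟨?_, ?_, hj1⟩, hbody j hj⟩⟩
    · exact hj''
    · exact (Nat.le_add_right _ _).trans hj''
    · exact (Nat.le_add_right _ _).trans hj'

/-! ### The running time of counted loops -/

theorem size_le_self (a : ℕ) : Nat.size a ≤ a := Nat.size_le.2 Nat.lt_two_pow_self

theorem foldSum_le {α β : Type} (f : β → α → β) (c : β → α → ℕ) {B : ℕ} (a : β) (l : List α)
    (h : ∀ p x, (p ++ [x]) <+: l → c (p.foldl f a) x ≤ B) : foldSum f c a l ≤ l.length * B := by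
  induction l generalizing a with
  | nil => exact Nat.zero_le _
  | cons x l ih =>
    have h1 := h [] x (by simp)
    have h2 := ih (f a x) fun p y hp => h (x :: p) y (by simpa using hp)
    simp only [foldSum, List.length_cons, add_mul, List.foldl_nil] at h1 h2 ⊢
    omega

theorem forN_time_le {inp : ℕ → ℕ} {N : Tm Γ .nat} {init : Tm Γ τ}
    {body : Tm (.nat :: τ :: .prod .nat τ :: Γ) τ} {e : Env Γ} {B R Z : ℕ}
    (hR : N.eval inp e = R) (hZ : R ≤ Z)
    (hbody : ∀ j < R, body.time inp (j, forAcc inp init body e j,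
      (j, forAcc inp init body e j), e) ≤ B) :
    (forN N init body).time inp e ≤
      N.time inp e + init.time inp e + (Z + 1) * (B + 2 * Z + 20) := by
  have hit := forN_iterate inp init body e
  simp only [Tm.eval, Var.get] at hit
  simp only [forN, Tm.time, Tm.eval, Var.get, hit, hR]
  have hsum : (∑ j ∈ range R, (1 + 1 + (1 + 1 + (1 + 1 + (Nat.size j + 1) *
      (Nat.size 1 + 1) + body.time inp (j, forAcc inp init body e j,
        (j, forAcc inp init body e j), e) + 1) + 1) + 1 + 1)) ≤ R * (B + 2 * Z + 16) := by
    rw [← smul_eq_mul]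
    conv_rhs => rw [← card_range R]
    refine sum_le_card_nsmul _ _ _ fun j hj => ?_
    have hj := mem_range.1 hj
    have h1 := hbody j hj
    have h2 := size_le_self j
    rw [Nat.size_one]
    omega
  have h2 := size_le_self R
  have h3 : R * (B + 2 * Z + 16) ≤ Z * (B + 2 * Z + 16) := Nat.mul_le_mul_right _ hZ
  have h4 : (Z + 1) * (B + 2 * Z + 20) = Z * (B + 2 * Z + 16) + 4 * Z + (B + 2 * Z + 20) := by ring
  refine le_trans (Nat.add_le_add_right (Nat.add_le_add_left hsum _) 1) ?_
  omega

/-- Bounded by a polynomial, on positive arguments. -/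
def PolyBound (f : ℕ → ℕ) : Prop := ∃ c, ∀ z, 1 ≤ z → f z ≤ c * z ^ c

theorem PolyBound.const (a : ℕ) : PolyBound fun _ => a :=
  ⟨a, fun _ hz => Nat.le_mul_of_pos_right _ (pow_pos hz a)⟩

theorem PolyBound.id : PolyBound fun z => z := ⟨1, fun z _ => by simp⟩

theorem PolyBound.add {f g : ℕ → ℕ} (hf : PolyBound f) (hg : PolyBound g) :
    PolyBound fun z => f z + g z := by
  obtain ⟨a, ha⟩ := hf
  obtain ⟨b, hb⟩ := hg
  refine ⟨a + b, fun z hz => ?_⟩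
  have h1 := (ha z hz).trans (Nat.mul_le_mul_left a (pow_le_pow_right₀ hz (Nat.le_add_right a b)))
  have h2 := (hb z hz).trans (Nat.mul_le_mul_left b (pow_le_pow_right₀ hz (Nat.le_add_left b a)))
  rw [add_mul]
  exact Nat.add_le_add h1 h2

theorem PolyBound.mul {f g : ℕ → ℕ} (hf : PolyBound f) (hg : PolyBound g) :
    PolyBound fun z => f z * g z := by
  obtain ⟨a, ha⟩ := hf
  obtain ⟨b, hb⟩ := hg
  refine ⟨a * b + (a + b), fun z hz => ?_⟩
  refine (Nat.mul_le_mul (ha z hz) (hb z hz)).trans ?_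
  calc a * z ^ a * (b * z ^ b) = a * b * z ^ (a + b) := by ring
    _ ≤ (a * b + (a + b)) * z ^ (a * b + (a + b)) :=
      Nat.mul_le_mul (Nat.le_add_right _ _) (pow_le_pow_right₀ hz (Nat.le_add_left _ _))

end Machine

namespace Machine

open Finset

variable {Γ : List Ty}

/-! ### The program UniqueTopSets -/

/-- The size of the set with ID `i`, on a tape with the incidence matrix. -/
def setSize (i n : Var Γ .nat) : Tm Γ .nat :=
  forN (.var n) (.lit 0)
    (.op .add v1 (.read (.op .add (.op .mul (.var i.up3) (.var n.up3)) v0)))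

/-- The number of sets among the first `m` that precede the set with ID `i`, where sets come in
the order of decreasing size, and sets of the same size in the order of their IDs. -/
def setRank (i n m : Var Γ .nat) : Tm Γ .nat :=
  forN (.var m) (.lit 0)
    (.bind (setSize i.up3 n.up3) (.bind (setSize (.succ .zero) n.up3.succ)
      (.op .add (.var (.succ (.succ (.succ .zero))))
        (.ite (.op .lt v1 v0) (.lit 1)
          (.ite (.op .eq v1 v0) (.op .lt v2 (.var i.up3.succ.succ)) (.lit 0))))))

/-- The unique coverage of the subcollection with the IDs listed in `Q`. -/
def uniqueCoverage (Q : Var Γ (.list .nat)) (n : Var Γ .nat) : Tm Γ .nat :=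
  forN (.var n) (.lit 0)
    (.op .add v1 (.op .eq (.lit 1) (.fold (.var Q.up3) (.lit 0)
      (.op .add v1 (.read (.op .add (.op .mul v0 (.var n.up3.succ.succ)) v2))))))

/-- Add to a list of ID lists, each with its length, all lists of length at most `k` that arise
by adding the ID `i` to one of them. -/
def extendAll (i k : Var Γ .nat) (L : Var Γ (.list (.prod .nat (.list .nat)))) :
    Tm Γ (.list (.prod .nat (.list .nat))) :=
  .fold (.var L) (.var L)
    (.ite (.op .lt (.fst v0) (.var k.succ.succ))
      (.cons (.pair (.op .add (.fst v0) (.lit 1)) (.cons (.var i.succ.succ) (.snd v0))) v1) v1)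

/-- All lists of at most `k` IDs of sets of rank less than `K`, each with its length. -/
def allLists (n m k K : Var Γ .nat) : Tm Γ (.list (.prod .nat (.list .nat))) :=
  forN (.var m) (.cons (.pair (.lit 0) .nil) .nil)
    (.ite (.op .lt (setRank .zero n.up3 m.up3) (.var K.up3))
      (extendAll .zero k.up3 (.succ .zero)) v1)

/-- A list of maximum unique coverage, with its unique coverage. -/
def bestList (L : Var Γ (.list (.prod .nat (.list .nat)))) (n : Var Γ .nat) :
    Tm Γ (.prod .nat (.list .nat)) :=
  .fold (.var L) (.pair (.lit 0) .nil)
    (.bind (.snd v0) (.bind (uniqueCoverage .zero n.succ.succ.succ)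
      (.ite (.op .lt (.fst (.var (.succ (.succ (.succ .zero))))) v0) (.pair v0 v1)
        (.var (.succ (.succ (.succ .zero)))))))

/-- The program UniqueTopSets. Its variables are `n`, `m`, `k` and `K`. -/
def uniqueTopSets : Tm [.nat, .nat, .nat, .nat] (.list .nat) :=
  .bind (.ite (.op .lt (.var (.succ .zero)) (.var (.succ (.succ (.succ .zero)))))
      (.var (.succ .zero)) (.var (.succ (.succ (.succ .zero)))))
    (.bind (allLists (.succ .zero) (.succ (.succ .zero)) (.succ (.succ (.succ .zero))) .zero)
      (.snd (bestList .zero (.succ (.succ .zero)))))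

/-! ### The values computed by UniqueTopSets -/

theorem iter_add {f : ℕ → ℕ} (j : ℕ) :
    iter (fun x a => a + f x) 0 j = ∑ x ∈ range j, f x := by
  induction j with
  | zero => rfl
  | succ j ih => rw [iter_succ, ih, sum_range_succ]

/-- The size of the set in row `i` of the tape. -/
def rowSum (inp : ℕ → ℕ) (n i : ℕ) : ℕ := ∑ x ∈ range n, inp (i * n + x)

theorem setSize_eval (inp : ℕ → ℕ) (i n : Var Γ .nat) (e : Env Γ) :
    (setSize i n).eval inp e = rowSum inp (n.get e) (i.get e) := by
  rw [setSize, forN_eval]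
  exact iter_add (f := fun x => inp (i.get e * n.get e + x)) _

/-- The number of rows among the first `m` that precede row `i`. -/
def rowRank (inp : ℕ → ℕ) (n m i : ℕ) : ℕ :=
  ∑ j ∈ range m, if rowSum inp n i < rowSum inp n j then 1
    else if rowSum inp n i = rowSum inp n j then if j < i then 1 else 0 else 0

theorem setRank_eval (inp : ℕ → ℕ) (i n m : Var Γ .nat) (e : Env Γ) :
    (setRank i n m).eval inp e = rowRank inp (n.get e) (m.get e) (i.get e) := by
  rw [setRank, forN_eval]
  refine Eq.trans ?_ (iter_add _)
  unfold forAcc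
  simp only [Tm.eval, setSize_eval, Op.eval, Var.get]
  congr 1
  funext x a
  by_cases h1 : rowSum inp (n.get e) (i.get e) < rowSum inp (n.get e) x
  · simp [h1]
  · by_cases h2 : rowSum inp (n.get e) (i.get e) = rowSum inp (n.get e) x <;>
      by_cases h3 : x < i.get e <;> simp [h1, h2, h3]

theorem foldl_add {α : Type} (f : α → ℕ) (l : List α) (a : ℕ) :
    l.foldl (fun b x => b + f x) a = a + (l.map f).sum := by
  induction l generalizing a with
  | nil => rfl
  | cons x l ih => rw [List.foldl_cons, ih, List.map_cons, List.sum_cons, add_assoc]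

/-- The unique coverage of the rows listed in `Q`. -/
def rowsUnique (inp : ℕ → ℕ) (n : ℕ) (Q : List ℕ) : ℕ :=
  ∑ x ∈ range n, if 1 = (Q.map fun i => inp (i * n + x)).sum then 1 else 0

theorem uniqueCoverage_eval (inp : ℕ → ℕ) (Q : Var Γ (.list .nat)) (n : Var Γ .nat) (e : Env Γ) :
    (uniqueCoverage Q n).eval inp e = rowsUnique inp (n.get e) (Q.get e) := by
  rw [uniqueCoverage, forN_eval]
  refine Eq.trans ?_ (iter_add _)
  unfold forAcc
  congr 1
  funext x a
  change a + (if 1 = (Q.get e).foldl (fun b i => b + inp (i * n.get e + x)) 0 then 1 else 0) = _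
  rw [foldl_add, zero_add]

/-- One step of the enumeration of lists. -/
def extend (i k : ℕ) (L : List (ℕ × List ℕ)) : List (ℕ × List ℕ) :=
  L.foldl (fun acc Q => if Q.1 < k then (Q.1 + 1, i :: Q.2) :: acc else acc) L

theorem extendAll_eval (inp : ℕ → ℕ) (i k : Var Γ .nat)
    (L : Var Γ (.list (.prod .nat (.list .nat)))) (e : Env Γ) :
    (extendAll i k L).eval inp e = extend (i.get e) (k.get e) (L.get e) := by
  simp only [extendAll, extend, Tm.eval, Op.eval, Var.get]
  congr 1
  funext acc Q
  by_cases h : Q.1 < k.get e <;> simp [h]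

/-- The enumeration of the lists of at most `k` rows of rank less than `K` among the first `j`
rows. -/
def enum (inp : ℕ → ℕ) (n m k K : ℕ) (j : ℕ) : List (ℕ × List ℕ) :=
  iter (fun i L => if rowRank inp n m i < K then extend i k L else L) [(0, [])] j

theorem allLists_forAcc (inp : ℕ → ℕ) (n m k K : Var Γ .nat) (e : Env Γ) (j : ℕ) :
    forAcc inp (.cons (.pair (.lit 0) .nil) .nil)
      (.ite (.op .lt (setRank .zero n.up3 m.up3) (.var K.up3))
        (extendAll .zero k.up3 (.succ .zero)) v1) e j =
      enum inp (n.get e) (m.get e) (k.get e) (K.get e) j := by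
  unfold forAcc enum
  simp only [Tm.eval, setRank_eval, extendAll_eval, Op.eval, Var.get]
  congr 1
  funext x a
  split_ifs <;> simp_all

theorem allLists_eval (inp : ℕ → ℕ) (n m k K : Var Γ .nat) (e : Env Γ) :
    (allLists n m k K).eval inp e =
      enum inp (n.get e) (m.get e) (k.get e) (K.get e) (m.get e) := by
  rw [allLists, forN_eval, allLists_forAcc]
  rfl

/-- The search for the best list. -/
def best (inp : ℕ → ℕ) (n : ℕ) (L : List (ℕ × List ℕ)) : ℕ × List ℕ :=
  L.foldl (fun b Q => if b.1 < rowsUnique inp n Q.2 then (rowsUnique inp n Q.2, Q.2) else b) (0, [])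

theorem bestList_eval (inp : ℕ → ℕ) (L : Var Γ (.list (.prod .nat (.list .nat))))
    (n : Var Γ .nat) (e : Env Γ) :
    (bestList L n).eval inp e = best inp (n.get e) (L.get e) := by
  simp only [bestList, best, Tm.eval, uniqueCoverage_eval, Op.eval, Var.get]
  congr 1
  funext b Q
  split_ifs <;> simp_all

theorem uniqueTopSets_eval (inp : ℕ → ℕ) (n m k K : ℕ) :
    uniqueTopSets.eval inp (n, m, k, K, ()) = (best inp n (enum inp n m k (min m K) m)).2 := by
  have : (if (if m < K then 1 else 0) ≠ 0 then m else K) = min m K := by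
    split_ifs <;> omega
  rw [← this]
  simp only [uniqueTopSets, Tm.eval, bestList_eval, allLists_eval, Op.eval, Var.get]
  rfl

end Machine

namespace Machine

open Finset

/-! ### Correctness of UniqueTopSets -/

theorem mem_extend {i k : ℕ} {L : List (ℕ × List ℕ)} {Q : ℕ × List ℕ} :
    Q ∈ extend i k L ↔ Q ∈ L ∨ ∃ P ∈ L, P.1 < k ∧ Q = (P.1 + 1, i :: P.2) := by
  have : ∀ acc : List (ℕ × List ℕ),
      Q ∈ L.foldl (fun acc Q => if Q.1 < k then (Q.1 + 1, i :: Q.2) :: acc else acc) acc ↔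
        Q ∈ acc ∨ ∃ P ∈ L, P.1 < k ∧ Q = (P.1 + 1, i :: P.2) := by
    induction L with
    | nil => simp
    | cons P L ih =>
      intro acc
      rw [List.foldl_cons, ih]
      by_cases h : P.1 < k
      · simp only [h, if_true, List.mem_cons, exists_eq_or_imp, true_and]
        tauto
      · simp only [h, if_false, List.mem_cons, exists_eq_or_imp, false_and, false_or]
  exact this L

/-- How many of the lists are shorter than `b`, before and after `i` is added to the lists shorter
than `k`. -/
theorem countP_extend (i k b : ℕ) (L : List (ℕ × List ℕ)) :
    (extend i k L).countP (fun Q => Q.1 < b) =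
      L.countP (fun Q => Q.1 < b) + L.countP (fun Q => Q.1 < k ∧ Q.1 + 1 < b) := by
  have : ∀ M acc : List (ℕ × List ℕ),
      (M.foldl (fun acc Q => if Q.1 < k then (Q.1 + 1, i :: Q.2) :: acc else acc) acc).countP
        (fun Q => Q.1 < b) =
      acc.countP (fun Q => Q.1 < b) + M.countP (fun Q => Q.1 < k ∧ Q.1 + 1 < b) := by
    intro M
    induction M with
    | nil => simp
    | cons P M ih =>
      intro acc
      rw [List.foldl_cons, ih, List.countP_cons]
      by_cases h : P.1 < k <;> by_cases h' : P.1 + 1 < b <;>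
        (simp [h, h']; try omega)
  exact this L L

/-- The rows of rank less than `K` among the first `j`. -/
def topRows (inp : ℕ → ℕ) (n m K j : ℕ) : Finset ℕ :=
  (range j).filter fun i => rowRank inp n m i < K

/-- Each of the enumerated lists is a small subcollection of the kernel, without repetitions. -/
theorem enum_sound {inp : ℕ → ℕ} {n m k K : ℕ} {j : ℕ} {Q : ℕ × List ℕ}
    (hQ : Q ∈ enum inp n m k K j) : Q.1 = Q.2.length ∧ Q.1 ≤ k ∧ Q.2.Nodup ∧
      ∀ a ∈ Q.2, a ∈ topRows inp n m K j := by
  induction j generalizing Q with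
  | zero =>
    have : Q = (0, []) := by simpa [enum] using hQ
    subst this
    simp
  | succ j ih =>
    have hmono : topRows inp n m K j ⊆ topRows inp n m K (j + 1) :=
      filter_subset_filter _ (range_mono (Nat.le_succ j))
    have hold : ∀ {P}, P ∈ enum inp n m k K j → P.1 = P.2.length ∧ P.1 ≤ k ∧ P.2.Nodup ∧
        ∀ a ∈ P.2, a ∈ topRows inp n m K (j + 1) := fun hP =>
      ⟨(ih hP).1, (ih hP).2.1, (ih hP).2.2.1, fun a ha => hmono ((ih hP).2.2.2 a ha)⟩
    rw [enum, iter_succ, ← enum] at hQ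
    split_ifs at hQ with hr
    · rcases mem_extend.1 hQ with h | ⟨P, hP, hk, rfl⟩
      · exact hold h
      · obtain ⟨h1, -, h3, h4⟩ := ih hP
        refine ⟨by simp [h1], hk, List.nodup_cons.2 ⟨fun hj => ?_, h3⟩, fun a ha => ?_⟩
        · have := mem_range.1 (mem_filter.1 (h4 j hj)).1
          omega
        · rcases List.mem_cons.1 ha with rfl | ha
          · exact mem_filter.2 ⟨self_mem_range_succ _, hr⟩
          · exact hmono (h4 a ha)
    · exact hold hQ

/-- Each small subcollection of the kernel is enumerated. -/
theorem enum_complete {inp : ℕ → ℕ} {n m k K : ℕ} {j : ℕ} {S : Finset ℕ}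
    (hS : S ⊆ topRows inp n m K j) (hk : S.card ≤ k) :
    ∃ Q ∈ enum inp n m k K j, Q.2.toFinset = S := by
  induction j generalizing S with
  | zero =>
    have : S = ∅ := by simpa [topRows] using hS
    exact ⟨(0, []), by simp [enum], by simp [this]⟩
  | succ j ih =>
    rw [enum, iter_succ, ← enum]
    by_cases hj : j ∈ S
    · have hr := (mem_filter.1 (hS hj)).2
      rw [if_pos hr]
      have hcard := card_erase_of_mem hj
      have hpos := card_pos.2 ⟨j, hj⟩
      obtain ⟨Q, hQ, hQS⟩ := ih (S := S.erase j) (fun a ha => by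
        have h1 := mem_filter.1 (hS (mem_of_mem_erase ha))
        have h2 := mem_range.1 h1.1
        have h3 := ne_of_mem_erase ha
        exact mem_filter.2 ⟨mem_range.2 (by omega), h1.2⟩) (by omega)
      obtain ⟨h1, -, h3, -⟩ := enum_sound hQ
      refine ⟨(Q.1 + 1, j :: Q.2), mem_extend.2 (Or.inr ⟨Q, hQ, ?_, rfl⟩), ?_⟩
      · rw [h1, ← List.toFinset_card_of_nodup h3, hQS]
        omega
      · rw [List.toFinset_cons, hQS, insert_erase hj]
    · obtain ⟨Q, hQ, hQS⟩ := ih (S := S) (fun a ha => by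
        have h1 := mem_filter.1 (hS ha)
        have h2 := mem_range.1 h1.1
        have h3 : a ≠ j := fun h => hj (h ▸ ha)
        exact mem_filter.2 ⟨mem_range.2 (by omega), h1.2⟩) hk
      refine ⟨Q, ?_, hQS⟩
      split_ifs
      · exact mem_extend.2 (Or.inl hQ)
      · exact hQ

theorem sum_choose_succ (a b : ℕ) :
    ∑ i ∈ range (b + 1), (a + 1).choose i =
      ∑ i ∈ range (b + 1), a.choose i + ∑ i ∈ range b, a.choose i := by
  rw [sum_range_succ', sum_range_succ' (fun i => a.choose i) b]
  simp only [Nat.choose_succ_succ', sum_add_distrib, Nat.choose_zero_right]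
  omega

/-- The number of enumerated lists that are shorter than `b`, by Pascal's rule. -/
theorem enum_countP (inp : ℕ → ℕ) (n m k K j : ℕ) {b : ℕ} (hb : b ≤ k + 1) :
    (enum inp n m k K j).countP (fun Q => Q.1 < b) =
      ∑ i ∈ range b, (topRows inp n m K j).card.choose i := by
  induction j generalizing b with
  | zero =>
    rcases b with - | b
    · simp [enum]
    · rw [sum_range_succ']
      simp [enum, topRows]
  | succ j ih =>
    rw [enum, iter_succ, ← enum]
    have hcard : (topRows inp n m K (j + 1)).card =
        (topRows inp n m K j).card + if rowRank inp n m j < K then 1 else 0 := by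
      unfold topRows
      rw [range_add_one, filter_insert]
      split_ifs
      · rw [card_insert_of_notMem (by simp)]
      · rfl
    rw [hcard]
    split_ifs with hr
    · rw [countP_extend]
      rcases b with - | b
      · simp
      · rw [sum_choose_succ, ← ih hb, ← ih (by omega : b ≤ k + 1)]
        congr 1
        refine List.countP_congr fun Q _ => ?_
        simp only [decide_eq_true_eq]
        omega
    · exact ih hb

theorem enum_length (inp : ℕ → ℕ) (n m k K j : ℕ) :
    (enum inp n m k K j).length =
      ∑ i ∈ range (k + 1), (topRows inp n m K j).card.choose i := by
  rw [← enum_countP inp n m k K j le_rfl, List.countP_eq_length.2]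
  intro Q hQ
  have := (enum_sound hQ).2.1
  simp only [decide_eq_true_eq]
  omega

/-- The list found is best; it may be empty, which happens if all unique coverages are `0`. -/
theorem best_spec (inp : ℕ → ℕ) (n : ℕ) (L : List (ℕ × List ℕ)) :
    (best inp n L).1 = rowsUnique inp n (best inp n L).2 ∧
    ((best inp n L).2 = [] ∨ ∃ Q ∈ L, (best inp n L).2 = Q.2) ∧
    ∀ Q ∈ L, rowsUnique inp n Q.2 ≤ (best inp n L).1 := by
  induction L using List.reverseRecOn with
  | nil => simp [best, rowsUnique]
  | append_singleton L P ih =>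
    obtain ⟨h1, h2, h3⟩ := ih
    have hb : best inp n (L ++ [P]) = if (best inp n L).1 < rowsUnique inp n P.2 then
        (rowsUnique inp n P.2, P.2) else best inp n L := by
      simp only [best, List.foldl_append, List.foldl_cons, List.foldl_nil]
      rfl
    rw [hb]
    split_ifs with h
    · refine ⟨rfl, Or.inr ⟨P, by simp, rfl⟩, fun Q hQ => ?_⟩
      rcases List.mem_append.1 hQ with hQ | hQ
      · exact (h3 Q hQ).trans h.le
      · rw [List.mem_singleton.1 hQ]
    · refine ⟨h1, ?_, fun Q hQ => ?_⟩
      · rcases h2 with h2 | ⟨Q, hQ, h2⟩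
        · exact Or.inl h2
        · exact Or.inr ⟨Q, List.mem_append_left _ hQ, h2⟩
      · rcases List.mem_append.1 hQ with hQ | hQ
        · exact h3 Q hQ
        · rw [List.mem_singleton.1 hQ]
          omega

/-! ### The tape with the incidence matrix -/

section Tape

variable {m n : ℕ} (V : Fin m → Finset (Fin n))

/-- The input tape with the incidence matrix of `V`. -/
abbrev tape : ℕ → ℕ := fun a => MUC.incidence V (a / n) (a % n)

theorem incidence_le_one (i x : ℕ) : MUC.incidence V i x ≤ 1 := by
  unfold MUC.incidence
  split_ifs <;> omega

theorem incidence_val (i : Fin m) (x : Fin n) :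
    MUC.incidence V i x = if x ∈ V i then 1 else 0 := by
  unfold MUC.incidence
  rw [dif_pos ⟨i.2, x.2⟩]

theorem tape_apply (i : ℕ) (x : Fin n) : tape V (i * n + x) = MUC.incidence V i x := by
  unfold tape
  have hn : 0 < n := x.pos
  rw [mul_comm, Nat.mul_add_div hn, Nat.div_eq_of_lt x.2, Nat.mul_add_mod, Nat.mod_eq_of_lt x.2,
    add_zero]

theorem sum_incidence (i : Fin m) : ∑ x ∈ range n, MUC.incidence V i x = (V i).card := by
  rw [sum_range]
  simp_rw [incidence_val]
  simp

theorem rowSum_tape (i : Fin m) : rowSum (tape V) n i = (V i).card := by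
  rw [rowSum, sum_range, ← sum_incidence, sum_range]
  simp_rw [tape_apply]

/-- The set `j` precedes the set `i` in the order of decreasing size. -/
def Precedes (j i : Fin m) : Prop :=
  (V i).card < (V j).card ∨ (V i).card = (V j).card ∧ j < i

instance (j i : Fin m) : Decidable (Precedes V j i) := by unfold Precedes; infer_instance

/-- The rank of a set, in the order by decreasing size and then by ID. -/
theorem rowRank_tape (i : Fin m) :
    rowRank (tape V) n m i = (univ.filter fun j => Precedes V j i).card := by
  rw [rowRank, sum_range, card_filter]
  refine sum_congr rfl fun j _ => ?_
  rw [rowSum_tape, rowSum_tape]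
  unfold Precedes
  simp only [Fin.val_fin_lt]
  by_cases h1 : (V i).card < (V j).card <;> by_cases h2 : (V i).card = (V j).card <;>
    by_cases h3 : j < i <;> simp [h1, h2, h3]

theorem rowRank_lt_of_precedes {j i : Fin m} (h : Precedes V j i) :
    rowRank (tape V) n m j < rowRank (tape V) n m i := by
  rw [rowRank_tape, rowRank_tape]
  refine card_lt_card ((ssubset_iff_of_subset fun a ha => ?_).2 ⟨j, ?_, ?_⟩)
  · have ha' : Precedes V a j := (mem_filter.1 ha).2
    refine mem_filter.2 ⟨mem_univ a, ?_⟩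
    unfold Precedes at *
    omega
  · exact mem_filter.2 ⟨mem_univ j, h⟩
  · intro hj
    have hj' : Precedes V j j := (mem_filter.1 hj).2
    unfold Precedes at hj'
    omega

/-- The sets of rank less than `min m K` are `K` largest sets: since ranks are distinct, they take
all values less than `m`. -/
theorem isTopSets_rank (K : ℕ) : MUC.IsTopSets V K
    (univ.filter fun i : Fin m => rowRank (tape V) n m i < min m K) := by
  have hlt : ∀ i : Fin m, rowRank (tape V) n m i < m := fun i => by
    rw [rowRank_tape]
    refine (card_lt_card (ssubset_univ_iff.2 fun h => ?_)).trans_eq (Finset.card_fin m)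
    have hi := (mem_filter.1 (eq_univ_iff_forall.1 h i)).2
    unfold Precedes at hi
    omega
  set f : Fin m → Fin m := fun i => ⟨rowRank (tape V) n m i, hlt i⟩ with hf
  have hinj : Function.Injective f := by
    intro i j hij
    by_contra hne
    have hij : rowRank (tape V) n m i = rowRank (tape V) n m j := by simpa [hf] using hij
    have : Precedes V i j ∨ Precedes V j i := by
      have : (i : ℕ) ≠ j := fun h => hne (Fin.ext h)
      simp only [Precedes, Fin.lt_def]
      omega
    rcases this with h | h <;> have := rowRank_lt_of_precedes V h <;> omega
  have hbij := Finite.injective_iff_bijective.1 hinj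
  refine ⟨?_, fun i hi j hj => ?_⟩
  · rw [card_bij (t := univ.filter fun a : Fin m => (a : ℕ) < min m K) (fun i _ => f i)
      (fun i hi => mem_filter.2 ⟨mem_univ _, (mem_filter.1 hi).2⟩) (fun _ _ _ _ h => hinj h)
      (fun b hb => by
        obtain ⟨a, rfl⟩ := hbij.2 b
        exact ⟨a, mem_filter.2 ⟨mem_univ _, (mem_filter.1 hb).2⟩, rfl⟩)]
    rw [Fin.card_filter_val_lt]
    omega
  · simp only [mem_filter, mem_univ, true_and] at hi hj
    by_contra hcon
    push Not at hcon
    have := rowRank_lt_of_precedes V (j := j) (i := i) (Or.inl hcon)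
    omega

/-- How many of the listed sets contain `x`. -/
theorem sum_list_incidence {L : List ℕ} {B : Finset (Fin m)} (hL : MUC.Lists L B) (x : Fin n) :
    (L.map fun i => MUC.incidence V i x).sum = (B.filter fun i => x ∈ V i).card := by
  have hto : L.toFinset = B.map Fin.valEmbedding := by
    ext a
    rw [List.mem_toFinset, hL.2]
    simp
  rw [← List.sum_toFinset _ hL.1, hto, sum_map, card_filter]
  refine sum_congr rfl fun i _ => ?_
  exact incidence_val V i x

theorem rowsUnique_tape {L : List ℕ} {B : Finset (Fin m)} (hL : MUC.Lists L B) :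
    rowsUnique (tape V) n L = (MUC.uniqueCover V B).card := by
  rw [rowsUnique, sum_range]
  simp_rw [tape_apply, sum_list_incidence V hL]
  rw [← card_filter]
  congr 1
  ext x
  rw [MUC.mem_uniqueCover_iff_card]
  simp [eq_comm]

theorem lists_of_nodup {L : List ℕ} (h : L.Nodup) (hlt : ∀ a ∈ L, a < m) :
    MUC.Lists L (univ.filter fun i : Fin m => (i : ℕ) ∈ L) := by
  refine ⟨h, fun a => ⟨fun ha => ⟨⟨a, hlt a ha⟩, by simpa using ha, rfl⟩, ?_⟩⟩
  rintro ⟨i, hi, rfl⟩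
  simpa using hi

theorem card_eq_length_of_lists {L : List ℕ} {B : Finset (Fin m)} (h : MUC.Lists L B) :
    B.card = L.length := by
  have hto : L.toFinset = B.map Fin.valEmbedding := by
    ext a
    rw [List.mem_toFinset, h.2]
    simp
  rw [← List.toFinset_card_of_nodup h.1, hto, card_map]

/-- The output of the program is a possible output of UniqueTopSets. -/
theorem uniqueTopSets_correct (k K : ℕ) :
    ∃ B : Finset (Fin m), MUC.Lists (uniqueTopSets.eval (tape V) (n, m, k, K, ())) B ∧
      MUC.IsUniqueTopSetsOutput V k K B := by
  set L := enum (tape V) n m k (min m K) m with hL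
  obtain ⟨h1, h2, h3⟩ := best_spec (tape V) n L
  rw [uniqueTopSets_eval]
  set R := (best (tape V) n L).2 with hR
  have hsound : R.Nodup ∧ R.length ≤ k ∧ ∀ a ∈ R, a ∈ topRows (tape V) n m (min m K) m := by
    rcases h2 with h2 | ⟨Q, hQ, h2⟩
    · rw [h2]
      simp
    · obtain ⟨e1, e2, e3, e4⟩ := enum_sound hQ
      rw [h2]
      exact ⟨e3, e1 ▸ e2, e4⟩
  have hlists := lists_of_nodup hsound.1 fun a ha =>
    mem_range.1 (mem_filter.1 (hsound.2.2 a ha)).1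
  refine ⟨_, hlists, _, isTopSets_rank V K, fun i hi => ?_, ?_, fun S hS hSk => ?_⟩
  · have := hsound.2.2 i (mem_filter.1 hi).2
    exact mem_filter.2 ⟨mem_univ i, (mem_filter.1 this).2⟩
  · rw [card_eq_length_of_lists hlists]
    exact hsound.2.1
  · obtain ⟨Q, hQ, hQS⟩ := enum_complete (inp := tape V) (n := n) (m := m) (k := k)
      (K := min m K) (j := m) (S := S.map Fin.valEmbedding) (fun a ha => by
        obtain ⟨i, hi, rfl⟩ := mem_map.1 ha
        exact mem_filter.2 ⟨mem_range.2 i.2, (mem_filter.1 (hS hi)).2⟩) (by rwa [card_map])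
    have hQl : MUC.Lists Q.2 S := by
      refine ⟨(enum_sound hQ).2.2.1, fun a => ?_⟩
      rw [← List.mem_toFinset, hQS]
      simp
    have := h3 Q hQ
    rwa [h1, rowsUnique_tape V hQl, rowsUnique_tape V hlists] at this

end Tape

end Machine

namespace Machine

open Finset

variable {Γ : List Ty}

/-! ### The running time of UniqueTopSets -/

theorem op_cost_le {a b Z : ℕ} (ha : a ≤ Z) (hb : b ≤ Z) :
    (Nat.size a + 1) * (Nat.size b + 1) ≤ (Z + 1) ^ 2 := by
  rw [sq]
  exact Nat.mul_le_mul (Nat.succ_le_succ ((size_le_self a).trans ha))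
    (Nat.succ_le_succ ((size_le_self b).trans hb))

theorem sum_range_le_of_le_one {f : ℕ → ℕ} (hf : ∀ x, f x ≤ 1) (j : ℕ) :
    ∑ x ∈ range j, f x ≤ j := by
  simpa using sum_le_card_nsmul (range j) f 1 fun x _ => hf x

/-- A bound for the time to compute the size of a set, when all numbers are at most `Z`. -/
def sizeTime (Z : ℕ) : ℕ := 2 + (Z + 1) * ((4 * (Z + 1) ^ 2 + 4 * Z + 20) + 2 * Z + 20)

theorem setSize_time_le {inp : ℕ → ℕ} (hinp : ∀ a, inp a ≤ 1) {i n : Var Γ .nat} {e : Env Γ}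
    {Z i' n' : ℕ} (hi : i.get e = i') (hn : n.get e = n') (hZ : i' * n' + n' ≤ Z) (hiZ : i' ≤ Z)
    (hZ1 : 1 ≤ Z) :
    (setSize i n).time inp e ≤ sizeTime Z := by
  have key := forN_time_le (inp := inp) (N := .var n) (init := .lit 0) (e := e)
    (body := .op .add v1 (.read (.op .add (.op .mul (.var i.up3) (.var n.up3)) v0)))
    (B := 4 * (Z + 1) ^ 2 + 4 * Z + 20) (R := n') (Z := Z) hn (by omega) (fun j hj => by
      have hacc : forAcc inp (.lit 0) (.op .add v1
          (.read (.op .add (.op .mul (.var i.up3) (.var n.up3)) v0))) e j =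
          ∑ x ∈ range j, inp (i' * n' + x) := by
        rw [← hi, ← hn]
        exact iter_add (f := fun x => inp (i.get e * n.get e + x)) _
      rw [hacc]
      have h1 := sum_range_le_of_le_one (fun x => hinp (i' * n' + x)) j
      simp only [Tm.time, Tm.eval, Op.eval, Var.get, hi, hn]
      have h2 := hinp (i' * n' + j)
      have c1 := op_cost_le (a := i') (b := n') (Z := Z) hiZ (by omega)
      have c2 := op_cost_le (a := i' * n') (b := j) (Z := Z) (by omega) (by omega)
      have c3 := op_cost_le (a := ∑ x ∈ range j, inp (i' * n' + x)) (b := inp (i' * n' + j))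
        (Z := Z) (by omega) (by omega)
      have c4 := size_le_self (i' * n' + j)
      have c5 := size_le_self (inp (i' * n' + j))
      omega)
  exact key

/-- A bound for the time to compute the rank of a set, when all numbers are at most `Z`. -/
def rankTime (Z : ℕ) : ℕ :=
  2 + (Z + 1) * ((2 * sizeTime Z + 4 * (Z + 1) ^ 2 + 30) + 2 * Z + 20)

theorem setRank_time_le {inp : ℕ → ℕ} (hinp : ∀ a, inp a ≤ 1) {i n m : Var Γ .nat} {e : Env Γ}
    {Z i' n' m' : ℕ} (hi : i.get e = i') (hn : n.get e = n') (hm : m.get e = m')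
    (hZ : m' * n' + n' + m' ≤ Z) (him : i' < m') (hZ1 : 1 ≤ Z) :
    (setRank i n m).time inp e ≤ rankTime Z := by
  have hrow : ∀ a, rowSum inp n' a ≤ Z := fun a =>
    (sum_range_le_of_le_one (fun x => hinp _) n').trans (by omega)
  have hadd : ∀ a < m', a * n' + n' ≤ Z := fun a ha => by
    have := Nat.mul_le_mul_right n' ha.le
    omega
  exact forN_time_le (inp := inp) (N := .var m) (init := .lit 0) (e := e)
    (B := 2 * sizeTime Z + 4 * (Z + 1) ^ 2 + 30) (R := m') (Z := Z) hm (by omega) (fun j hj => by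
      have hacc : forAcc inp (.lit 0) (.bind (setSize i.up3 n.up3)
          (.bind (setSize (.succ .zero) n.up3.succ)
          (.op .add (.var (.succ (.succ (.succ .zero))))
            (.ite (.op .lt v1 v0) (.lit 1)
              (.ite (.op .eq v1 v0) (.op .lt v2 (.var i.up3.succ.succ)) (.lit 0)))))) e j =
          rowRank inp n' j i' := by
        have := setRank_eval inp (Γ := .nat :: Γ) i.succ n.succ .zero (j, e)
        rw [setRank, forN_eval] at this
        simp only [Var.get, hn, hi] at this
        rw [← this]
        unfold forAcc
        simp only [Tm.eval, setSize_eval, Var.get]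
      rw [hacc]
      have h1 : rowRank inp n' j i' ≤ j := by
        refine sum_range_le_of_le_one (fun x => ?_) j
        split_ifs <;> omega
      have t1 := setSize_time_le (Γ := .nat :: .nat :: .prod .nat .nat :: Γ) hinp
        (i := i.up3) (n := n.up3) (e := (j, rowRank inp n' j i',
        (j, rowRank inp n' j i'), e)) hi hn (hadd i' him) (by omega) hZ1
      have t2 := setSize_time_le (Γ := .nat :: .nat :: .nat :: .prod .nat .nat :: Γ) hinp
        (i := .succ .zero) (n := n.up3.succ) (i' := j)
        (e := (rowSum inp n' i', j, rowRank inp n' j i', (j, rowRank inp n' j i'), e)) rfl hn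
        (hadd j hj) (by omega) hZ1
      simp only [Tm.time, Tm.eval, Op.eval, Var.get, hi, hn, setSize_eval] at t1 t2 ⊢
      have c1 := op_cost_le (hrow i') (hrow j)
      have c2 := op_cost_le (a := j) (b := i') (Z := Z) (by omega) (by omega)
      have c3 := op_cost_le (a := rowRank inp n' j i') (b := 1) (Z := Z) (by omega) hZ1
      have c4 := op_cost_le (a := rowRank inp n' j i') (b := 0) (Z := Z) (by omega) (by omega)
      split_ifs <;> omega)

/-- A bound for the time to compute the unique coverage of a list of sets, when all numbers are at
most `Z`. -/
def coverageTime (Z : ℕ) : ℕ :=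
  2 + (Z + 1) * ((Z * (4 * (Z + 1) ^ 2 + 4 * Z + 30) + 4 * (Z + 1) ^ 2 + 30) + 2 * Z + 20)

theorem uniqueCoverage_time_le {inp : ℕ → ℕ} (hinp : ∀ a, inp a ≤ 1) {Q : Var Γ (.list .nat)}
    {n : Var Γ .nat} {e : Env Γ} {Z n' m' : ℕ} {Q' : List ℕ} (hQ : Q.get e = Q') (hn : n.get e = n')
    (hQl : Q'.length ≤ Z) (hQm : ∀ i ∈ Q', i < m') (hZ : m' * n' + n' + m' ≤ Z) (hZ1 : 1 ≤ Z) :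
    (uniqueCoverage Q n).time inp e ≤ coverageTime Z := by
  exact forN_time_le (inp := inp) (N := .var n) (init := .lit 0) (e := e)
    (B := Z * (4 * (Z + 1) ^ 2 + 4 * Z + 30) + 4 * (Z + 1) ^ 2 + 30) (R := n') (Z := Z) hn
    (by omega) (fun j hj => by
      set acc : ℕ := forAcc inp (.lit 0) (.op .add v1 (.op .eq (.lit 1) (.fold (.var Q.up3) (.lit 0)
        (.op .add v1 (.read (.op .add (.op .mul v0 (.var n.up3.succ.succ)) v2)))))) e j with hacc
      have hacc' : acc = ∑ x ∈ range j, if 1 = (Q'.map fun i => inp (i * n' + x)).sum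
          then 1 else 0 := by
        rw [← iter_add, hacc]
        unfold forAcc
        congr 1
        funext x a
        change a + (if 1 = (Q.get e).foldl (fun b i => b + inp (i * n.get e + x)) 0
          then 1 else 0) = _
        rw [foldl_add, zero_add, hQ, hn]
      have hle : acc ≤ j := by
        rw [hacc']
        exact sum_range_le_of_le_one (fun x => by split_ifs <;> omega) j
      clear_value acc
      have hsum : ∀ P : List ℕ, P <+: Q' →
          P.foldl (fun b i => b + inp (i * n' + j)) 0 ≤ Z := fun P hP => by
        rw [foldl_add, zero_add]
        refine (List.sum_le_card_nsmul _ 1 fun x hx => ?_).trans ?_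
        · obtain ⟨i, -, rfl⟩ := List.mem_map.1 hx
          exact hinp _
        · rw [List.length_map, smul_eq_mul, mul_one]
          exact hP.length_le.trans hQl
      have hfold := foldSum_le (fun (b i : ℕ) => b + inp (i * n' + j))
        (fun b i => 1 + (1 + 1 + (Nat.size i + 1) * (Nat.size n' + 1) + 1 +
          (Nat.size (i * n') + 1) * (Nat.size j + 1) + Nat.size (i * n' + j) +
          Nat.size (inp (i * n' + j)) + 1) +
          (Nat.size b + 1) * (Nat.size (inp (i * n' + j)) + 1) + 1)
        (B := 4 * (Z + 1) ^ 2 + 4 * Z + 30) 0 Q' (fun P i hP => by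
          have hi := hQm i (hP.subset (by simp))
          have hmul := Nat.mul_le_mul_right n' hi
          rw [Nat.succ_mul] at hmul
          have hb := hsum P ((List.prefix_append P [i]).trans hP)
          have h2 := hinp (i * n' + j)
          have c1 := op_cost_le (a := i) (b := n') (Z := Z) (by omega) (by omega)
          have c2 := op_cost_le (a := i * n') (b := j) (Z := Z) (by omega) (by omega)
          have c3 := op_cost_le (b := inp (i * n' + j)) hb (by omega)
          have c4 := size_le_self (i * n' + j)
          have c5 := size_le_self (inp (i * n' + j))
          omega)
      have hfold2 := hfold.trans (Nat.mul_le_mul_right _ hQl)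
      have hb := hsum Q' List.prefix_rfl
      simp only [Tm.time, Tm.eval, Op.eval, Var.get, hQ, hn]
      dsimp only [Ty.Val]
      refine le_trans (Nat.add_le_add_right (Nat.add_le_add_left (Nat.add_le_add_right
        (Nat.add_le_add_left (Nat.add_le_add_left hfold2 _) _) _) _) _) ?_
      have c1 := op_cost_le (a := 1) hZ1 hb
      have c2 : ∀ c ≤ 1, (Nat.size acc + 1) * (Nat.size c + 1) ≤ (Z + 1) ^ 2 := fun c hc =>
        op_cost_le (by omega) (by omega)
      have c3 := c2 (if 1 = Q'.foldl (fun b i => b + inp (i * n' + j)) 0 then 1 else 0)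
        (by split_ifs <;> omega)
      omega)

theorem extendAll_time_le {inp : ℕ → ℕ} {i k : Var Γ .nat}
    {L : Var Γ (.list (.prod .nat (.list .nat)))} {e : Env Γ} {Z c k' : ℕ}
    {L' : List (ℕ × List ℕ)} (hL : L.get e = L') (hk : k.get e = k') (hkZ : k' ≤ Z)
    (hLk : ∀ Q ∈ L', Q.1 ≤ k') (hc : L'.length ≤ c) (hZ1 : 1 ≤ Z) :
    (extendAll i k L).time inp e ≤ 3 + c * (2 * (Z + 1) ^ 2 + 30) := by
  simp only [extendAll, Tm.time, Tm.eval, Op.eval, Var.get, hL, hk]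
  have h := foldSum_le (fun (a : List (ℕ × List ℕ)) (Q : ℕ × List ℕ) =>
      if (if Q.1 < k' then 1 else 0) ≠ 0 then (Q.1 + 1, i.get e :: Q.2) :: a else a)
    (fun a Q => 1 + 1 + 1 + (Nat.size Q.1 + 1) * (Nat.size k' + 1) +
      (if (if Q.1 < k' then 1 else 0) ≠ 0 then
        1 + 1 + 1 + (Nat.size Q.1 + 1) * (Nat.size 1 + 1) + (1 + (1 + 1) + 1) + 1 + 1 + 1 else 1) +
      1 + 1) (B := 2 * (Z + 1) ^ 2 + 30) L' L' (fun P Q hP => by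
        have hQ := hLk Q (hP.subset (by simp))
        have c1 := op_cost_le (a := Q.1) (b := k') (Z := Z) (by omega) hkZ
        have c2 := op_cost_le (a := Q.1) (b := 1) (Z := Z) (by omega) hZ1
        split_ifs <;> omega)
  have h2 := h.trans (Nat.mul_le_mul_right _ hc)
  rw [show 3 = 1 + 1 + 1 from rfl]
  exact Nat.add_le_add_left h2 _

theorem allLists_time_le {inp : ℕ → ℕ} (hinp : ∀ a, inp a ≤ 1) {n m k K : Var Γ .nat} {e : Env Γ}
    {Z c n' m' k' K' : ℕ} (hn : n.get e = n') (hm : m.get e = m') (hk : k.get e = k')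
    (hK : K.get e = K') (hZ : m' * n' + n' + m' ≤ Z) (hZ1 : 1 ≤ Z) (hkZ : k' ≤ Z) (hKZ : K' ≤ Z)
    (hc : ∀ j ≤ m', (enum inp n' m' k' K' j).length ≤ c) :
    (allLists n m k K).time inp e ≤
      6 + (Z + 1) *
        ((rankTime Z + (Z + 1) ^ 2 + 20 + c * (2 * (Z + 1) ^ 2 + 30)) + 2 * Z + 20) := by
  exact forN_time_le (inp := inp) (N := .var m) (init := .cons (.pair (.lit 0) .nil) .nil) (e := e)
    (B := rankTime Z + (Z + 1) ^ 2 + 20 + c * (2 * (Z + 1) ^ 2 + 30)) (R := m') (Z := Z) hm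
    (by omega) (fun j hj => by
      rw [allLists_forAcc, hn, hm, hk, hK]
      set L := enum inp n' m' k' K' j with hL
      have t1 := setRank_time_le (Γ := .nat :: .list (.prod .nat (.list .nat)) ::
        .prod .nat (.list (.prod .nat (.list .nat))) :: Γ) hinp (i := .zero) (n := n.up3)
        (m := m.up3) (e := (j, L, (j, L), e)) rfl hn hm hZ hj hZ1
      have t2 := extendAll_time_le (Γ := .nat :: .list (.prod .nat (.list .nat)) ::
        .prod .nat (.list (.prod .nat (.list .nat))) :: Γ) (inp := inp) (i := .zero) (k := k.up3)
        (L := .succ .zero) (e := (j, L, (j, L), e)) rfl hk hkZ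
        (fun Q hQ => (enum_sound hQ).2.1) (hc j hj.le) hZ1
      simp only [Tm.time, Tm.eval, Op.eval, Var.get, setRank_eval, hn, hm, hK]
      have h1 : rowRank inp n' m' j ≤ m' := by
        refine sum_range_le_of_le_one (fun x => ?_) m'
        split_ifs <;> omega
      have c1 := op_cost_le (a := rowRank inp n' m' j) (b := K') (Z := Z) (by omega) hKZ
      split_ifs <;> omega)

theorem bestList_time_le {inp : ℕ → ℕ} (hinp : ∀ a, inp a ≤ 1) {n : Var Γ .nat}
    {L : Var Γ (.list (.prod .nat (.list .nat)))} {e : Env Γ} {Z c n' m' : ℕ}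
    {L' : List (ℕ × List ℕ)} (hL : L.get e = L') (hn : n.get e = n')
    (hLl : ∀ Q ∈ L', Q.2.length ≤ Z) (hLm : ∀ Q ∈ L', ∀ i ∈ Q.2, i < m')
    (hZ : m' * n' + n' + m' ≤ Z) (hZ1 : 1 ≤ Z) (hc : L'.length ≤ c) :
    (bestList L n).time inp e ≤ 5 + c * (coverageTime Z + (Z + 1) ^ 2 + 30) := by
  have hu : ∀ Q, rowsUnique inp n' Q ≤ Z := fun Q =>
    (sum_range_le_of_le_one (fun x => by split_ifs <;> omega) n').trans (by omega)
  simp only [bestList, Tm.time, Tm.eval, Op.eval, Var.get, hL]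
  refine Nat.add_le_add (by omega : 1 + (1 + 1 + 1) + 1 ≤ 5) ((foldSum_le _ _ _ L'
    (B := coverageTime Z + (Z + 1) ^ 2 + 30) fun P Q hP => ?_).trans (Nat.mul_le_mul_right _ hc))
  have hQ : Q ∈ L' := hP.subset (by simp)
  simp only [uniqueCoverage_eval, Var.get, hn]
  set b := P.foldl (fun (a : ℕ × List ℕ) (x : ℕ × List ℕ) =>
    if (if a.1 < rowsUnique inp n' x.2 then 1 else 0) ≠ 0 then (rowsUnique inp n' x.2, x.2) else a)
    (0, []) with hb
  have hbZ : b.1 ≤ Z := by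
    have : ∀ (P : List (ℕ × List ℕ)) (a : ℕ × List ℕ), a.1 ≤ Z → (P.foldl
        (fun (a : ℕ × List ℕ) (x : ℕ × List ℕ) =>
          if (if a.1 < rowsUnique inp n' x.2 then 1 else 0) ≠ 0 then
            (rowsUnique inp n' x.2, x.2) else a) a).1 ≤ Z := by
      intro P
      induction P with
      | nil => exact fun a ha => ha
      | cons x P ih =>
        intro a ha
        refine ih _ ?_
        dsimp only
        split_ifs <;> first | exact hu _ | exact ha
    exact this P _ (Nat.zero_le Z)
  have t1 := uniqueCoverage_time_le (Γ := .list .nat :: .prod .nat (.list .nat) ::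
    .prod .nat (.list .nat) :: Γ) hinp (Q := .zero) (n := n.succ.succ.succ) (e := (Q.2, Q, b, e))
    rfl hn (hLl Q hQ) (hLm Q hQ) hZ hZ1
  have c1 := op_cost_le hbZ (hu Q.2)
  clear_value b
  dsimp only [Ty.Val] at *
  split_ifs <;> omega

theorem ite_var_time {τ : Ty} (inp : ℕ → ℕ) (c : Tm Γ .nat) (u v : Var Γ τ) (e : Env Γ) :
    (Tm.ite c (.var u) (.var v)).time inp e = c.time inp e + 2 := by
  rw [Tm.time]
  split_ifs <;> rfl

/-- The factor of the number of lists in the running time. -/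
def listTime (Z : ℕ) : ℕ :=
  (Z + 1) * (2 * (Z + 1) ^ 2 + 30) + (coverageTime Z + (Z + 1) ^ 2 + 30)

/-- The part of the running time that does not depend on the number of lists. -/
def baseTime (Z : ℕ) : ℕ := (Z + 1) * (rankTime Z + (Z + 1) ^ 2 + 2 * Z + 40) + 40

/-- The running time, in terms of a bound `c` for the number of lists. The last summand is the cost
of the comparison of `m` and `K`, the only operation on a number that may be large. -/
theorem uniqueTopSets_time_le {inp : ℕ → ℕ} (hinp : ∀ a, inp a ≤ 1) {n m k K Z c : ℕ}
    (hZ : m * n + n + m ≤ Z) (hZ1 : 1 ≤ Z) (hkm : k ≤ m)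
    (hc : ∀ j ≤ m, (enum inp n m k (min m K) j).length ≤ c) :
    uniqueTopSets.time inp (n, m, k, K, ()) ≤
      c * listTime Z + baseTime Z + (Nat.size m + 1) * (Nat.size K + 1) := by
  have hite : (if (if m < K then 1 else 0) ≠ 0 then m else K) = min m K := by
    split_ifs <;> omega
  have t1 := allLists_time_le (Γ := [.nat, .nat, .nat, .nat, .nat]) hinp (n := .succ .zero)
    (m := .succ (.succ .zero)) (k := .succ (.succ (.succ .zero))) (K := .zero)
    (n' := n) (m' := m) (k' := k) (K' := min m K) (e := (min m K, n, m, k, K, ()))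
    rfl rfl rfl rfl hZ hZ1 (by omega) (by omega) hc
  set L := enum inp n m k (min m K) m with hL
  have t2 := bestList_time_le (Γ := [.list (.prod .nat (.list .nat)), .nat, .nat, .nat, .nat, .nat])
    hinp (n := .succ (.succ .zero)) (L := .zero) (e := (L, min m K, n, m, k, K, ())) (m' := m)
    rfl rfl (fun Q hQ => by
      have := enum_sound hQ
      omega) (fun Q hQ i hi => mem_range.1 (mem_filter.1 ((enum_sound hQ).2.2.2 i hi)).1) hZ hZ1
    (hc m le_rfl)
  have hval : (allLists (.succ .zero) (.succ (.succ .zero)) (.succ (.succ (.succ .zero))) .zero :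
      Tm [.nat, .nat, .nat, .nat, .nat] _).eval inp (min m K, n, m, k, K, ()) = L :=
    allLists_eval inp _ _ _ _ _
  have htime : uniqueTopSets.time inp (n, m, k, K, ()) ≤
      (6 + (Nat.size m + 1) * (Nat.size K + 1)) +
      ((allLists (.succ .zero) (.succ (.succ .zero)) (.succ (.succ (.succ .zero))) .zero :
      Tm [.nat, .nat, .nat, .nat, .nat] _).time inp (min m K, n, m, k, K, ()) +
      ((bestList .zero (.succ (.succ .zero)) :
        Tm [.list (.prod .nat (.list .nat)), .nat, .nat, .nat, .nat, .nat] _).time inp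
        (L, min m K, n, m, k, K, ()) + 1) + 1) + 1 := by
    rw [← hval, ← hite]
    simp only [uniqueTopSets, Tm.time.eq_5, ite_var_time]
    simp only [Tm.time, Tm.eval, Op.eval, Var.get]
    refine Nat.add_le_add_right (Nat.add_le_add_right ?_ _) _
    omega
  refine htime.trans ?_
  unfold listTime baseTime
  have e1 : (Z + 1) * ((rankTime Z + (Z + 1) ^ 2 + 20 + c * (2 * (Z + 1) ^ 2 + 30)) + 2 * Z + 20) =
      c * ((Z + 1) * (2 * (Z + 1) ^ 2 + 30)) +
        (Z + 1) * (rankTime Z + (Z + 1) ^ 2 + 2 * Z + 40) := by ring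
  rw [mul_add c]
  omega

theorem polyBound_time :
    PolyBound fun Z => 3 * listTime Z + baseTime Z + 2 * (Z + 1) * (Z + 3) := by
  have hid := PolyBound.id
  have hc := PolyBound.const
  have h1 : PolyBound fun Z => Z + 1 := hid.add (hc 1)
  have hsq : PolyBound fun Z => (Z + 1) ^ 2 := by simpa only [sq] using h1.mul h1
  have hsize : PolyBound sizeTime := (hc 2).add (h1.mul
    (((((hc 4).mul hsq).add ((hc 4).mul hid)).add (hc 20)).add ((hc 2).mul hid) |>.add (hc 20)))
  have hrank : PolyBound rankTime := (hc 2).add (h1.mul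
    ((((((hc 2).mul hsize).add ((hc 4).mul hsq)).add (hc 30)).add ((hc 2).mul hid)).add (hc 20)))
  have hcov : PolyBound coverageTime := (hc 2).add (h1.mul
    (((((hid.mul ((((hc 4).mul hsq).add ((hc 4).mul hid)).add (hc 30))).add ((hc 4).mul hsq)).add
      (hc 30)).add ((hc 2).mul hid)).add (hc 20)))
  have hlist : PolyBound listTime :=
    (h1.mul (((hc 2).mul hsq).add (hc 30))).add ((hcov.add hsq).add (hc 30))
  have hbase : PolyBound baseTime :=
    (h1.mul (((hrank.add hsq).add ((hc 2).mul hid)).add (hc 40))).add (hc 40)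
  exact (((hc 3).mul hlist).add hbase).add (((hc 2).mul h1).mul (hid.add (hc 3)))

end Machine

/-! ### The number of subcollections, and the time bound -/

namespace Machine

open Finset

/-- The number of small subcollections of the kernel, compared with `(e x)^k` for
`x = r (φ + 1) / ε`. -/
theorem sum_choose_le_of_ceil {k N : ℕ} {x : ℝ} (hk : 2 ≤ k) (hx : 1 ≤ x) (hkN : k ≤ N)
    (hN : N ≤ ⌈(k : ℝ) * x⌉₊) :
    ((∑ i ∈ range (k + 1), N.choose i : ℕ) : ℝ) ≤ 3 * (Real.exp 1 * x) ^ k := by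
  have hk0 : (0 : ℝ) < k := by positivity
  have hN' : (N : ℝ) ≤ k * x + 1 :=
    (Nat.cast_le.2 hN).trans (Nat.ceil_lt_add_one (by positivity)).le
  refine (MUC.sum_choose_le (by omega) hkN).trans ?_
  -- rounding up costs a factor `(1 + 1 / k) ^ k ≤ e`
  have h1 : Real.exp 1 * N / k ≤ (Real.exp 1 * x) * Real.exp (1 / k) := by
    have h2 : (N : ℝ) ≤ k * x * (1 / k + 1) := by
      refine hN'.trans ?_
      have : (k : ℝ) * x * (1 / k + 1) = x + k * x := by field_simp
      rw [this]
      linarith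
    have h3 := Real.add_one_le_exp (1 / (k : ℝ))
    rw [div_le_iff₀ hk0, mul_assoc, mul_assoc]
    refine mul_le_mul_of_nonneg_left (h2.trans ?_) (Real.exp_pos 1).le
    have := mul_le_mul_of_nonneg_left h3 (by positivity : (0 : ℝ) ≤ k * x)
    linarith
  refine (pow_le_pow_left₀ (by positivity) h1 k).trans ?_
  rw [mul_pow, ← Real.exp_nat_mul, mul_one_div_cancel hk0.ne', mul_comm]
  have := Real.exp_one_lt_d9
  gcongr
  linarith

/-- The count `N` of the lists is at most `3 y`, and all other factors are polynomial in `Z`. -/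
theorem time_le_of_count {T N l b c Z s t : ℕ} {y : ℝ}
    (hpoly : 3 * l + b + 2 * (Z + 1) * (Z + 3) ≤ c * Z ^ c)
    (hT : T ≤ N * l + b + s * t) (hN : (N : ℝ) ≤ 3 * y)
    (hst : (s : ℝ) * t ≤ (2 * (Z + 1) * (Z + 3)) * y) (hy : 1 ≤ y) :
    (T : ℝ) ≤ y * (c * (Z : ℝ) ^ c) := by
  have e1 : (T : ℝ) ≤ N * l + b + s * t := by exact_mod_cast hT
  have e2 : (3 * l + b + 2 * (Z + 1) * (Z + 3) : ℝ) ≤ c * (Z : ℝ) ^ c := by exact_mod_cast hpoly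
  have e3 := mul_le_mul_of_nonneg_right hN (Nat.cast_nonneg (α := ℝ) l)
  have e4 := mul_le_mul_of_nonneg_left e2 (by linarith : (0 : ℝ) ≤ y)
  have e5 : (b : ℝ) ≤ y * b := le_mul_of_one_le_left (Nat.cast_nonneg _) hy
  refine e1.trans (le_trans ?_ e4)
  rw [mul_add, mul_add]
  have e6 : 3 * y * (l : ℝ) = y * (3 * l) := by ring
  have e7 : (2 * (Z + 1) * (Z + 3)) * y = y * (2 * ((Z : ℝ) + 1) * (Z + 3)) := by ring
  linarith

/-- A polynomial in `m n + n + m ≤ 3 m n` is a polynomial in `m n / ε`. -/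
theorem mul_pow_le_of_size (c : ℕ) {m n Z : ℕ} {ε : ℝ} (hm : (1 : ℝ) ≤ m) (hn : (1 : ℝ) ≤ n)
    (hε : 0 < ε) (hε1 : ε ≤ 1) (hZ : Z = m * n + n + m) :
    (c : ℝ) * (Z : ℝ) ^ c ≤ ((c * 3 ^ c + c : ℕ) : ℝ) *
      ((m : ℝ) * n * (1 / ε)) ^ (c * 3 ^ c + c) := by
  set w : ℝ := m * n * (1 / ε) with hw
  have hmn : (m : ℝ) * n ≤ w := by
    rw [hw]
    exact le_mul_of_one_le_right (by positivity) (by rw [le_div_iff₀ hε]; linarith)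
  have hmn1 : 1 ≤ (m : ℝ) * n := by nlinarith
  have hZw : (Z : ℝ) ≤ 3 * w := by
    rw [hZ]
    push_cast
    nlinarith
  clear_value w
  have hw1 : 1 ≤ w := hmn1.trans hmn
  have h1 : w ^ c ≤ w ^ (c * 3 ^ c + c) := pow_le_pow_right₀ hw1 (Nat.le_add_left _ _)
  have h2 : (Z : ℝ) ^ c ≤ (3 * w) ^ c := pow_le_pow_left₀ (Nat.cast_nonneg _) hZw c
  rw [mul_pow] at h2
  have h3 := mul_le_mul_of_nonneg_left h2 (Nat.cast_nonneg (α := ℝ) c)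
  have h4 := mul_le_mul_of_nonneg_left h1 (by positivity : (0 : ℝ) ≤ c * 3 ^ c)
  have h5 : (0 : ℝ) ≤ c * w ^ (c * 3 ^ c + c) := by positivity
  rw [Nat.cast_add, Nat.cast_mul, Nat.cast_pow, Nat.cast_ofNat]
  rw [add_mul]
  linarith

/-- The number of lists is at most `3 (e r (φ + 1) / ε) ^ k`, and the time for each list is
polynomial in `m` and `n`. The logarithm of the kernel size is absorbed by the first factor. -/
theorem exists_uniqueTopSets_time : ∃ c : ℕ,
    ∀ (m n : ℕ) (V : Fin m → Finset (Fin n)) (k r : ℕ) (φ ε : ℝ),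
      MUC.IsInstance V k r φ ε →
      (uniqueTopSets.time (tape V) (n, m, k, MUC.kernelSize k r φ ε, ()) : ℝ) ≤
        (Real.exp 1 * (r : ℝ) * (φ + 1) / ε) ^ k *
          ((c : ℝ) * ((m : ℝ) * (n : ℝ) * (1 / ε)) ^ c) := by
  obtain ⟨c, hc⟩ := polyBound_time
  refine ⟨c * 3 ^ c + c, ?_⟩
  intro m n V k r φ ε h
  have hn := h.pos.1
  have hk := h.two_le_k
  have hkm := h.k_le
  have hr := h.two_le_r
  have hφ := h.one_le_ratio
  have hε := h.eps_pos
  have hε1 := h.eps_lt_one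
  set x : ℝ := r * (φ + 1) / ε with hx
  have hx4 : 4 ≤ x := by
    rw [hx, le_div_iff₀ hε]
    have h1 : (2 : ℝ) ≤ r := by exact_mod_cast hr
    nlinarith
  set K := MUC.kernelSize k r φ ε with hK
  have hKx : K = ⌈(k : ℝ) * x⌉₊ := by
    rw [hK, MUC.kernelSize, hx]
    congr 1
    ring
  have hkK : k ≤ K := by
    have h1 : (k : ℝ) ≤ K := by
      rw [hKx]
      refine le_trans ?_ (Nat.le_ceil _)
      have : (0 : ℝ) ≤ k := by positivity
      nlinarith
    exact_mod_cast h1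
  set Z := m * n + n + m with hZ
  have hZ1 : 1 ≤ Z := by omega
  set N := ∑ i ∈ range (k + 1), (min m K).choose i with hN
  have hlen : ∀ j ≤ m, (enum (tape V) n m k (min m K) j).length ≤ N := by
    intro j hj
    rw [enum_length]
    refine sum_le_sum fun i _ => Nat.choose_le_choose i ?_
    have h1 : topRows (tape V) n m (min m K) j ⊆ (univ.filter fun i : Fin m =>
        rowRank (tape V) n m i < min m K).map Fin.valEmbedding := by
      intro a ha
      obtain ⟨ha, hr⟩ := mem_filter.1 ha
      have ha := mem_range.1 ha
      exact mem_map.2 ⟨⟨a, by omega⟩, mem_filter.2 ⟨mem_univ _, hr⟩, rfl⟩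
    refine (card_le_card h1).trans ?_
    rw [card_map, (isTopSets_rank V K).1]
    omega
  have ht := uniqueTopSets_time_le (inp := tape V) (fun a => incidence_le_one V _ _) (K := K)
    hZ.ge hZ1 hkm hlen
  have hpoly : 3 * listTime Z + baseTime Z + 2 * (Z + 1) * (Z + 3) ≤ c * Z ^ c := hc Z hZ1
  clear_value N Z K x
  generalize uniqueTopSets.time (tape V) (n, m, k, K, ()) = T at ht ⊢
  generalize listTime Z = l, baseTime Z = b at ht hpoly
  have hNreal : (N : ℝ) ≤ 3 * (Real.exp 1 * x) ^ k :=
    hN ▸ sum_choose_le_of_ceil hk (by linarith) (by omega) (by omega)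
  obtain ⟨y, hy⟩ : ∃ y, y = (Real.exp 1 * x) ^ k := ⟨_, rfl⟩
  rw [← hy] at hNreal
  have hex : 1 ≤ Real.exp 1 * x := by
    have := Real.exp_one_gt_d9
    nlinarith
  have hxy : x ≤ y := by
    have h1 : Real.exp 1 * x ≤ y := hy ▸ le_self_pow₀ hex (by omega)
    have := Real.exp_one_gt_d9
    nlinarith
  have hy1 : 1 ≤ y := hy ▸ one_le_pow₀ hex
  have hm2 : (2 : ℝ) ≤ m := by exact_mod_cast hk.trans hkm
  have hmZ : (m : ℝ) ≤ Z := by exact_mod_cast (by omega : m ≤ Z)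
  have hKy : ((Nat.size m + 1 : ℕ) : ℝ) * ((Nat.size K + 1 : ℕ) : ℝ) ≤
      (2 * (Z + 1) * (Z + 3)) * y := by
    have h1 : ((Nat.size m + 1 : ℕ) : ℝ) ≤ Z + 1 := by
      exact_mod_cast Nat.succ_le_succ ((size_le_self m).trans (by omega))
    have h2 : ((Nat.size K + 1 : ℕ) : ℝ) ≤ (Z + 3) * y := by
      have h3 : ((Nat.size K + 1 : ℕ) : ℝ) ≤ (K : ℝ) + 1 := by
        exact_mod_cast Nat.succ_le_succ (size_le_self K)
      have h4 : (K : ℝ) ≤ k * x + 1 := by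
        rw [hKx]
        exact (Nat.ceil_lt_add_one (by positivity)).le
      have h5 : (k : ℝ) * x ≤ Z * y := by
        have : (k : ℝ) ≤ Z := le_trans (by exact_mod_cast hkm) hmZ
        gcongr
      linarith
    have h6 : (0 : ℝ) ≤ (Z + 1) * ((Z + 3) * y) := by positivity
    have := mul_le_mul h1 h2 (by positivity) (by positivity)
    linarith
  have hfinal : (T : ℝ) ≤ y * (c * (Z : ℝ) ^ c) :=
    time_le_of_count hpoly ht hNreal hKy hy1
  refine hfinal.trans ?_
  have hbase : Real.exp 1 * (r : ℝ) * (φ + 1) / ε = Real.exp 1 * x := by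
    rw [hx]
    ring
  rw [hbase, ← hy]
  refine mul_le_mul_of_nonneg_left ?_ (by linarith)
  exact mul_pow_le_of_size c (by linarith) (by exact_mod_cast hn) hε hε1.le hZ

end Machine

namespace Machine

open Finset Hashing

variable {Γ : List Ty}

/-! ### The streaming algorithm -/

/-- The innermost variable. -/
abbrev x0 {a : Ty} : Var (a :: Γ) a := .zero

/-- The second innermost variable. -/
abbrev x1 {a b : Ty} : Var (a :: b :: Γ) b := .succ x0

/-- The third innermost variable. -/
abbrev x2 {a b c : Ty} : Var (a :: b :: c :: Γ) c := .succ x1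

/-- The fourth innermost variable. -/
abbrev x3 {a b c d : Ty} : Var (a :: b :: c :: d :: Γ) d := .succ x2

/-- The fifth innermost variable. -/
abbrev x4 {a b c d f : Ty} : Var (a :: b :: c :: d :: f :: Γ) f := .succ x3

/-- The variable `v`, seen inside five further bindings. -/
abbrev Var.up5 {τ a b c d f : Ty} (v : Var Γ τ) : Var (a :: b :: c :: d :: f :: Γ) τ :=
  v.succ.succ.succ.succ.succ

/-- A stored set: its ID, its size, and a list of some of its elements. -/
abbrev EntryTy : Ty := .prod .nat (.prod .nat (.list .nat))

/-- The memory: the random numbers, the prime modulus, the sampling threshold, the largest size so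
far, and the stored sets. -/
abbrev MemTy : Ty := .prod (.list .nat) (.prod .nat (.prod .nat (.prod .nat (.list EntryTy))))

/-- The number of binary digits. -/
def bitLength (a : Var Γ .nat) : Tm Γ .nat :=
  .snd (.loop (.var a) (.pair (.var a) (.lit 0))
    (.ite (.fst v0) (.pair (.op .div (.fst v0) (.lit 2)) (.op .add (.snd v0) (.lit 1))) v0))

/-- Whether `q ≥ 2` is a prime number, by trial division. -/
def isPrime (q : Var Γ .nat) : Tm Γ .nat :=
  forN (.var q) (.lit 1)
    (.ite (.op .lt (.lit 1) v0) (.ite (.op .mod (.var q.up3) v0) v1 (.lit 0)) v1)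

/-- The least prime number greater than `n`, which is at most `2 n` by Bertrand's postulate. -/
def nextPrime (n : Var Γ .nat) : Tm Γ .nat :=
  .loop (.var n) (.op .add (.var n) (.lit 1))
    (.ite (isPrime x0) v0 (.op .add v0 (.lit 1)))

/-- The number of coefficients of the hash function: an even number `t` such that `2 ^ t` is at
least `2 m ^ a` times the number of events in the union bound. -/
def degree (a : ℕ) (m k : Var Γ .nat) : Tm Γ .nat :=
  .op .mul (.lit 2) (.op .mul (.op .add (.op .mul (.lit 2) (.var k)) (.lit (a + 3))) (bitLength m))

/-- The sampling threshold: elements are sampled at such a rate that about so many are expected in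
the largest set. -/
def threshold (a : ℕ) (m k e : Var Γ .nat) : Tm Γ .nat :=
  .op .mul (.lit 576) (.op .mul (degree a m k) (.op .mul (.var e) (.var e)))

/-- The hash value of `x`. -/
def hash (x : Var Γ .nat) (seeds : Var Γ (.list .nat)) (q : Var Γ .nat) : Tm Γ .nat :=
  .fold (.var seeds) (.lit 0)
    (.op .mod (.op .add (.op .mul v1 (.var x.succ.succ)) v0) (.var q.succ.succ))

/-- Whether `x` is sampled when the largest size is `M`. -/
def sampled (x : Var Γ .nat) (seeds : Var Γ (.list .nat)) (q T M : Var Γ .nat) : Tm Γ .nat :=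
  .op .lt (.op .mul (hash x seeds q) (.var M)) (.op .mul (.var T) (.var q))

/-- The size of the arriving set. -/
def arrivingSize (n : Var Γ .nat) : Tm Γ .nat :=
  forN (.var n) (.lit 0) (.op .add v1 (.read v0))

/-- A list of at most `4 T` sampled elements of the arriving set, with its length. -/
def collect (n : Var Γ .nat) (seeds : Var Γ (.list .nat)) (q T M : Var Γ .nat) :
    Tm Γ (.prod .nat (.list .nat)) :=
  forN (.var n) (.pair (.lit 0) .nil)
    (.ite (.read v0) (.ite (sampled x0 seeds.up3 q.up3 T.up3 M.up3)
      (.ite (.op .lt (.fst v1) (.op .mul (.lit 4) (.var T.up3)))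
        (.pair (.op .add (.fst v1) (.lit 1)) (.cons v0 (.snd v1))) v1) v1) v1)

/-- A stored set of least size, among `x` and the list `l`. -/
def leastEntry (x : Var Γ EntryTy) (l : Var Γ (.list EntryTy)) : Tm Γ EntryTy :=
  .fold (.var l) (.var x) (.ite (.op .lt (.fst (.snd v0)) (.fst (.snd v1))) v0 v1)

/-- Remove the stored set with the ID of `x`. -/
def removeEntry (x : Var Γ EntryTy) (l : Var Γ (.list EntryTy)) : Tm Γ (.list EntryTy) :=
  .fold (.var l) .nil (.ite (.op .eq (.fst v0) (.fst (.var x.succ.succ))) v1 (.cons v0 v1))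

/-- Remove a stored set of least size. -/
def evict (l : Var Γ (.list EntryTy)) : Tm Γ (.list EntryTy) :=
  .lcase (.var l) .nil (.bind (leastEntry x0 x1) (removeEntry x0 l.succ.succ.succ))

/-- If there are more than `K` stored sets, remove one of least size. -/
def trim (l : Var Γ (.list EntryTy)) (K : Var Γ .nat) : Tm Γ (.list EntryTy) :=
  .ite (.op .lt (.var K) (.fold (.var l) (.lit 0) (.op .add v1 (.lit 1))))
    (evict l) (.var l)

/-- How many sets are stored: a kernel for the error `1 / (2 ⌈1 / ε⌉)`. -/
def capacity (k r f e : Var Γ .nat) : Tm Γ .nat :=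
  .op .mul (.lit 2) (.op .mul (.op .mul (.var k) (.var r))
    (.op .mul (.op .add (.var f) (.lit 1)) (.var e)))

/-- Store the arriving set. The context is `M`, `s`, `T`, `q`, `seeds`, ID, memory, `n`, `m`, `k`,
`r`, `⌈φ⌉`, `⌈1 / ε⌉`, where `s` is the size of the arriving set and `M` the largest size so far. -/
def store : Tm (.nat :: .nat :: .nat :: .nat :: .list .nat :: .nat :: MemTy :: Params)
    (.list EntryTy) :=
  .bind (.cons (.pair (.var x0.up5) (.pair (.var x1) (.snd (collect x2.up5 x4 x3 x2 x0))))
      (.snd (.snd (.snd (.snd (.var x1.up5))))))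
    (.bind (capacity x0.up5.up5 x1.up5.up5 x2.up5.up5 x3.up5.up5) (trim x1 x0))

/-- The update of the memory. -/
def streamStep : Tm (.nat :: MemTy :: Params) MemTy :=
  .bind (.fst (.var x1)) (.bind (.fst (.snd (.var x2))) (.bind (.fst (.snd (.snd (.var x3))))
    (.bind (arrivingSize x0.up5)
      (.bind (.bind (.fst (.snd (.snd (.snd (.var x0.up5))))) (.ite (.op .lt v0 v1) v1 v0))
        (.pair (.var x4) (.pair (.var x3) (.pair (.var x2) (.pair (.var x0) store))))))))

/-- Whether `x` occurs in `l`. -/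
def member (x : Var Γ .nat) (l : Var Γ (.list .nat)) : Tm Γ .nat :=
  .fold (.var l) (.lit 0) (.ite (.op .eq v0 (.var x.succ.succ)) (.lit 1) v1)

/-- The number of sampled elements that occur in exactly one of the stored sets in `l`. -/
def estimate (l : Var Γ (.list EntryTy)) (n : Var Γ .nat) (seeds : Var Γ (.list .nat))
    (q T M : Var Γ .nat) : Tm Γ .nat :=
  forN (.var n) (.lit 0)
    (.ite (sampled x0 seeds.up3 q.up3 T.up3 M.up3)
      (.op .add v1 (.op .eq (.lit 1) (.fold (.var l.up3) (.lit 0)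
        (.bind (.snd (.snd v0)) (.op .add v2 (member x3 x0)))))) v1)

/-- The stored sets selected by the binary digits of `c`, with their number. -/
def select (l : Var Γ (.list EntryTy)) (c : Var Γ .nat) :
    Tm Γ (.prod .nat (.prod .nat (.list EntryTy))) :=
  .fold (.var l) (.pair (.var c) (.pair (.lit 0) .nil))
    (.pair (.op .div (.fst v1) (.lit 2)) (.ite (.op .mod (.fst v1) (.lit 2))
      (.pair (.op .add (.fst (.snd v1)) (.lit 1)) (.cons v0 (.snd (.snd v1)))) (.snd v1)))

/-- The IDs of stored sets. -/
def idList (l : Var Γ (.list EntryTy)) : Tm Γ (.list .nat) :=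
  .fold (.var l) .nil (.cons (.fst v0) v1)

/-- The number of subcollections of the stored sets. -/
def twoPowLength (l : Var Γ (.list EntryTy)) : Tm Γ .nat :=
  .loop (.fold (.var l) (.lit 0) (.op .add v1 (.lit 1))) (.lit 1) (.op .add v0 v0)

/-- The search for the best subcollection of at most `k` stored sets. -/
def search (l : Var Γ (.list EntryTy)) (n k : Var Γ .nat) (seeds : Var Γ (.list .nat))
    (q T M : Var Γ .nat) : Tm Γ (.prod .nat (.list .nat)) :=
  forN (twoPowLength l) (.pair (.lit 0) .nil)
    (.bind (select l.up3 x0) (.bind (.snd (.snd v0))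
      (.ite (.op .lt (.var k.up5) (.fst (.snd (.var x1)))) (.var x3)
        (.bind (estimate x0 n.up5 seeds.up5 q.up5 T.up5 M.up5)
          (.ite (.op .lt (.fst (.var x4)) v0) (.pair v0 (idList x1)) (.var x4))))))

/-- The output. After the bound variables, the context is the stored sets, `M`, `T`, `q`, `seeds`,
the memory, `n`, `m`, `k`, `r`, `⌈φ⌉`, `⌈1 / ε⌉`. -/
def streamOutput : Tm (MemTy :: Params) (.list .nat) :=
  .bind (.fst (.var x0)) (.bind (.fst (.snd (.var x1))) (.bind (.fst (.snd (.snd (.var x2))))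
    (.bind (.fst (.snd (.snd (.snd (.var x3))))) (.bind (.snd (.snd (.snd (.snd (.var x4)))))
      (.snd (search x0 x1.up5 x3.up5 x4 x3 x2 x1))))))

/-- The streaming algorithm with success probability at least `1 - m⁻ᵃ`. -/
def streamAlg (a : ℕ) : StreamAlg where
  mem := MemTy
  seedLen := degree a x1 x2
  seedMod := nextPrime x0
  start := .pair (.var x0) (.pair (nextPrime x1) (.pair (threshold a x2 x3 x1.up5)
    (.pair (.lit 0) .nil)))
  step := streamStep
  output := streamOutput

/-! ### The values computed by the streaming algorithm -/

theorem size_eq_succ {x : ℕ} (hx : x ≠ 0) : Nat.size x = Nat.size (x / 2) + 1 := by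
  refine le_antisymm (Nat.size_le.2 ?_) (Nat.lt_size.2 ?_)
  · have := Nat.lt_size_self (x / 2)
    rw [pow_succ]
    omega
  · rcases Nat.eq_zero_or_pos (x / 2) with h | h
    · rw [h, Nat.size_zero, pow_zero]
      omega
    · obtain ⟨s, hs⟩ := Nat.exists_eq_succ_of_ne_zero (Nat.size_pos.2 h).ne'
      have h1 := Nat.lt_size.1 (by omega : s < Nat.size (x / 2))
      rw [hs, Nat.succ_eq_add_one, pow_succ]
      omega

theorem bitLength_iterate (inp : ℕ → ℕ) (e : Env Γ) (a j : ℕ) :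
    ∃ b c : ℕ, (fun x : ℕ × ℕ => (Tm.ite (.fst v0) (.pair (.op .div (.fst v0) (.lit 2))
      (.op .add (.snd v0) (.lit 1))) v0 : Tm (.prod .nat .nat :: Γ) _).eval inp (x, e))^[j] (a, 0) =
      (b, c) ∧ c + Nat.size b = Nat.size a ∧ b ≤ a - j := by
  induction j with
  | zero => exact ⟨a, 0, rfl, by omega, by omega⟩
  | succ j ih =>
    obtain ⟨b, c, h, h1, h2⟩ := ih
    rw [Function.iterate_succ_apply', h]
    simp only [Tm.eval, Var.get, Op.eval]
    by_cases hb : b = 0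
    · exact ⟨b, c, by simp [hb], h1, by omega⟩
    · refine ⟨b / 2, c + 1, by simp [hb], ?_, by omega⟩
      rw [size_eq_succ hb] at h1
      omega

theorem bitLength_eval (inp : ℕ → ℕ) (a : Var Γ .nat) (e : Env Γ) :
    (bitLength a).eval inp e = Nat.size (a.get e) := by
  obtain ⟨b, c, h, h1, h2⟩ := bitLength_iterate inp e (a.get e) (a.get e)
  have hb : b = 0 := by omega
  rw [hb, Nat.size_zero, add_zero] at h1
  simp only [bitLength, Tm.eval, Var.get] at h ⊢
  rw [h]
  exact h1

theorem isPrime_forAcc (inp : ℕ → ℕ) (q : Var Γ .nat) (e : Env Γ) (j : ℕ) :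
    forAcc inp (.lit 1)
      (.ite (.op .lt (.lit 1) v0) (.ite (.op .mod (.var q.up3) v0) v1 (.lit 0)) v1) e j =
      if ∀ d < j, 1 < d → ¬ d ∣ q.get e then 1 else 0 := by
  induction j with
  | zero => simp [forAcc, Tm.eval]
  | succ j ih =>
    have hs : ∀ P : ℕ → Prop, (∀ d < j + 1, P d) ↔ (∀ d < j, P d) ∧ P j := fun P => by
      simp only [Nat.lt_succ_iff_lt_or_eq, or_imp, forall_and, forall_eq]
    unfold forAcc at ih ⊢
    rw [iter_succ, ih]
    simp only [Tm.eval, Var.get, Op.eval, hs]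
    by_cases h1 : 1 < j
    · by_cases h2 : j ∣ q.get e
      · simp [h1, h2, Nat.mod_eq_zero_of_dvd h2]
      · have : q.get e % j ≠ 0 := fun h => h2 (Nat.dvd_of_mod_eq_zero h)
        simp [h1, h2, this]
    · simp [h1]

theorem isPrime_eval (inp : ℕ → ℕ) (q : Var Γ .nat) (e : Env Γ) (hq : 2 ≤ q.get e) :
    (isPrime q).eval inp e = if (q.get e).Prime then 1 else 0 := by
  rw [isPrime, forN_eval, isPrime_forAcc]
  refine if_congr ?_ rfl rfl
  rw [Nat.prime_def_lt']
  simp only [Tm.eval]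
  exact ⟨fun h => ⟨hq, fun d h1 h2 => h d h2 h1⟩, fun h d h1 h2 => h.2 d h2 h1⟩

theorem exists_prime_gt (n : ℕ) : ∃ p, n < p ∧ p.Prime := by
  obtain ⟨p, hp, h⟩ := Nat.exists_infinite_primes (n + 1)
  exact ⟨p, hp, h⟩

/-- The least prime number greater than `n`. -/
def primeAbove (n : ℕ) : ℕ := Nat.find (exists_prime_gt n)

theorem primeAbove_gt (n : ℕ) : n < primeAbove n := (Nat.find_spec (exists_prime_gt n)).1

theorem primeAbove_prime (n : ℕ) : (primeAbove n).Prime := (Nat.find_spec (exists_prime_gt n)).2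

theorem primeAbove_le {n : ℕ} (hn : n ≠ 0) : primeAbove n ≤ 2 * n := by
  obtain ⟨p, hp, h1, h2⟩ := Nat.exists_prime_lt_and_le_two_mul n hn
  exact (Nat.find_min' (exists_prime_gt n) ⟨h1, hp⟩).trans h2

theorem nextPrime_iterate (inp : ℕ → ℕ) (e : Env Γ) {n : ℕ} (hn : n ≠ 0) (j : ℕ) :
    (fun a : ℕ => (Tm.ite (isPrime x0) v0 (.op .add v0 (.lit 1)) : Tm (.nat :: Γ) .nat).eval inp
      (a, e))^[j] (n + 1) = min (n + 1 + j) (primeAbove n) := by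
  have hgt := primeAbove_gt n
  induction j with
  | zero => simp only [Function.iterate_zero, id_eq]; omega
  | succ j ih =>
    rw [Function.iterate_succ_apply', ih]
    set b := min (n + 1 + j) (primeAbove n) with hb
    have hp := isPrime_eval inp (x0 : Var (.nat :: Γ) .nat) (b, e)
      (show 2 ≤ b by omega)
    simp only [Tm.eval, Var.get, Op.eval] at hp ⊢
    rw [hp]
    by_cases h : primeAbove n ≤ n + 1 + j
    · have : b = primeAbove n := by omega
      have hprime : b.Prime := this ▸ primeAbove_prime n
      simp only [hprime, if_true, ne_eq, one_ne_zero, not_false_eq_true]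
      omega
    · have hprime : ¬ b.Prime := fun hpr => by
        have : primeAbove n ≤ b := Nat.find_min' (exists_prime_gt n) ⟨by omega, hpr⟩
        omega
      simp only [hprime, if_false, ne_eq, not_true_eq_false]
      exact (by omega : (b + 1 : ℕ) = min (n + 1 + (j + 1)) (primeAbove n))

theorem nextPrime_eval (inp : ℕ → ℕ) (n : Var Γ .nat) (e : Env Γ) (hn : n.get e ≠ 0) :
    (nextPrime n).eval inp e = primeAbove (n.get e) := by
  have := nextPrime_iterate inp e hn (n.get e)
  simp only [nextPrime, Tm.eval, Var.get, Op.eval] at this ⊢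
  rw [this]
  have h2 := primeAbove_le hn
  exact min_eq_right (by
    rw [two_mul] at h2
    exact h2.trans (Nat.add_le_add_right (Nat.le_succ _) _))

/-- The number of coefficients of the hash function. -/
def degreeVal (a m k : ℕ) : ℕ := 2 * ((2 * k + (a + 3)) * Nat.size m)

theorem degree_eval (inp : ℕ → ℕ) (a : ℕ) (m k : Var Γ .nat) (e : Env Γ) :
    (degree a m k).eval inp e = degreeVal a (m.get e) (k.get e) := by
  simp only [degree, Tm.eval, bitLength_eval, Op.eval, degreeVal]

/-- The sampling threshold. -/
def thresholdVal (a m k d : ℕ) : ℕ := 576 * (degreeVal a m k * (d * d))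

theorem threshold_eval (inp : ℕ → ℕ) (a : ℕ) (m k d : Var Γ .nat) (e : Env Γ) :
    (threshold a m k d).eval inp e = thresholdVal a (m.get e) (k.get e) (d.get e) := by
  simp only [threshold, Tm.eval, degree_eval, Op.eval, thresholdVal]

theorem hash_eval (inp : ℕ → ℕ) (x : Var Γ .nat) (s : Var Γ (.list .nat)) (q : Var Γ .nat)
    (e : Env Γ) : (hash x s q).eval inp e = horner (q.get e) (s.get e) (x.get e) := by
  simp only [hash, Tm.eval, Op.eval, Var.get, horner]

/-- The element `x` is sampled, when `M` is the largest size. -/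
def IsSampled (s : List ℕ) (q T M x : ℕ) : Prop := horner q s x * M < T * q

instance (s : List ℕ) (q T M x : ℕ) : Decidable (IsSampled s q T M x) := by
  unfold IsSampled; infer_instance

theorem sampled_eval (inp : ℕ → ℕ) (x : Var Γ .nat) (s : Var Γ (.list .nat)) (q T M : Var Γ .nat)
    (e : Env Γ) : (sampled x s q T M).eval inp e =
      if IsSampled (s.get e) (q.get e) (T.get e) (M.get e) (x.get e) then 1 else 0 := by
  simp only [sampled, Tm.eval, hash_eval, Op.eval, IsSampled]

theorem arrivingSize_forAcc (inp : ℕ → ℕ) (e : Env Γ) (j : ℕ) :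
    forAcc inp (.lit 0) (.op .add v1 (.read v0)) e j = ∑ x ∈ range j, inp x := iter_add _

theorem arrivingSize_eval (inp : ℕ → ℕ) (n : Var Γ .nat) (e : Env Γ) :
    (arrivingSize n).eval inp e = ∑ x ∈ range (n.get e), inp x := by
  rw [arrivingSize, forN_eval, arrivingSize_forAcc]
  rfl

/-- Collecting sampled elements of a set given by its indicator function `inp`. -/
def collectVal (inp : ℕ → ℕ) (s : List ℕ) (q T M : ℕ) (j : ℕ) : ℕ × List ℕ :=
  iter (fun x a => if inp x ≠ 0 ∧ IsSampled s q T M x ∧ a.1 < 4 * T then (a.1 + 1, x :: a.2) else a)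
    (0, []) j

theorem collect_forAcc (inp : ℕ → ℕ) (s : Var Γ (.list .nat)) (q T M : Var Γ .nat) (e : Env Γ)
    (j : ℕ) : forAcc inp (.pair (.lit 0) .nil)
    (.ite (.read v0) (.ite (sampled x0 s.up3 q.up3 T.up3 M.up3)
      (.ite (.op .lt (.fst v1) (.op .mul (.lit 4) (.var T.up3)))
        (.pair (.op .add (.fst v1) (.lit 1)) (.cons v0 (.snd v1))) v1) v1) v1) e j =
    collectVal inp (s.get e) (q.get e) (T.get e) (M.get e) j := by
  unfold forAcc collectVal
  simp only [Tm.eval, sampled_eval, Op.eval, Var.get]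
  congr 1
  funext x a
  by_cases h1 : inp x = 0 <;>
    by_cases h2 : IsSampled (s.get e) (q.get e) (T.get e) (M.get e) x <;>
    by_cases h3 : a.1 < 4 * T.get e <;> simp [h1, h2, h3]

theorem collect_eval (inp : ℕ → ℕ) (n : Var Γ .nat) (s : Var Γ (.list .nat)) (q T M : Var Γ .nat)
    (e : Env Γ) : (collect n s q T M).eval inp e =
      collectVal inp (s.get e) (q.get e) (T.get e) (M.get e) (n.get e) := by
  rw [collect, forN_eval, collect_forAcc]
  rfl

/-- A stored set. -/
abbrev Entry : Type := ℕ × ℕ × List ℕ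

/-- A stored set of least size. -/
def leastVal (x : Entry) (l : List Entry) : Entry :=
  l.foldl (fun a y => if y.2.1 < a.2.1 then y else a) x

theorem leastEntry_eval (inp : ℕ → ℕ) (x : Var Γ EntryTy) (l : Var Γ (.list EntryTy)) (e : Env Γ) :
    (leastEntry x l).eval inp e = leastVal (x.get e) (l.get e) := by
  simp only [leastEntry, leastVal, Tm.eval, Op.eval, Var.get]
  congr 1
  funext a y
  by_cases h : y.2.1 < a.2.1 <;> simp [h]

/-- Removal of the stored sets with a given ID; the order is reversed. -/
def removeVal (i : ℕ) (l : List Entry) : List Entry :=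
  l.foldl (fun a y => if y.1 = i then a else y :: a) []

theorem removeEntry_eval (inp : ℕ → ℕ) (x : Var Γ EntryTy) (l : Var Γ (.list EntryTy)) (e : Env Γ) :
    (removeEntry x l).eval inp e = removeVal (x.get e).1 (l.get e) := by
  simp only [removeEntry, removeVal, Tm.eval, Op.eval, Var.get]
  congr 1
  funext a y
  by_cases h : y.1 = (x.get e).1 <;> simp [h]

/-- Removal of a least stored set. -/
def evictVal : List Entry → List Entry
  | [] => []
  | x :: l => removeVal (leastVal x l).1 (x :: l)

theorem evict_eval (inp : ℕ → ℕ) (l : Var Γ (.list EntryTy)) (e : Env Γ) :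
    (evict l).eval inp e = evictVal (l.get e) := by
  simp only [evict, Tm.eval, leastEntry_eval, removeEntry_eval, Var.get]
  rcases l.get e with _ | ⟨x, xs⟩ <;> rfl

/-- Removal of a least stored set, if there are more than `K`. -/
def trimVal (l : List Entry) (K : ℕ) : List Entry := if K < l.length then evictVal l else l

theorem foldl_length {α : Type} (l : List α) (a : ℕ) :
    l.foldl (fun b _ => b + 1) a = a + l.length := by
  rw [foldl_add (fun _ => 1)]
  simp

theorem trimVal_eq (L : List Entry) (K : ℕ) :
    (if (if K < L.foldl (fun a _ => a + 1) 0 then 1 else 0) ≠ 0 then evictVal L else L) =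
      trimVal L K := by
  rw [foldl_length, zero_add, trimVal]
  by_cases h : K < L.length <;> simp [h]

theorem trim_eval (inp : ℕ → ℕ) (l : Var Γ (.list EntryTy)) (K : Var Γ .nat) (e : Env Γ) :
    (trim l K).eval inp e = trimVal (l.get e) (K.get e) := by
  simp only [trim, Tm.eval, evict_eval, Op.eval, Var.get]
  exact trimVal_eq (l.get e) (K.get e)

/-- How many sets are stored. -/
def capacityVal (k r f d : ℕ) : ℕ := 2 * (k * r * ((f + 1) * d))

theorem capacity_eval (inp : ℕ → ℕ) (k r f d : Var Γ .nat) (e : Env Γ) :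
    (capacity k r f d).eval inp e = capacityVal (k.get e) (r.get e) (f.get e) (d.get e) := by
  simp only [capacity, Tm.eval, Op.eval, capacityVal]

/-- The memory after the arrival of the set with ID `j` and indicator function `inp`. -/
def stepVal (inp : ℕ → ℕ) (j : ℕ) (s : List ℕ) (q T M : ℕ) (E : List Entry) (n K : ℕ) :
    MemTy.Val :=
  let z := ∑ x ∈ range n, inp x
  (s, q, T, max M z, trimVal ((j, z, (collectVal inp s q T (max M z) n).2) :: E) K)

theorem streamStep_eval (inp : ℕ → ℕ) (j : ℕ) (s : List ℕ) (q T M : ℕ) (E : List Entry)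
    (n m k r f d : ℕ) : streamStep.eval inp (j, (s, q, T, M, E), n, m, k, r, f, d, ()) =
      stepVal inp j s q T M E n (capacityVal k r f d) := by
  have hmax : ∀ z : ℕ, (if (if M < z then 1 else 0) ≠ 0 then z else M) = max M z := fun z => by
    split_ifs <;> omega
  simp only [stepVal]
  rw [← hmax]
  simp only [streamStep, store, Tm.eval, arrivingSize_eval, collect_eval, trim_eval, capacity_eval,
    Op.eval, Var.get]

theorem foldl_mem (l : List ℕ) (x : ℕ) :
    l.foldl (fun a y => if (if y = x then 1 else 0) ≠ 0 then 1 else a) 0 =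
      if x ∈ l then 1 else 0 := by
  induction l using List.reverseRecOn with
  | nil => rfl
  | append_singleton l y ih =>
    rw [List.foldl_append, ih]
    by_cases h1 : y = x
    · simp [h1]
    · by_cases h2 : x ∈ l <;> simp [h1, h2, Ne.symm h1]

theorem member_eval (inp : ℕ → ℕ) (x : Var Γ .nat) (l : Var Γ (.list .nat)) (e : Env Γ) :
    (member x l).eval inp e = if x.get e ∈ l.get e then 1 else 0 := by
  exact foldl_mem (l.get e) (x.get e)

/-- The number of sets in `l` that contain `x`, according to their lists of elements. -/
def occurrences (l : List Entry) (x : ℕ) : ℕ := (l.map fun y => if x ∈ y.2.2 then 1 else 0).sum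

/-- The estimate of the unique coverage of `l`. -/
def estimateVal (l : List Entry) (s : List ℕ) (q T M : ℕ) (j : ℕ) : ℕ :=
  ∑ x ∈ range j, if IsSampled s q T M x ∧ 1 = occurrences l x then 1 else 0

theorem estimate_fold (inp : ℕ → ℕ) (l : List Entry) (e : Env Γ) (x c : ℕ) (p : ℕ × ℕ) :
    l.foldl (fun a y => (Tm.bind (.snd (.snd v0)) (.op .add v2 (member x3 x0)) :
      Tm (EntryTy :: .nat :: .nat :: .nat :: .prod .nat .nat :: Γ) .nat).eval inp
        (y, a, x, c, p, e)) 0 = occurrences l x := by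
  simp only [Tm.eval, member_eval, Op.eval, Var.get]
  exact (foldl_add (fun y : Entry => if x ∈ y.2.2 then 1 else 0) l 0).trans (zero_add _)

theorem estimate_forAcc (inp : ℕ → ℕ) (l : Var Γ (.list EntryTy)) (s : Var Γ (.list .nat))
    (q T M : Var Γ .nat) (e : Env Γ) (j : ℕ) : forAcc inp (.lit 0)
    (.ite (sampled x0 s.up3 q.up3 T.up3 M.up3)
      (.op .add v1 (.op .eq (.lit 1) (.fold (.var l.up3) (.lit 0)
        (.bind (.snd (.snd v0)) (.op .add v2 (member x3 x0)))))) v1) e j =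
    estimateVal (l.get e) (s.get e) (q.get e) (T.get e) (M.get e) j := by
  rw [estimateVal, ← iter_add]
  unfold forAcc
  congr 1
  funext x a
  have h0 := estimate_fold inp (l.get e) e x a (x, a)
  simp only [Tm.eval, sampled_eval, member_eval, Op.eval, Var.get] at h0 ⊢
  rw [h0]
  by_cases h1 : IsSampled (s.get e) (q.get e) (T.get e) (M.get e) x <;>
    by_cases h2 : 1 = occurrences (l.get e) x <;> simp [h1, h2]

theorem estimate_eval (inp : ℕ → ℕ) (l : Var Γ (.list EntryTy)) (n : Var Γ .nat)
    (s : Var Γ (.list .nat)) (q T M : Var Γ .nat) (e : Env Γ) :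
    (estimate l n s q T M).eval inp e =
      estimateVal (l.get e) (s.get e) (q.get e) (T.get e) (M.get e) (n.get e) := by
  rw [estimate, forN_eval, estimate_forAcc]
  rfl

/-- The entries of `l` selected by the binary digits of `c`. -/
def picked {α : Type} : List α → ℕ → List α
  | [], _ => []
  | y :: l, c => if c % 2 = 0 then picked l (c / 2) else y :: picked l (c / 2)

theorem select_eval (inp : ℕ → ℕ) (l : Var Γ (.list EntryTy)) (c : Var Γ .nat) (e : Env Γ) :
    (select l c).eval inp e = (c.get e / 2 ^ (l.get e).length,
      (picked (l.get e) (c.get e)).length, (picked (l.get e) (c.get e)).reverse) := by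
  have key : ∀ (l : List Entry) (c b : ℕ) (L : List Entry),
      l.foldl (fun a y => (Tm.pair (.op .div (.fst v1) (.lit 2)) (.ite (.op .mod (.fst v1) (.lit 2))
      (.pair (.op .add (.fst (.snd v1)) (.lit 1)) (.cons v0 (.snd (.snd v1)))) (.snd v1)) :
      Tm (EntryTy :: .prod .nat (.prod .nat (.list EntryTy)) :: Γ) _).eval inp (y, a, e))
        (c, b, L) =
      (c / 2 ^ l.length, b + (picked l c).length, (picked l c).reverse ++ L) := by
    intro l
    induction l with
    | nil => intro c b L; simp [picked]
    | cons y l ih =>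
      intro c b L
      rw [List.foldl_cons]
      have hstep : (Tm.pair (.op .div (.fst v1) (.lit 2)) (.ite (.op .mod (.fst v1) (.lit 2))
          (.pair (.op .add (.fst (.snd v1)) (.lit 1)) (.cons v0 (.snd (.snd v1)))) (.snd v1)) :
          Tm (EntryTy :: .prod .nat (.prod .nat (.list EntryTy)) :: Γ) _).eval inp
            (y, (c, b, L), e) = if c % 2 = 0 then (c / 2, b, L) else (c / 2, b + 1, y :: L) := by
        by_cases h : c % 2 = 0 <;> simp [Tm.eval, Op.eval, Var.get, h]
      rw [hstep]
      by_cases h : c % 2 = 0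
      · rw [if_pos h, ih]
        simp [picked, h, pow_succ', Nat.div_div_eq_div_mul]
      · rw [if_neg h, ih]
        simp [picked, h, pow_succ', Nat.div_div_eq_div_mul, add_assoc, add_comm]
  have := key (l.get e) (c.get e) 0 []
  rw [zero_add, List.append_nil] at this
  rw [← this]
  rfl

theorem idList_eval (inp : ℕ → ℕ) (l : Var Γ (.list EntryTy)) (e : Env Γ) :
    (idList l).eval inp e = ((l.get e).map Prod.fst).reverse := by
  simp only [idList, Tm.eval, Var.get]
  generalize l.get e = l
  induction l using List.reverseRecOn with
  | nil => rfl
  | append_singleton l y ih =>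
    rw [List.foldl_append, ih]
    simp

theorem double_iterate (inp : ℕ → ℕ) (e : Env Γ) (j : ℕ) :
    (fun a : ℕ => (Tm.op .add v0 v0 : Tm (.nat :: Γ) .nat).eval inp (a, e))^[j] 1 = 2 ^ j := by
  induction j with
  | zero => rfl
  | succ j ih =>
    rw [Function.iterate_succ_apply', ih]
    simp only [Tm.eval, Var.get, Op.eval]
    ring

theorem twoPowLength_eval (inp : ℕ → ℕ) (l : Var Γ (.list EntryTy)) (e : Env Γ) :
    (twoPowLength l).eval inp e = 2 ^ (l.get e).length := by
  have h0 := foldl_length (l.get e) 0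
  rw [zero_add] at h0
  have := double_iterate inp e (l.get e).length
  simp only [twoPowLength, Tm.eval, Op.eval, Var.get] at this ⊢
  rw [h0, this]

/-- The search for the best subcollection. -/
def searchVal (l : List Entry) (n k : ℕ) (s : List ℕ) (q T M : ℕ) (j : ℕ) : ℕ × List ℕ :=
  iter (fun c b => if k < (picked l c).length then b
    else if b.1 < estimateVal (picked l c).reverse s q T M n then
      (estimateVal (picked l c).reverse s q T M n, (picked l c).map Prod.fst) else b) (0, []) j

theorem search_forAcc (inp : ℕ → ℕ) (l : Var Γ (.list EntryTy)) (n k : Var Γ .nat)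
    (s : Var Γ (.list .nat)) (q T M : Var Γ .nat) (e : Env Γ) (j : ℕ) :
    forAcc inp (.pair (.lit 0) .nil)
    (.bind (select l.up3 x0) (.bind (.snd (.snd v0))
      (.ite (.op .lt (.var k.up5) (.fst (.snd (.var x1)))) (.var x3)
        (.bind (estimate x0 n.up5 s.up5 q.up5 T.up5 M.up5)
          (.ite (.op .lt (.fst (.var x4)) v0) (.pair v0 (idList x1)) (.var x4)))))) e j =
    searchVal (l.get e) (n.get e) (k.get e) (s.get e) (q.get e) (T.get e) (M.get e) j := by
  unfold forAcc searchVal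
  simp only [Tm.eval, select_eval, estimate_eval, idList_eval, Op.eval, Var.get]
  congr 1
  funext c b
  by_cases h1 : k.get e < (picked (l.get e) c).length
  · simp [h1]
  · by_cases h2 : b.1 < estimateVal (picked (l.get e) c).reverse (s.get e) (q.get e) (T.get e)
      (M.get e) (n.get e) <;> simp [h1, h2]

theorem search_eval (inp : ℕ → ℕ) (l : Var Γ (.list EntryTy)) (n k : Var Γ .nat)
    (s : Var Γ (.list .nat)) (q T M : Var Γ .nat) (e : Env Γ) :
    (search l n k s q T M).eval inp e = searchVal (l.get e) (n.get e) (k.get e) (s.get e)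
      (q.get e) (T.get e) (M.get e) (2 ^ (l.get e).length) := by
  rw [search, forN_eval, search_forAcc, twoPowLength_eval]

theorem streamOutput_eval (inp : ℕ → ℕ) (s : List ℕ) (q T M : ℕ) (E : List Entry)
    (n m k r f d : ℕ) : streamOutput.eval inp ((s, q, T, M, E), n, m, k, r, f, d, ()) =
      (searchVal E n k s q T M (2 ^ E.length)).2 := by
  simp only [streamOutput, Tm.eval, search_eval, Var.get]

end Machine

namespace Machine

open Finset Hashing

/-! ### Correctness of the streaming algorithm, given the random numbers -/

/-- The sampling rate only decreases during the stream, so an element that is sampled in the end was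
sampled on every arrival of a set that contains it. -/
theorem IsSampled.mono {s : List ℕ} {q T M M' x : ℕ} (h : IsSampled s q T M x) (hM : M' ≤ M) :
    IsSampled s q T M' x :=
  (Nat.mul_le_mul_left _ hM).trans_lt h

/-- The list of sampled elements has at most `4 T` entries, and it is complete if there are no more
sampled elements than that. -/
theorem collectVal_spec (inp : ℕ → ℕ) (s : List ℕ) (q T M j : ℕ) :
    (collectVal inp s q T M j).1 = (collectVal inp s q T M j).2.length ∧
    (collectVal inp s q T M j).1 ≤ 4 * T ∧
    (collectVal inp s q T M j).1 ≤
      ((range j).filter fun x => inp x ≠ 0 ∧ IsSampled s q T M x).card ∧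
    (∀ x ∈ (collectVal inp s q T M j).2, x < j ∧ inp x ≠ 0) ∧
    (((range j).filter fun x => inp x ≠ 0 ∧ IsSampled s q T M x).card ≤ 4 * T →
      ∀ x < j, inp x ≠ 0 → IsSampled s q T M x → x ∈ (collectVal inp s q T M j).2) := by
  induction j with
  | zero => simp [collectVal]
  | succ j ih =>
    have hs : collectVal inp s q T M (j + 1) =
      if inp j ≠ 0 ∧ IsSampled s q T M j ∧ (collectVal inp s q T M j).1 < 4 * T then
        ((collectVal inp s q T M j).1 + 1, j :: (collectVal inp s q T M j).2)
      else collectVal inp s q T M j := rfl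
    rw [hs]
    obtain ⟨h1, h2, h3, h4, h5⟩ := ih
    generalize collectVal inp s q T M j = a at *
    have hcard : ((range (j + 1)).filter fun x => inp x ≠ 0 ∧ IsSampled s q T M x).card =
        ((range j).filter fun x => inp x ≠ 0 ∧ IsSampled s q T M x).card +
          if inp j ≠ 0 ∧ IsSampled s q T M j then 1 else 0 := by
      rw [range_add_one, filter_insert]
      split_ifs
      · rw [card_insert_of_notMem (by simp)]
      · rfl
    rw [hcard]
    by_cases hc : inp j ≠ 0 ∧ IsSampled s q T M j
    · rw [if_pos hc]
      by_cases ht : a.1 < 4 * T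
      · rw [if_pos ⟨hc.1, hc.2, ht⟩]
        refine ⟨by simp [h1], ht, by omega, fun x hx => ?_, fun hle x hx hx1 hx2 => ?_⟩
        · rcases List.mem_cons.1 hx with rfl | hx
          · exact ⟨Nat.lt_succ_self _, hc.1⟩
          · exact ⟨(h4 x hx).1.trans (Nat.lt_succ_self j), (h4 x hx).2⟩
        · rcases Nat.lt_succ_iff_lt_or_eq.1 hx with hx | rfl
          · exact List.mem_cons_of_mem _ (h5 (by omega) x hx hx1 hx2)
          · exact List.mem_cons_self
      · rw [if_neg fun h => ht h.2.2]
        exact ⟨h1, h2, by omega, fun x hx => ⟨(h4 x hx).1.trans (Nat.lt_succ_self j), (h4 x hx).2⟩,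
          fun hle => by omega⟩
    · rw [if_neg hc, if_neg fun h => hc ⟨h.1, h.2.1⟩]
      refine ⟨h1, h2, h3, fun x hx => ⟨(h4 x hx).1.trans (Nat.lt_succ_self j), (h4 x hx).2⟩,
          fun hle x hx hx1 hx2 => ?_⟩
      rcases Nat.lt_succ_iff_lt_or_eq.1 hx with hx | rfl
      · exact h5 hle x hx hx1 hx2
      · exact absurd ⟨hx1, hx2⟩ hc

theorem leastVal_spec (x : Entry) (l : List Entry) :
    leastVal x l ∈ x :: l ∧ ∀ y ∈ x :: l, (leastVal x l).2.1 ≤ y.2.1 := by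
  unfold leastVal
  induction l using List.reverseRecOn with
  | nil => simp
  | append_singleton l y ih =>
    rw [List.foldl_append, List.foldl_cons, List.foldl_nil]
    obtain ⟨h1, h2⟩ := ih
    split_ifs with h
    · refine ⟨by simp, fun z hz => ?_⟩
      rw [← List.cons_append, List.mem_append, List.mem_singleton] at hz
      rcases hz with hz | rfl
      · exact h.le.trans (h2 z hz)
      · exact le_rfl
    · rw [← List.cons_append]
      refine ⟨List.mem_append_left _ h1, fun z hz => ?_⟩
      rw [List.mem_append, List.mem_singleton] at hz
      rcases hz with hz | rfl
      · exact h2 z hz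
      · exact not_lt.1 h

theorem removeVal_eq (i : ℕ) (l : List Entry) :
    removeVal i l = (l.filter fun y => y.1 ≠ i).reverse := by
  unfold removeVal
  induction l using List.reverseRecOn with
  | nil => rfl
  | append_singleton l y ih =>
    rw [List.foldl_append, ih]
    by_cases h : y.1 = i <;> simp [h]

section Stream

variable {m n : ℕ} (V : Fin m → Finset (Fin n)) (s : List ℕ) (q T K : ℕ)

/-- The size of the set with ID `i`. -/
def sizeOfId (i : ℕ) : ℕ := ∑ x ∈ range n, MUC.incidence V i x

/-- The largest size among the first `j` sets. -/
def maxSize (j : ℕ) : ℕ := iter (fun i M => max M (sizeOfId V i)) 0 j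

/-- The list of elements that is stored on the arrival of the set with ID `i`. -/
def storedElements (i : ℕ) : List ℕ :=
  (collectVal (MUC.incidence V i) s q T (maxSize V (i + 1)) n).2

/-- What is stored on the arrival of the set with ID `i`. -/
def entryOfId (i : ℕ) : Entry := (i, sizeOfId V i, storedElements V s q T i)

/-- The stored sets after `j` arrivals. -/
def storedAfter (j : ℕ) : List Entry :=
  iter (fun i E => trimVal (entryOfId V s q T i :: E) K) [] j

theorem sizeOfId_val (i : Fin m) : sizeOfId V i = (V i).card := sum_incidence V i

theorem maxSize_mono {i j : ℕ} (h : i ≤ j) : maxSize V i ≤ maxSize V j := by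
  induction j, h using Nat.le_induction with
  | base => exact le_rfl
  | succ j _ ih => exact ih.trans (le_max_left _ _)

theorem sizeOfId_le_maxSize {i j : ℕ} (h : i < j) : sizeOfId V i ≤ maxSize V j :=
  (le_max_right (maxSize V i) _).trans (maxSize_mono V h)

theorem maxSize_le {j b : ℕ} (h : ∀ i < j, sizeOfId V i ≤ b) : maxSize V j ≤ b := by
  induction j with
  | zero => exact Nat.zero_le b
  | succ j ih => exact max_le (ih fun i hi => h i (by omega)) (h j (by omega))

theorem sizeOfId_le (i : ℕ) : sizeOfId V i ≤ n :=
  sum_range_le_of_le_one (incidence_le_one V i) n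

/-- `I` lists the IDs of the stored sets after `j` arrivals. -/
structure IsStored (j : ℕ) (I : List ℕ) : Prop where
  eq : storedAfter V s q T K j = I.map (entryOfId V s q T)
  nodup : I.Nodup
  lt : ∀ i ∈ I, i < j
  length : I.length = min K j
  top : ∀ i ∈ I, ∀ i' < j, i' ∉ I → sizeOfId V i' ≤ sizeOfId V i

theorem exists_isStored (j : ℕ) : ∃ I, IsStored V s q T K j I := by
  induction j with
  | zero => exact ⟨[], rfl, List.nodup_nil, by simp, by simp, by simp⟩
  | succ j ih =>
    obtain ⟨I, h1, h2, h3, h4, h5⟩ := ih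
    have hj : j ∉ I := fun h => (h3 j h).false
    have hstep : storedAfter V s q T K (j + 1) =
        trimVal ((j :: I).map (entryOfId V s q T)) K := by
      rw [List.map_cons, ← h1]
      rfl
    rw [trimVal, List.length_map, List.length_cons, h4] at hstep
    split_ifs at hstep with hK
    · obtain ⟨hm, hmin⟩ := leastVal_spec (entryOfId V s q T j) (I.map (entryOfId V s q T))
      rw [← List.map_cons] at hm hmin
      have hev : evictVal ((j :: I).map (entryOfId V s q T)) = removeVal
          (leastVal (entryOfId V s q T j) (I.map (entryOfId V s q T))).1
          ((j :: I).map (entryOfId V s q T)) := rfl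
      obtain ⟨i₀, hi₀, he⟩ := List.mem_map.1 hm
      rw [hev, ← he, removeVal_eq, List.filter_map, ← List.map_reverse] at hstep
      rw [← he] at hmin
      have hmin' : ∀ i ∈ j :: I, sizeOfId V i₀ ≤ sizeOfId V i := fun i hi =>
        hmin _ (List.mem_map_of_mem hi)
      set I' := ((j :: I).filter ((fun y : Entry => decide (y.1 ≠ (entryOfId V s q T i₀).1)) ∘
        entryOfId V s q T)).reverse with hI'
      have hmem : ∀ i, i ∈ I' ↔ i ∈ j :: I ∧ i ≠ i₀ := fun i => by
        rw [hI', List.mem_reverse, List.mem_filter]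
        exact and_congr_right fun _ => decide_eq_true_iff
      have hnd : (j :: I).Nodup := List.nodup_cons.2 ⟨hj, h2⟩
      have hnd' : I'.Nodup := List.nodup_reverse.2 (hnd.filter _)
      refine ⟨I', hstep, hnd', fun i hi => ?_, ?_, fun i hi i' hi' hni' => ?_⟩
      · rcases List.mem_cons.1 ((hmem i).1 hi).1 with rfl | h
        · omega
        · have := h3 i h
          omega
      · have : I'.toFinset = (j :: I).toFinset.erase i₀ := by
          ext i
          rw [List.mem_toFinset, hmem, mem_erase, List.mem_toFinset, and_comm]
        rw [← List.toFinset_card_of_nodup hnd', this, card_erase_of_mem (List.mem_toFinset.2 hi₀),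
          List.toFinset_card_of_nodup hnd, List.length_cons]
        omega
      · obtain ⟨hi, hne⟩ := (hmem i).1 hi
        by_cases h0 : i' = i₀
        · rw [h0]
          exact hmin' i hi
        · have hni : i' ∉ j :: I := fun h => hni' ((hmem i').2 ⟨h, h0⟩)
          rw [List.mem_cons, not_or] at hni
          rcases List.mem_cons.1 hi with rfl | hi
          · rcases List.mem_cons.1 hi₀ with rfl | hi₀
            · exact absurd rfl hne
            · exact (h5 i₀ hi₀ i' (by omega) hni.2).trans (hmin' _ List.mem_cons_self)
          · exact h5 i hi i' (by omega) hni.2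
    · refine ⟨j :: I, hstep, List.nodup_cons.2 ⟨hj, h2⟩, fun i hi => ?_, ?_, ?_⟩
      · rcases List.mem_cons.1 hi with rfl | h
        · omega
        · have := h3 i h
          omega
      · rw [List.length_cons]
        omega
      · intro i _ i' hi' hni'
        rw [List.mem_cons, not_or] at hni'
        have hsub : I.toFinset ⊆ range j := fun a ha => mem_range.2 (h3 a (List.mem_toFinset.1 ha))
        have heq := eq_of_subset_of_card_le hsub (by
          rw [List.toFinset_card_of_nodup h2, card_range]
          omega)
        have : i' ∈ I.toFinset := heq ▸ mem_range.2 (by omega)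
        exact absurd (List.mem_toFinset.1 this) hni'.2

/-- The stored sets form a kernel of `K` largest sets. -/
theorem IsStored.isTopSets {I : List ℕ} (h : IsStored V s q T K m I) :
    MUC.IsTopSets V K (univ.filter fun i : Fin m => (i : ℕ) ∈ I) := by
  refine ⟨?_, fun i hi j hj => ?_⟩
  · rw [card_eq_length_of_lists (lists_of_nodup h.nodup h.lt), h.length]
  · rw [← sizeOfId_val, ← sizeOfId_val]
    exact h.top i (mem_filter.1 hi).2 j j.2 fun hj' => hj (mem_filter.2 ⟨mem_univ j, hj'⟩)

/-- No list of stored elements had to be cut off. -/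
def NoOverflow : Prop := ∀ i : Fin m,
  ((V i).filter fun x : Fin n => IsSampled s q T (maxSize V (i + 1)) x).card ≤ 4 * T

/-- The number of sampled elements in the unique cover. -/
def sampledCoverage (B : Finset (Fin m)) : ℕ :=
  ((MUC.uniqueCover V B).filter fun x : Fin n => IsSampled s q T (maxSize V m) x).card

variable {V s q T}

/-- Without overflow, the stored lists are correct on the elements that are sampled at the final
rate. They may contain further elements, sampled at an earlier rate. -/
theorem mem_storedElements_iff (h : NoOverflow V s q T) (i : Fin m) (x : Fin n)
    (hx : IsSampled s q T (maxSize V m) x) : (x : ℕ) ∈ storedElements V s q T i ↔ x ∈ V i := by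
  obtain ⟨-, -, -, h4, h5⟩ := collectVal_spec (MUC.incidence V i) s q T (maxSize V (i + 1)) n
  have hinc : MUC.incidence V i x ≠ 0 ↔ x ∈ V i := by
    rw [incidence_val]
    split_ifs with h <;> simp [h]
  refine ⟨fun hm => hinc.1 (h4 x hm).2, fun hm => h5 ?_ x x.2 (hinc.2 hm)
    (hx.mono (maxSize_mono V i.2))⟩
  refine le_trans (le_of_eq ?_) (h i)
  rw [← card_map Fin.valEmbedding]
  congr 1
  ext a
  simp only [mem_filter, mem_range, mem_map, Fin.valEmbedding_apply]
  constructor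
  · rintro ⟨ha, h1, h2⟩
    have h1' : (⟨a, ha⟩ : Fin n) ∈ V i := by
      rw [show a = ((⟨a, ha⟩ : Fin n) : ℕ) from rfl, incidence_val] at h1
      by_contra hcon
      rw [if_neg hcon] at h1
      exact h1 rfl
    exact ⟨⟨a, ha⟩, ⟨h1', h2⟩, rfl⟩
  · rintro ⟨b, ⟨h1, h2⟩, rfl⟩
    refine ⟨b.2, ?_, h2⟩
    rw [incidence_val, if_pos h1]
    exact one_ne_zero

theorem estimateVal_eq (h : NoOverflow V s q T) {L : List ℕ} {B : Finset (Fin m)}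
    (hL : MUC.Lists L B) :
    estimateVal (L.map (entryOfId V s q T)).reverse s q T (maxSize V m) n =
      sampledCoverage V s q T B := by
  rw [estimateVal, sum_range, sampledCoverage, ← card_filter]
  congr 1
  ext x
  rw [mem_filter, mem_filter, and_iff_right (mem_univ x), and_comm]
  refine and_congr_left fun hx => ?_
  have hocc : occurrences (L.map (entryOfId V s q T)).reverse x =
      (L.map fun i => MUC.incidence V i x).sum := by
    rw [occurrences, ← List.map_reverse, List.map_map, List.map_reverse, List.sum_reverse]
    congr 1
    refine List.map_congr_left fun i hi => ?_
    obtain ⟨i, -, rfl⟩ := (hL.2 i).1 hi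
    rw [incidence_val]
    exact if_congr (mem_storedElements_iff h i x hx) rfl rfl
  rw [hocc, sum_list_incidence V hL, MUC.mem_uniqueCover_iff_card, eq_comm]

theorem picked_map {α β : Type} (f : α → β) (l : List α) (c : ℕ) :
    picked (l.map f) c = (picked l c).map f := by
  induction l generalizing c with
  | nil => rfl
  | cons x l ih =>
    rw [List.map_cons, picked, picked]
    split_ifs <;> simp [ih]

theorem picked_sublist {α : Type} (l : List α) (c : ℕ) : (picked l c).Sublist l := by
  induction l generalizing c with
  | nil => exact List.Sublist.refl _
  | cons x l ih =>
    rw [picked]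
    split_ifs
    · exact (ih _).cons x
    · exact (ih _).cons_cons x

/-- The binary digits of the numbers less than `2 ^ l.length` select all sublists of `l`. -/
theorem exists_picked_eq_filter {α : Type} (l : List α) (p : α → Bool) :
    ∃ c < 2 ^ l.length, picked l c = l.filter p := by
  induction l with
  | nil => exact ⟨0, by simp, rfl⟩
  | cons x l ih =>
    obtain ⟨c, hc, h⟩ := ih
    by_cases hx : p x
    · refine ⟨2 * c + 1, by rw [List.length_cons, pow_succ]; omega, ?_⟩
      rw [picked, if_neg (by omega), show (2 * c + 1) / 2 = c by omega, h,
        List.filter_cons_of_pos hx]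
    · refine ⟨2 * c, by rw [List.length_cons, pow_succ]; omega, ?_⟩
      rw [picked, if_pos (by omega), show 2 * c / 2 = c by omega, h, List.filter_cons_of_neg hx]

theorem searchVal_spec (l : List Entry) (n k : ℕ) (s : List ℕ) (q T M j : ℕ) :
    (searchVal l n k s q T M j = (0, []) ∨ ∃ c, (picked l c).length ≤ k ∧
      searchVal l n k s q T M j =
        (estimateVal (picked l c).reverse s q T M n, (picked l c).map Prod.fst)) ∧
    ∀ c < j, (picked l c).length ≤ k →
      estimateVal (picked l c).reverse s q T M n ≤ (searchVal l n k s q T M j).1 := by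
  induction j with
  | zero => exact ⟨Or.inl rfl, by simp⟩
  | succ j ih =>
    have hs : searchVal l n k s q T M (j + 1) = if k < (picked l j).length then
        searchVal l n k s q T M j
      else if (searchVal l n k s q T M j).1 < estimateVal (picked l j).reverse s q T M n then
        (estimateVal (picked l j).reverse s q T M n, (picked l j).map Prod.fst)
      else searchVal l n k s q T M j := rfl
    rw [hs]
    obtain ⟨h1, h2⟩ := ih
    split_ifs with hk hlt
    · refine ⟨h1, fun c hc hck => ?_⟩
      rcases Nat.lt_succ_iff_lt_or_eq.1 hc with hc | rfl
      · exact h2 c hc hck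
      · omega
    · refine ⟨Or.inr ⟨j, not_lt.1 hk, rfl⟩, fun c hc hck => ?_⟩
      rcases Nat.lt_succ_iff_lt_or_eq.1 hc with hc | rfl
      · exact (h2 c hc hck).trans hlt.le
      · exact le_rfl
    · refine ⟨h1, fun c hc hck => ?_⟩
      rcases Nat.lt_succ_iff_lt_or_eq.1 hc with hc | rfl
      · exact h2 c hc hck
      · exact not_lt.1 hlt

/-- Without overflow, the output is a subcollection of the kernel with the largest number of
sampled elements in its unique cover. -/
theorem exists_lists_search (h : NoOverflow V s q T) (k : ℕ) :
    ∃ A B : Finset (Fin m), MUC.IsTopSets V K A ∧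
      MUC.Lists (searchVal (storedAfter V s q T K m) n k s q T (maxSize V m)
        (2 ^ (storedAfter V s q T K m).length)).2 B ∧ B.card ≤ k ∧
      ∀ Q ⊆ A, Q.card ≤ k → sampledCoverage V s q T Q ≤ sampledCoverage V s q T B := by
  obtain ⟨I, hI⟩ := exists_isStored V s q T K m
  have hlists : ∀ c, MUC.Lists (picked I c) (univ.filter fun i : Fin m => (i : ℕ) ∈ picked I c) :=
    fun c => lists_of_nodup (hI.nodup.sublist (picked_sublist I c))
      fun a ha => hI.lt a ((picked_sublist I c).subset ha)
  set E := storedAfter V s q T K m with hE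
  have hEI : E = I.map (entryOfId V s q T) := hI.eq
  clear_value E
  obtain ⟨h1, h2⟩ := searchVal_spec E n k s q T (maxSize V m) (2 ^ E.length)
  have hest : ∀ c (B : Finset (Fin m)), MUC.Lists (picked I c) B →
      estimateVal (picked E c).reverse s q T (maxSize V m) n = sampledCoverage V s q T B := by
    intro c B hB
    rw [hEI, picked_map]
    exact estimateVal_eq h hB
  have hlen : ∀ c, (picked E c).length = (picked I c).length := fun c => by
    rw [hEI, picked_map, List.length_map]
  have hmax : ∀ Q ⊆ univ.filter (fun i : Fin m => (i : ℕ) ∈ I), Q.card ≤ k →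
      sampledCoverage V s q T Q ≤ (searchVal E n k s q T (maxSize V m) (2 ^ E.length)).1 := by
    intro Q hQ hQk
    obtain ⟨c, hc, hp⟩ := exists_picked_eq_filter I
      (fun a => decide (a ∈ Q.map Fin.valEmbedding))
    have hQl : MUC.Lists (picked I c) Q := by
      refine ⟨(hlists c).1, fun a => ?_⟩
      rw [hp, List.mem_filter]
      simp only [decide_eq_true_eq, mem_map, Fin.valEmbedding_apply]
      refine ⟨fun ha => ha.2, fun ha => ⟨?_, ha⟩⟩
      obtain ⟨i, hi, rfl⟩ := ha
      exact (mem_filter.1 (hQ hi)).2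
    rw [← hest c Q hQl]
    refine h2 c ?_ ?_
    · rw [hEI, List.length_map]
      exact hc
    · rw [hlen, ← card_eq_length_of_lists hQl]
      exact hQk
  rcases h1 with h1 | ⟨c, hck, h1⟩
  · refine ⟨_, ∅, hI.isTopSets, ?_, by simp, fun Q hQ hQk => ?_⟩
    · rw [h1]
      exact ⟨List.nodup_nil, by simp⟩
    · refine (hmax Q hQ hQk).trans ?_
      rw [h1]
      exact Nat.zero_le _
  · refine ⟨_, univ.filter fun i : Fin m => (i : ℕ) ∈ picked I c, hI.isTopSets, ?_, ?_,
      fun Q hQ hQk => ?_⟩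
    · rw [h1, hEI, picked_map, List.map_map]
      have : (Prod.fst ∘ entryOfId V s q T) = id := rfl
      rw [this, List.map_id]
      exact hlists c
    · rw [card_eq_length_of_lists (hlists c), ← hlen]
      exact hck
    · refine (hmax Q hQ hQk).trans (le_of_eq ?_)
      rw [h1]
      exact hest c _ (hlists c)

variable (V)

/-- The memory of the streaming algorithm. -/
theorem streamAlg_memory (a k r f d : ℕ) (hn : n ≠ 0)
    (σ : (streamAlg a).Seed (n, m, k, r, f, d, ())) (j : ℕ) :
    (streamAlg a).memory (n, m, k, r, f, d, ()) V σ j =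
      ((streamAlg a).seedList (n, m, k, r, f, d, ()) σ, primeAbove n, thresholdVal a m k d,
        maxSize V j, storedAfter V ((streamAlg a).seedList (n, m, k, r, f, d, ()) σ)
          (primeAbove n) (thresholdVal a m k d) (capacityVal k r f d) j) := by
  induction j with
  | zero =>
    have h1 := nextPrime_eval blank (x1 : Var (.list .nat :: Params) .nat)
      ((streamAlg a).seedList (n, m, k, r, f, d, ()) σ, n, m, k, r, f, d, ()) hn
    have h2 := threshold_eval blank a (x2 : Var (.list .nat :: Params) .nat) x3 x1.up5
      ((streamAlg a).seedList (n, m, k, r, f, d, ()) σ, n, m, k, r, f, d, ())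
    exact congrArg₂
      (fun y z => ((streamAlg a).seedList (n, m, k, r, f, d, ()) σ, y, z, 0, [])) h1 h2
  | succ j ih =>
    rw [StreamAlg.memory, ih]
    exact streamStep_eval _ _ _ _ _ _ _ _ _ _ _ _ _

/-- The output of the streaming algorithm. -/
theorem streamAlg_result (a k r f d : ℕ) (hn : n ≠ 0)
    (σ : (streamAlg a).Seed (n, m, k, r, f, d, ())) :
    (streamAlg a).result (n, m, k, r, f, d, ()) V σ =
      (searchVal (storedAfter V ((streamAlg a).seedList (n, m, k, r, f, d, ()) σ)
          (primeAbove n) (thresholdVal a m k d) (capacityVal k r f d) m) n k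
        ((streamAlg a).seedList (n, m, k, r, f, d, ()) σ) (primeAbove n) (thresholdVal a m k d)
        (maxSize V m) (2 ^ (storedAfter V ((streamAlg a).seedList (n, m, k, r, f, d, ()) σ)
          (primeAbove n) (thresholdVal a m k d) (capacityVal k r f d) m).length)).2 := by
  rw [StreamAlg.result, streamAlg_memory V a k r f d hn]
  exact streamOutput_eval _ _ _ _ _ _ _ _ _ _ _ _

end Stream

end Machine

/-! ### The sampling rate -/

namespace Hashing

open Finset

/-- Polynomial hashing modulo a prime `q ≥ n` is `t`-wise independent on `{0, …, n - 1}`. -/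
theorem isWiseUniform_horner {q n t : ℕ} (hq : q.Prime) (hn : n ≤ q) :
    IsWiseUniform t (fun (σ : Fin t → Fin q) (x : Fin n) =>
      (⟨horner q ((List.ofFn σ).map Fin.val) x, horner_lt hq.pos _ _⟩ : Fin q)) := by
  obtain ⟨q, rfl⟩ := Nat.exists_eq_succ_of_ne_zero hq.ne_zero
  have : Fact (q + 1).Prime := ⟨hq⟩
  have hv : Function.Injective fun x : Fin n => ((x : ℕ) : ZMod (q + 1)) := fun x y hxy => by
    have := congrArg ZMod.val hxy
    simp only [ZMod.val_natCast_of_lt (x.2.trans_le hn),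
      ZMod.val_natCast_of_lt (y.2.trans_le hn)] at this
    exact Fin.ext this
  have h := isWiseUniform_poly (t := t) _ hv
  have key : (fun (σ : Fin t → ZMod (q + 1)) (x : Fin n) =>
      ∑ j, σ j * ((x : ℕ) : ZMod (q + 1)) ^ (j.rev : ℕ)) =
      fun (σ : Fin t → Fin (q + 1)) (x : Fin n) =>
      (⟨horner (q + 1) ((List.ofFn σ).map Fin.val) x, horner_lt hq.pos _ _⟩ : Fin (q + 1)) := by
    funext σ x
    rw [← foldl_ofFn_eq_sum]
    have hc := horner_cast (q + 1) ((List.ofFn (n := t) (α := Fin (q + 1)) σ).map Fin.val) x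
    have hmap : ((List.ofFn (n := t) (α := Fin (q + 1)) σ).map Fin.val).map
        (Nat.cast : ℕ → ZMod (q + 1)) = List.ofFn σ := by
      rw [List.map_map]
      refine (List.map_congr_left fun y _ => ?_).trans (List.map_id _)
      exact Fin.cast_val_eq_self y
    rw [hmap] at hc
    refine hc.symm.trans ?_
    exact Fin.cast_val_eq_self (⟨horner (q + 1) _ x, horner_lt hq.pos _ _⟩ : Fin (q + 1))
  rw [key] at h
  exact h

/-- The hash values for which an element is sampled, when `M` is the largest size. -/
def sampledValues (q T M : ℕ) : Finset (Fin q) := univ.filter fun y => (y : ℕ) * M < T * q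

/-- The probability that an element is sampled, when `M` is the largest size. -/
noncomputable def rate (q T M : ℕ) : ℝ := ((sampledValues q T M).card : ℝ) / q

/-- The number of sampled hash values is `T q / M`, rounded up. -/
theorem card_sampledValues {q T M : ℕ} (hM : T < M) :
    T * q ≤ (sampledValues q T M).card * M ∧ (sampledValues q T M).card * M ≤ T * q + M := by
  set c := (T * q + (M - 1)) / M with hc
  have hM0 : 0 < M := by omega
  have hlt : ∀ y : ℕ, y * M < T * q ↔ y < c := fun y => by
    rw [hc, Nat.lt_iff_add_one_le, Nat.lt_iff_add_one_le, Nat.le_div_iff_mul_le hM0, add_mul,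
      one_mul]
    omega
  have hcq : c ≤ q := by
    by_contra hcon
    have h1 := (hlt q).2 (not_le.1 hcon)
    rw [mul_comm] at h1
    exact absurd (Nat.mul_le_mul_right q hM.le) (not_le.2 h1)
  have hcard : (sampledValues q T M).card = c := by
    rw [sampledValues, ← card_map Fin.valEmbedding, ← card_range c]
    congr 1
    ext a
    simp only [mem_map, mem_filter, mem_univ, true_and, Fin.valEmbedding_apply, mem_range, hlt]
    exact ⟨by rintro ⟨y, hy, rfl⟩; exact hy, fun ha => ⟨⟨a, ha.trans_le hcq⟩, ha, rfl⟩⟩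
  rw [hcard]
  have h1 := Nat.div_mul_le_self (T * q + (M - 1)) M
  have h2 := Nat.lt_div_mul_add (a := T * q + (M - 1)) hM0
  rw [← hc] at h1 h2
  omega

theorem le_rate_mul {q T M : ℕ} (hq : 0 < q) (hM : T < M) : (T : ℝ) ≤ rate q T M * M := by
  have h := (card_sampledValues (q := q) hM).1
  rw [rate, div_mul_eq_mul_div, le_div_iff₀ (by positivity)]
  exact_mod_cast h

theorem rate_mul_le {q T M : ℕ} (hq : 0 < q) (hT : 0 < T) (hM : T < M) (hMq : M ≤ q) :
    rate q T M * M ≤ 2 * T := by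
  have h := (card_sampledValues (q := q) hM).2
  have h2 : M ≤ T * q := hMq.trans (Nat.le_mul_of_pos_left q hT)
  rw [rate, div_mul_eq_mul_div, div_le_iff₀ (by positivity)]
  have : (sampledValues q T M).card * M ≤ 2 * T * q := by rw [mul_assoc]; omega
  exact_mod_cast this

theorem rate_nonneg (q T M : ℕ) : 0 ≤ rate q T M := by unfold rate; positivity

end Hashing

namespace Machine

open Finset Hashing

/-! ### The success probability of the streaming algorithm -/

section

variable {m n : ℕ} (V : Fin m → Finset (Fin n))

/-- The tail bound for the number of sampled elements of a fixed set. -/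
theorem card_deviation_le {q t T M : ℕ} (hq : q.Prime) (hn : n ≤ q) (ht : Even t) (ht0 : 0 < t)
    (U : Finset (Fin n)) {μ D : ℝ} (hμ : rate q T M * U.card ≤ μ) (hD : 6 * t ≤ D)
    (hDμ : 36 * t * μ ≤ D ^ 2) :
    ((univ.filter fun σ : Fin t → Fin q => D ≤ |((U.filter fun x : Fin n =>
      IsSampled ((List.ofFn σ).map Fin.val) q T M x).card : ℝ) - rate q T M * U.card|).card : ℝ) ≤
      2 * (1 / 2) ^ t * Fintype.card (Fin t → Fin q) := by
  have h := (isWiseUniform_horner (t := t) hq hn).tail_le ht ht0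
    (by rw [Fintype.card_fin]; exact hq.pos) (sampledValues q T M) U (μ := μ) (D := D)
    (by rw [Fintype.card_fin]; exact hμ) hD hDμ
  refine (Nat.cast_le.2 (card_le_card fun σ hσ => ?_)).trans h
  refine mem_filter.2 ⟨mem_univ σ, (mem_filter.1 hσ).2.trans_eq ?_⟩
  simp only [sampledValues, Fintype.card_fin, rate, IsSampled, mem_filter, mem_univ, true_and]

variable {V}

/-- A single set has its size as unique coverage. -/
theorem maxSize_le_opt {k : ℕ} (hk : 1 ≤ k) (j : ℕ) (hj : j ≤ m) : maxSize V j ≤ MUC.opt V k :=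
  maxSize_le V fun i hi => by
    have := sizeOfId_val V ⟨i, hi.trans_le hj⟩
    rw [show sizeOfId V i = sizeOfId V ((⟨i, hi.trans_le hj⟩ : Fin m) : ℕ) from rfl, this]
    exact MUC.card_le_opt V hk _

theorem card_le_maxSize (i : Fin m) : (V i).card ≤ maxSize V (i + 1) := by
  rw [← sizeOfId_val]
  exact sizeOfId_le_maxSize V (Nat.lt_succ_self _)

/-- As long as the sets have at most `T` elements, everything is sampled. -/
theorem isSampled_of_le {q T M : ℕ} (hq : 0 < q) (hT : 0 < T) (hM : M ≤ T) (s : List ℕ) (x : ℕ) :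
    IsSampled s q T M x := by
  have h1 := horner_lt hq s x
  refine (Nat.mul_le_mul_left _ hM).trans_lt ?_
  rw [mul_comm]
  exact Nat.mul_lt_mul_of_pos_left h1 hT

/-- The sampled coverages deviate little from their means. If no set has more than `T` elements,
everything is sampled and there is nothing to require. -/
def IsAccurate (V : Fin m → Finset (Fin n)) (k d : ℕ) (s : List ℕ) (q T : ℕ) : Prop :=
  T < maxSize V m → ∀ B : Finset (Fin m), B.card ≤ k →
    |(sampledCoverage V s q T B : ℝ) - rate q T (maxSize V m) * (MUC.uniqueCover V B).card| <
      rate q T (maxSize V m) * MUC.opt V k / (4 * d)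

open Classical in
/-- The probability of an overflow: about `T` and at most `2 T` sampled elements are expected in
each set, so that more than `4 T` are a deviation of at least `2 T`. -/
theorem card_overflow_le {q t T d : ℕ} (hq : q.Prime) (hn : n ≤ q) (ht : Even t) (ht0 : 0 < t)
    (hT : T = 576 * (t * (d * d))) (hd : 0 < d) :
    ((univ.filter fun σ : Fin t → Fin q =>
      ¬ NoOverflow V ((List.ofFn σ).map Fin.val) q T).card : ℝ) ≤
      m * (2 * (1 / 2) ^ t * Fintype.card (Fin t → Fin q)) := by
  have hdd : 1 ≤ d * d := Nat.mul_pos hd hd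
  have htT : 576 * t ≤ T := by rw [hT]; exact Nat.mul_le_mul_left _ (Nat.le_mul_of_pos_right _ hdd)
  have htT' : (576 : ℝ) * t ≤ T := by exact_mod_cast htT
  have hsub : (univ.filter fun σ : Fin t → Fin q =>
      ¬ NoOverflow V ((List.ofFn σ).map Fin.val) q T) ⊆
      (univ : Finset (Fin m)).biUnion fun i => univ.filter fun σ : Fin t → Fin q =>
        4 * T < ((V i).filter fun x : Fin n =>
          IsSampled ((List.ofFn σ).map Fin.val) q T (maxSize V (i + 1)) x).card := by
    intro σ hσ
    simp only [NoOverflow, mem_filter, mem_univ, true_and, not_forall, not_le] at hσ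
    simpa using hσ
  have hone : ∀ i : Fin m, ((univ.filter fun σ : Fin t → Fin q =>
        4 * T < ((V i).filter fun x : Fin n =>
          IsSampled ((List.ofFn σ).map Fin.val) q T (maxSize V (i + 1)) x).card).card : ℝ) ≤
      2 * (1 / 2) ^ t * Fintype.card (Fin t → Fin q) := by
    intro i
    have hcard := card_le_maxSize (V := V) i
    rcases le_or_gt (maxSize V (i + 1)) T with hM | hM
    · rw [filter_eq_empty_iff.2]
      · simp only [card_empty, Nat.cast_zero]
        positivity
      · intro σ _
        have := card_filter_le (V i) fun x : Fin n =>
          IsSampled ((List.ofFn σ).map Fin.val) q T (maxSize V (i + 1)) x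
        omega
    · have hMq : maxSize V (i + 1) ≤ q := (maxSize_le V fun i _ => sizeOfId_le V i).trans hn
      have hr := rate_mul_le (q := q) hq.pos (by omega : 0 < T) hM hMq
      have hμ : rate q T (maxSize V (i + 1)) * (V i).card ≤ 2 * T :=
        (mul_le_mul_of_nonneg_left (by exact_mod_cast hcard) (rate_nonneg _ _ _)).trans hr
      have ht0' : (0 : ℝ) ≤ t := Nat.cast_nonneg t
      refine le_trans ?_ (card_deviation_le hq hn ht ht0 (V i) hμ (D := 2 * T)
        (by linarith) (by nlinarith))
      refine Nat.cast_le.2 (card_le_card fun σ hσ => ?_)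
      simp only [mem_filter, mem_univ, true_and] at hσ ⊢
      have hσ' : (4 : ℝ) * T < ((V i).filter fun x : Fin n =>
          IsSampled ((List.ofFn σ).map Fin.val) q T (maxSize V (i + 1)) x).card := by
        exact_mod_cast hσ
      refine le_trans ?_ (le_abs_self _)
      linarith
  refine (Nat.cast_le.2 (card_le_card hsub)).trans ?_
  refine (Nat.cast_le.2 card_biUnion_le).trans ?_
  rw [Nat.cast_sum]
  refine (sum_le_sum fun i _ => hone i).trans ?_
  rw [sum_const, card_univ, Fintype.card_fin, nsmul_eq_mul]

open Classical in
/-- The probability of an inaccurate estimate, by a union bound over the small subcollections. The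
expectation for an optimal one is at least `T`, since `opt` is at least the largest size. -/
theorem card_inaccurate_le {q t T d k : ℕ} (hk : 1 ≤ k) (hq : q.Prime) (hn : n ≤ q) (ht : Even t)
    (ht0 : 0 < t) (hT : T = 576 * (t * (d * d))) (hd : 0 < d) :
    ((univ.filter fun σ : Fin t → Fin q =>
      ¬ IsAccurate V k d ((List.ofFn σ).map Fin.val) q T).card : ℝ) ≤
      (∑ i ∈ range (k + 1), m.choose i : ℕ) *
        (2 * (1 / 2) ^ t * Fintype.card (Fin t → Fin q)) := by
  rcases le_or_gt (maxSize V m) T with hM | hM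
  · rw [filter_eq_empty_iff.2]
    · simp only [card_empty, Nat.cast_zero]
      positivity
    · exact fun σ _ h => h fun h' => absurd hM (not_le.2 h')
  set μ := rate q T (maxSize V m) * MUC.opt V k with hμ
  have hTμ : (T : ℝ) ≤ μ := (le_rate_mul hq.pos hM).trans
    (mul_le_mul_of_nonneg_left (by exact_mod_cast maxSize_le_opt hk m le_rfl) (rate_nonneg _ _ _))
  have hT' : (T : ℝ) = 576 * (t * (d * d)) := by rw [hT]; push_cast; ring
  have hd' : (1 : ℝ) ≤ d := by exact_mod_cast hd
  have ht' : (0 : ℝ) < t := by exact_mod_cast ht0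
  have hsub : (univ.filter fun σ : Fin t → Fin q =>
      ¬ IsAccurate V k d ((List.ofFn σ).map Fin.val) q T) ⊆
      ((univ : Finset (Fin m)).powerset.filter fun B => B.card ≤ k).biUnion fun B =>
        univ.filter fun σ : Fin t → Fin q => μ / (4 * d) ≤
          |(((MUC.uniqueCover V B).filter fun x : Fin n =>
            IsSampled ((List.ofFn σ).map Fin.val) q T (maxSize V m) x).card : ℝ) -
            rate q T (maxSize V m) * (MUC.uniqueCover V B).card| := by
    intro σ hσ
    simp only [IsAccurate, mem_filter, mem_univ, true_and, Classical.not_imp, not_forall,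
      not_lt] at hσ
    obtain ⟨-, B, hB, h⟩ := hσ
    simp only [mem_biUnion, mem_filter, mem_univ, true_and, mem_powerset]
    exact ⟨B, ⟨subset_univ B, hB⟩, h⟩
  refine (Nat.cast_le.2 (card_le_card hsub)).trans ?_
  refine (Nat.cast_le.2 card_biUnion_le).trans ?_
  rw [Nat.cast_sum]
  have hcnt := MUC.card_filter_powerset_card_le (univ : Finset (Fin m)) k
  rw [card_univ, Fintype.card_fin] at hcnt
  rw [← hcnt, ← nsmul_eq_mul]
  refine sum_le_card_nsmul _ _ _ fun B hB => ?_
  have hBk := (mem_filter.1 hB).2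
  have hBopt : ((MUC.uniqueCover V B).card : ℝ) ≤ MUC.opt V k := by
    exact_mod_cast MUC.card_uniqueCover_le_opt V hBk
  refine card_deviation_le hq hn ht ht0 _
    (mul_le_mul_of_nonneg_left hBopt (rate_nonneg _ _ _)) ?_ ?_
  · rw [le_div_iff₀ (by positivity)]
    have h1 : (t : ℝ) * d ≤ t * (d * d) := mul_le_mul_of_nonneg_left (by nlinarith) ht'.le
    have h2 : (0 : ℝ) ≤ t * d := by positivity
    linarith
  -- this is where the constant `576 = 36 * 4 ^ 2` in the threshold comes from
  · rw [div_pow, le_div_iff₀ (by positivity)]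
    have h0 : 0 ≤ μ := le_trans (by positivity) hTμ
    calc 36 * (t : ℝ) * μ * (4 * d) ^ 2 = (576 * (t * (d * d))) * μ := by ring
      _ ≤ μ * μ := mul_le_mul_of_nonneg_right (hT' ▸ hTμ) h0
      _ = μ ^ 2 := by ring

/-- Without overflow and with accurate estimates, the output is a good approximation. Of the error
`1 / d ≤ ε`, the kernel takes one half and the estimates of the output and of an optimal
subcollection of the kernel take a quarter each. -/
theorem exists_isApprox_search {k r q T K d : ℕ} {φ ε : ℝ} (h : MUC.IsInstance V k r φ ε)
    (hq : 0 < q) (hT : 0 < T) (hd : 1 / ε ≤ d) (hK : 2 * (k * r * (φ + 1) * d) ≤ K) {s : List ℕ}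
    (hs : NoOverflow V s q T) (ha : IsAccurate V k d s q T) :
    ∃ B : Finset (Fin m), MUC.Lists (searchVal (storedAfter V s q T K m) n k s q T (maxSize V m)
        (2 ^ (storedAfter V s q T K m).length)).2 B ∧ MUC.IsApprox V k ε B := by
  obtain ⟨A, B, hA, hB, hBk, hmax⟩ := exists_lists_search (K := K) hs k
  have hε := h.eps_pos
  have hd0 : (0 : ℝ) < d := lt_of_lt_of_le (by positivity) hd
  have hdε : 1 / (d : ℝ) ≤ ε := (one_div_le hε hd0).1 hd
  obtain ⟨Q, hQA, hQk, hQ⟩ := h.exists_approx_of_isTopSets (δ := 1 / (2 * d)) (by positivity)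
    (by rw [div_div_eq_mul_div, div_one]; linarith) hA
  have hYQ := hmax Q hQA hQk
  refine ⟨B, hB, hBk, ?_⟩
  set O : ℝ := (MUC.opt V k : ℝ) with hO
  have hO0 : 0 ≤ O := Nat.cast_nonneg _
  have hhalf : 1 / (2 * (d : ℝ)) = 1 / d / 2 := by rw [div_div]; ring
  rw [hhalf] at hQ
  have hfin : (1 - ε) * O ≤ (1 - 1 / d) * O := mul_le_mul_of_nonneg_right (by linarith) hO0
  have hdO : 0 ≤ 1 / d * O := by positivity
  rcases le_or_gt (maxSize V m) T with hM | hM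
  · have hall : ∀ C : Finset (Fin m), sampledCoverage V s q T C = (MUC.uniqueCover V C).card :=
      fun C => by
        exact congrArg card (filter_true_of_mem fun x _ => isSampled_of_le hq hT hM s x)
    rw [hall, hall] at hYQ
    have hYQ' : ((MUC.uniqueCover V Q).card : ℝ) ≤ (MUC.uniqueCover V B).card := by
      exact_mod_cast hYQ
    linarith
  · have h1 := (abs_lt.1 (ha hM B hBk)).2
    have h2 := (abs_lt.1 (ha hM Q hQk)).1
    have hYQ' : (sampledCoverage V s q T Q : ℝ) ≤ sampledCoverage V s q T B := by
      exact_mod_cast hYQ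
    have hp : 0 < rate q T (maxSize V m) := by
      refine pos_of_mul_pos_left (lt_of_lt_of_le ?_ (le_rate_mul hq hM)) (Nat.cast_nonneg _)
      exact_mod_cast hT
    set p := rate q T (maxSize V m)
    have h3 : p * O / (4 * d) = p * (1 / d * O / 4) := by field_simp
    rw [← hO, h3] at h1 h2
    have h4 : p * ((MUC.uniqueCover V Q).card - 1 / d * O / 2) ≤
        p * (MUC.uniqueCover V B).card := by linarith
    have h5 := le_of_mul_le_mul_left h4 hp
    linarith

end

theorem sum_choose_le_pow {m k : ℕ} (hkm : k ≤ m) (hm : 1 ≤ m) :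
    (∑ i ∈ range (k + 1), m.choose i) ≤ 2 * m ^ (k + 1) := by
  calc (∑ i ∈ range (k + 1), m.choose i) ≤ ∑ _i ∈ range (k + 1), m ^ k :=
        sum_le_sum fun i hi => (Nat.choose_le_pow m i).trans
          (Nat.pow_le_pow_right hm (Nat.lt_succ_iff.1 (mem_range.1 hi)))
    _ = (k + 1) * m ^ k := by rw [sum_const, card_range, smul_eq_mul]
    _ ≤ 2 * m * m ^ k := Nat.mul_le_mul_right _ (by omega)
    _ = 2 * m ^ (k + 1) := by ring

/-- The choice of the degree makes the total failure probability at most `1 / m ^ a`. -/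
theorem failure_le {a m k : ℕ} (hk : 2 ≤ k) (hkm : k ≤ m) :
    ((m : ℝ) + (∑ i ∈ range (k + 1), m.choose i : ℕ)) * (2 * (1 / 2) ^ degreeVal a m k) ≤
      1 / (m : ℝ) ^ a := by
  have hm : 2 ≤ m := hk.trans hkm
  have hm0 : (0 : ℝ) < m := by positivity
  have h1 : m + (∑ i ∈ range (k + 1), m.choose i) ≤ m ^ (k + 3) := by
    have h2 := sum_choose_le_pow hkm (by omega : 1 ≤ m)
    have h3 : m ≤ m ^ (k + 1) := Nat.le_self_pow (by omega) m
    calc m + (∑ i ∈ range (k + 1), m.choose i) ≤ 2 * 2 * m ^ (k + 1) := by omega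
      _ ≤ m * m * m ^ (k + 1) := Nat.mul_le_mul_right _ (Nat.mul_le_mul hm hm)
      _ = m ^ (k + 3) := by ring
  have h4 : m ^ a * (m + (∑ i ∈ range (k + 1), m.choose i)) * 2 ≤ 2 ^ degreeVal a m k := by
    calc m ^ a * (m + (∑ i ∈ range (k + 1), m.choose i)) * 2 ≤ m ^ a * m ^ (k + 3) * m :=
          Nat.mul_le_mul (Nat.mul_le_mul_left _ h1) hm
      _ = m ^ (a + k + 4) := by ring
      _ ≤ (2 ^ Nat.size m) ^ (a + k + 4) := Nat.pow_le_pow_left (Nat.lt_size_self m).le _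
      _ = 2 ^ (Nat.size m * (a + k + 4)) := by rw [← pow_mul]
      _ ≤ 2 ^ degreeVal a m k := Nat.pow_le_pow_right (by norm_num) (by
          rw [degreeVal, mul_comm (Nat.size m), ← mul_assoc]
          exact Nat.mul_le_mul_right _ (by omega))
  have h4' : (m : ℝ) ^ a * (m + (∑ i ∈ range (k + 1), m.choose i : ℕ)) * 2 ≤
      2 ^ degreeVal a m k := by exact_mod_cast h4
  rw [le_div_iff₀ (by positivity), one_div, inv_pow]
  have h5 : (0 : ℝ) < 2 ^ degreeVal a m k := by positivity
  rw [mul_comm, ← mul_assoc, ← mul_assoc, ← div_eq_mul_inv, div_le_one h5]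
  exact h4'

/-- The streaming algorithm succeeds with probability at least `1 - 1 / m ^ a`. -/
theorem streamAlg_prob (a : ℕ) {m n : ℕ} (V : Fin m → Finset (Fin n)) (k r : ℕ) (φ ε : ℝ)
    (h : MUC.IsInstance V k r φ ε) : 1 - 1 / (m : ℝ) ^ a ≤
      (streamAlg a).prob (n, m, k, r, ⌈φ⌉₊, ⌈1 / ε⌉₊, ()) V
        (fun L => ∃ B : Finset (Fin m), MUC.Lists L B ∧ MUC.IsApprox V k ε B) := by
  classical
  have hn : n ≠ 0 := h.pos.1.ne'
  have hε := h.eps_pos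
  set f := ⌈φ⌉₊ with hf
  set d := ⌈1 / ε⌉₊ with hd
  have hd1 : 1 / ε ≤ d := Nat.le_ceil _
  have hd0 : 0 < d := Nat.ceil_pos.2 (by positivity)
  have hsize : 0 < Nat.size m := Nat.size_pos.2 (by have := h.two_le_k; have := h.k_le; omega)
  have ht0 : 0 < degreeVal a m k := by unfold degreeVal; positivity
  have hT0 : 0 < thresholdVal a m k d := by unfold thresholdVal; positivity
  have hq := primeAbove_prime n
  have hnq := (primeAbove_gt n).le
  have hK : 2 * (k * r * (φ + 1) * d) ≤ (capacityVal k r f d : ℝ) := by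
    unfold capacityVal
    push_cast
    have : φ ≤ f := Nat.le_ceil _
    rw [mul_assoc (k * r : ℝ)]
    gcongr
  have hres := streamAlg_result V a k r f d hn
  rw [StreamAlg.prob]
  have hN : (streamAlg a).numSeeds (n, m, k, r, f, d, ()) = degreeVal a m k :=
    degree_eval _ _ _ _ _
  have hR : (streamAlg a).seedRange (n, m, k, r, f, d, ()) = primeAbove n :=
    nextPrime_eval _ _ _ hn
  simp only [hres, StreamAlg.seedList]
  unfold StreamAlg.Seed
  rw [hN, hR]
  set Good : (Fin (degreeVal a m k) → Fin (primeAbove n)) → Prop := fun σ =>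
    NoOverflow V ((List.ofFn σ).map Fin.val) (primeAbove n) (thresholdVal a m k d) ∧
    IsAccurate V k d ((List.ofFn σ).map Fin.val) (primeAbove n) (thresholdVal a m k d) with hGood
  have hcard0 : (0 : ℝ) < Fintype.card (Fin (degreeVal a m k) → Fin (primeAbove n)) := by
    rw [Fintype.card_fun, Fintype.card_fin]
    have := hq.pos
    positivity
  have hbad : ((univ.filter fun σ => ¬ Good σ).card : ℝ) ≤
      1 / (m : ℝ) ^ a * Fintype.card (Fin (degreeVal a m k) → Fin (primeAbove n)) := by
    have hsub : (univ.filter fun σ => ¬ Good σ) ⊆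
        (univ.filter fun σ : Fin (degreeVal a m k) → Fin (primeAbove n) =>
          ¬ NoOverflow V ((List.ofFn σ).map Fin.val) (primeAbove n) (thresholdVal a m k d)) ∪
        univ.filter fun σ : Fin (degreeVal a m k) → Fin (primeAbove n) =>
          ¬ IsAccurate V k d ((List.ofFn σ).map Fin.val) (primeAbove n) (thresholdVal a m k d) := by
      intro σ hσ
      simp only [hGood, mem_filter, mem_univ, true_and, mem_union] at hσ ⊢
      exact not_and_or.1 hσ
    have h1 := card_overflow_le (V := V) hq hnq (even_two_mul _) ht0 (T := thresholdVal a m k d)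
      rfl hd0
    have h2 := card_inaccurate_le (V := V) (by have := h.two_le_k; omega : 1 ≤ k) hq hnq
      (even_two_mul _) ht0 (T := thresholdVal a m k d) rfl hd0
    have h3 : ((univ.filter fun σ => ¬ Good σ).card : ℝ) ≤ _ :=
      (Nat.cast_le.2 (card_le_card hsub)).trans (Nat.cast_le.2 (card_union_le _ _))
    rw [Nat.cast_add] at h3
    refine (h3.trans (add_le_add h1 h2)).trans ?_
    rw [← add_mul, ← mul_assoc]
    exact mul_le_mul_of_nonneg_right (failure_le h.two_le_k h.k_le) hcard0.le
  have hgood : Fintype.card (Fin (degreeVal a m k) → Fin (primeAbove n)) =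
      (univ.filter Good).card + (univ.filter fun σ => ¬ Good σ).card := by
    rw [card_filter_add_card_filter_not, card_univ]
  have hgood' : (Fintype.card (Fin (degreeVal a m k) → Fin (primeAbove n)) : ℝ) =
      (univ.filter Good).card + (univ.filter fun σ => ¬ Good σ).card := by exact_mod_cast hgood
  rw [le_div_iff₀ hcard0]
  have hle : ((univ.filter Good).card : ℝ) ≤ ((univ.filter fun σ : Fin (degreeVal a m k) →
      Fin (primeAbove n) => ∃ B : Finset (Fin m), MUC.Lists (searchVal (storedAfter V
        ((List.ofFn σ).map Fin.val) (primeAbove n) (thresholdVal a m k d) (capacityVal k r f d) m)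
        n k ((List.ofFn σ).map Fin.val) (primeAbove n) (thresholdVal a m k d) (maxSize V m)
        (2 ^ (storedAfter V ((List.ofFn σ).map Fin.val) (primeAbove n) (thresholdVal a m k d)
          (capacityVal k r f d) m).length)).2 B ∧ MUC.IsApprox V k ε B).card : ℝ) := by
    refine Nat.cast_le.2 (card_le_card fun σ hσ => ?_)
    have hσ := (mem_filter.1 hσ).2
    exact mem_filter.2 ⟨mem_univ σ, exists_isApprox_search h hq.pos hT0 hd1 hK hσ.1 hσ.2⟩
  refine le_trans ?_ (le_trans hle (le_of_eq ?_))
  · linarith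
  · congr 2

end Machine

namespace Machine

open Finset Hashing

/-! ### Space of the elementary programs -/

section Peak

variable {Γ : List Ty} {σ τ : Ty} {inp : ℕ → ℕ} {e : Env Γ} {W : ℕ}

theorem peak_op_le {o : Op} {s t : Tm Γ .nat}
    (h : Ty.nat.bits (o.eval (s.eval inp e) (t.eval inp e)) ≤ W) (hs : s.peak inp e ≤ W)
    (ht : t.peak inp e ≤ W) : (Tm.op o s t).peak inp e ≤ W := max_le h (max_le hs ht)

theorem peak_read_le {t : Tm Γ .nat} (h : Ty.nat.bits (inp (t.eval inp e)) ≤ W)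
    (ht : t.peak inp e ≤ W) : (Tm.read t).peak inp e ≤ W := max_le h ht

theorem peak_bind_le {s : Tm Γ σ} {t : Tm (σ :: Γ) τ} (hs : s.peak inp e ≤ W)
    (ht : t.peak inp (s.eval inp e, e) ≤ W) : (Tm.bind s t).peak inp e ≤ W := max_le hs ht

theorem peak_ite_le {c : Tm Γ .nat} {s t : Tm Γ τ} (hc : c.peak inp e ≤ W)
    (hs : s.peak inp e ≤ W) (ht : t.peak inp e ≤ W) : (Tm.ite c s t).peak inp e ≤ W := by
  refine max_le hc ?_
  split_ifs
  exacts [hs, ht]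

theorem peak_pair_le {s : Tm Γ σ} {t : Tm Γ τ}
    (h : σ.bits (s.eval inp e) + τ.bits (t.eval inp e) ≤ W) (hs : s.peak inp e ≤ W)
    (ht : t.peak inp e ≤ W) : (Tm.pair s t).peak inp e ≤ W := by
  simp only [Tm.peak]
  exact max_le h (max_le hs ht)

theorem peak_cons_le {s : Tm Γ τ} {t : Tm Γ (.list τ)}
    (h : 1 + τ.bits (s.eval inp e) + (Ty.list τ).bits (t.eval inp e) ≤ W)
    (hs : s.peak inp e ≤ W) (ht : t.peak inp e ≤ W) : (Tm.cons s t).peak inp e ≤ W := by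
  simp only [Tm.peak, bits_cons]
  exact max_le h (max_le hs ht)

theorem peak_nil_le (h : 1 ≤ W) : (Tm.nil : Tm Γ (.list τ)).peak inp e ≤ W := by
  simp only [Tm.peak, bits_nil]
  exact h

theorem peak_fold_le {l : Tm Γ (.list σ)} {s : Tm Γ τ} {t : Tm (σ :: τ :: Γ) τ}
    (hl : l.peak inp e ≤ W) (hs : s.peak inp e ≤ W)
    (h : ∀ p x, (p ++ [x]) <+: l.eval inp e →
      t.peak inp (x, p.foldl (fun a x => t.eval inp (x, a, e)) (s.eval inp e), e) ≤ W) :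
    (Tm.fold l s t).peak inp e ≤ W :=
  max_le (max_le hl hs) (foldMax_le _ _ _ _ h)

theorem peak_loop_le {c : Tm Γ .nat} {s : Tm Γ τ} {t : Tm (τ :: Γ) τ}
    (hc : c.peak inp e ≤ W) (hs : s.peak inp e ≤ W)
    (h : ∀ j < c.eval inp e,
      t.peak inp ((fun a => t.eval inp (a, e))^[j] (s.eval inp e), e) ≤ W) :
    (Tm.loop c s t).peak inp e ≤ W :=
  max_le (max_le hc hs) (Finset.sup_le fun j hj => h j (Finset.mem_range.1 hj))

theorem peak_var_nat_le {X : ℕ} {v : Var Γ .nat} (h : v.get e ≤ X) (hW : Ty.nat.bits X ≤ W) :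
    (Tm.var v).peak inp e ≤ W := (bits_nat_mono h).trans hW

theorem peak_lit_le {X a : ℕ} (h : a ≤ X) (hW : Ty.nat.bits X ≤ W) :
    (Tm.lit a : Tm Γ .nat).peak inp e ≤ W := (bits_nat_mono h).trans hW

variable {X : ℕ}

theorem peak_bitLength_le {a : Var Γ .nat} (ha : a.get e + 2 ≤ X)
    (hW : 2 * Ty.nat.bits X ≤ W) : (bitLength a).peak inp e ≤ W := by
  have hb : ∀ {y : ℕ}, y ≤ X → Ty.nat.bits y ≤ Ty.nat.bits X := bits_nat_mono
  have hW1 : Ty.nat.bits X ≤ W := by omega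
  have ha' : a.get e ≤ X := le_trans (Nat.le_add_right _ 2) ha
  have h2 : 2 ≤ X := le_trans (Nat.le_add_left 2 _) ha
  refine peak_loop_le (peak_var_nat_le ha' hW1) (peak_pair_le ?_ (peak_var_nat_le ha' hW1)
    (peak_lit_le (Nat.zero_le X) hW1)) fun j _ => ?_
  · have h1 := hb ha'
    have h3 := hb (Nat.zero_le X)
    exact (Nat.add_le_add h1 h3).trans (by omega)
  · obtain ⟨y, z, h, h3, h4⟩ := bitLength_iterate inp e (a.get e) j
    have hs := size_le_self (a.get e)
    have hyX : y ≤ X := by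
      have : y ≤ a.get e := h4.trans (Nat.sub_le _ _)
      exact this.trans ha'
    have hzX : z + 1 ≤ X := by
      have : z ≤ a.get e := le_trans (by omega) hs
      exact le_trans (Nat.add_le_add this (by norm_num : 1 ≤ 2)) ha
    have hy := hb hyX
    have hy2 := hb ((Nat.div_le_self y 2).trans hyX)
    have hz1 := hb hzX
    have hz := hb ((Nat.le_succ z).trans hzX)
    have h1 := hb (show 1 ≤ X by omega)
    have h2' := hb h2
    simp only [Tm.eval, Var.get] at h ⊢
    rw [h]
    have hst : (Ty.prod .nat .nat).bits (y, z) ≤ W := by rw [bits_prod]; omega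
    refine peak_ite_le hst (peak_pair_le ?_ (peak_op_le ?_ hst ?_) (peak_op_le ?_ hst ?_)) hst
    · exact (Nat.add_le_add hy2 hz1).trans (by omega)
    · exact hy2.trans hW1
    · exact h2'.trans hW1
    · exact hz1.trans hW1
    · exact h1.trans hW1

theorem peak_isPrime_le {q : Var Γ .nat} (hq : q.get e ≤ X) (hX : 2 ≤ X)
    (hW : 2 * Ty.nat.bits X ≤ W) : (isPrime q).peak inp e ≤ W := by
  have hb : ∀ {y : ℕ}, y ≤ X → Ty.nat.bits y ≤ Ty.nat.bits X := bits_nat_mono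
  have hW1 : Ty.nat.bits X ≤ W := by omega
  have hacc : ∀ j, ∃ b ≤ X, forAcc inp (.lit 1)
      (.ite (.op .lt (.lit 1) v0) (.ite (.op .mod (.var q.up3) v0) v1 (.lit 0)) v1) e j = b :=
    fun j => ⟨_, by split_ifs <;> omega, isPrime_forAcc inp q e j⟩
  refine forN_peak_le (R := q.get e) rfl (peak_var_nat_le hq hW1)
    (peak_lit_le (by omega : 1 ≤ X) hW1) (fun j hj => ?_) fun j hj => ?_
  · obtain ⟨b, hbX, h⟩ := hacc j
    rw [h]
    have h1 := hb (max_le (hj.trans hq) (by omega : 1 ≤ X))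
    have h2 := hb hbX
    omega
  · obtain ⟨b, hbX, h⟩ := hacc j
    rw [h]
    have hjX : j ≤ X := hj.le.trans hq
    have h1 : ∀ {y : ℕ}, y ≤ X → Ty.nat.bits y ≤ W := fun hy => (hb hy).trans hW1
    refine peak_ite_le (peak_op_le (h1 ?_) (h1 ?_) (h1 hjX)) (peak_ite_le (peak_op_le (h1 ?_)
      (h1 hq) (h1 hjX)) (h1 hbX) (h1 (Nat.zero_le X))) (h1 hbX)
    · simp only [Op.eval]
      split_ifs <;> omega
    · omega
    · exact (Nat.mod_le _ _).trans hq

theorem peak_nextPrime_le {n : Var Γ .nat} {n' : ℕ} (hN : n.get e = n') (hn0 : n' ≠ 0)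
    (hn : 2 * n' + 2 ≤ X) (hW : 2 * Ty.nat.bits X ≤ W) : (nextPrime n).peak inp e ≤ W := by
  have hb : ∀ {y : ℕ}, y ≤ X → Ty.nat.bits y ≤ W := fun hy => (bits_nat_mono hy).trans (by omega)
  have hcN : Ty.nat.bits (n.get e) ≤ W := by rw [hN]; exact hb (by omega)
  refine peak_loop_le hcN (peak_op_le ?_ hcN (hb (by omega : 1 ≤ X))) fun j _ => ?_
  · simp only [Tm.eval, hN]
    exact hb (by simp only [Op.eval]; omega)
  · have h1 := nextPrime_iterate inp e hn0 j
    simp only [Tm.eval, Op.eval, Var.get, hN] at h1 ⊢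
    rw [h1]
    have h2 : min (n' + 1 + j) (primeAbove n') ≤ 2 * n' := 
      (min_le_right _ _).trans (primeAbove_le hn0)
    generalize min (n' + 1 + j) (primeAbove n') = y at h2
    exact peak_ite_le (peak_isPrime_le (X := X) (by omega : y ≤ X) (by omega) hW)
      (hb (by omega : y ≤ X)) (peak_op_le (hb (by omega : y + 1 ≤ X)) (hb (by omega : y ≤ X))
      (hb (by omega : 1 ≤ X)))

theorem peak_degree_le {a : ℕ} {m k : Var Γ .nat} {m' k' : ℕ} (hM : m.get e = m')
    (hK : k.get e = k') (hX : 2 * (2 * k' + (a + 3)) * (m' + 2) ≤ X)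
    (hW : 2 * Ty.nat.bits X ≤ W) : (degree a m k).peak inp e ≤ W := by
  have hb : ∀ {y : ℕ}, y ≤ X → Ty.nat.bits y ≤ W := fun hy => (bits_nat_mono hy).trans (by omega)
  have hs := size_le_self m'
  have h1 : (2 * k' + (a + 3)) * Nat.size m' ≤ (2 * k' + (a + 3)) * (m' + 2) :=
    Nat.mul_le_mul_left _ (hs.trans (Nat.le_add_right m' 2))
  rw [mul_assoc] at hX
  have h2 : 2 * k' + (a + 3) ≤ (2 * k' + (a + 3)) * (m' + 2) := Nat.le_mul_of_pos_right _ (by omega)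
  have h3 : m' + 2 ≤ (2 * k' + (a + 3)) * (m' + 2) := Nat.le_mul_of_pos_left _ (by omega)
  have hbit : (bitLength m).peak inp e ≤ W := peak_bitLength_le (X := X)
    (by rw [hM]; exact (by omega : m' + 2 ≤ X)) hW
  have hev : (bitLength m).eval inp e = Nat.size m' := by rw [bitLength_eval, hM]
  refine peak_op_le (hb ?_) (hb (by omega : 2 ≤ X)) (peak_op_le (hb ?_) (peak_op_le (hb ?_)
    (peak_op_le (hb ?_) (hb (by omega : 2 ≤ X)) ?_) (hb (by omega : a + 3 ≤ X))) hbit)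
  · simp only [Tm.eval, Op.eval, hev, hK]
    exact (by omega : 2 * ((2 * k' + (a + 3)) * Nat.size m') ≤ X)
  · simp only [Tm.eval, Op.eval, hev, hK]
    exact (by omega : (2 * k' + (a + 3)) * Nat.size m' ≤ X)
  · simp only [Tm.eval, Op.eval, hK]
    exact (by omega : (2 * k' + (a + 3)) ≤ X)
  · simp only [Tm.eval, Op.eval, hK]
    exact (by omega : 2 * k' ≤ X)
  · simp only [Tm.peak, hK]
    exact hb (by omega)

theorem peak_threshold_le {a : ℕ} {m k d : Var Γ .nat} {m' k' d' : ℕ} (hM : m.get e = m')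
    (hK : k.get e = k') (hD : d.get e = d') (hX : 2 * (2 * k' + (a + 3)) * (m' + 2) ≤ X)
    (h576 : 576 ≤ X) (hd : d' * d' ≤ X) (hT : thresholdVal a m' k' d' ≤ X)
    (hW : 2 * Ty.nat.bits X ≤ W) : (threshold a m k d).peak inp e ≤ W := by
  have hb : ∀ {y : ℕ}, y ≤ X → Ty.nat.bits y ≤ W := fun hy => (bits_nat_mono hy).trans (by omega)
  have hT' : 576 * (degreeVal a m' k' * (d' * d')) ≤ X := hT
  have hdX : Ty.nat.bits (d.get e) ≤ W := by
    rw [hD]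
    exact hb (le_trans (Nat.le_mul_self d') hd)
  refine peak_op_le (hb ?_) (hb h576) (peak_op_le (hb ?_) (peak_degree_le hM hK hX hW)
    (peak_op_le (hb ?_) hdX hdX))
  · simp only [Tm.eval, Op.eval, degree_eval, hM, hK, hD]
    exact hT'
  · simp only [Tm.eval, Op.eval, degree_eval, hM, hK, hD]
    exact (Nat.le_mul_of_pos_left _ (by norm_num)).trans hT'
  · simp only [Tm.eval, Op.eval, hD]
    exact hd

theorem peak_capacity_le {k r f d : Var Γ .nat} {k' r' f' d' : ℕ} (hk : k.get e = k')
    (hr : r.get e = r') (hf : f.get e = f') (hd : d.get e = d')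
    (hX : k' + r' + k' * r' + ((f' + 1) * d' + f' + 1 + d') + capacityVal k' r' f' d' + 2 ≤ X)
    (hW : Ty.nat.bits X ≤ W) : (capacity k r f d).peak inp e ≤ W := by
  have hb : ∀ {y : ℕ}, y ≤ X → Ty.nat.bits y ≤ W := fun hy => (bits_nat_mono hy).trans (by omega)
  unfold capacityVal at hX
  simp only [capacity, Tm.peak, Tm.eval, Op.eval, hk, hr, hf, hd]
  refine max_le (hb ?_) (max_le (hb ?_) (max_le (hb ?_) (max_le (max_le (hb ?_) (max_le (hb ?_)
    (hb ?_))) (max_le (hb ?_) (max_le (max_le (hb ?_) (max_le (hb ?_) (hb ?_))) (hb ?_))))))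
  all_goals omega

/-- The numbers that occur when the elements of sets are sampled are at most `X`; `q` is the modulus
and `T` the threshold. -/
structure SamplingBound (n q T X : ℕ) : Prop where
  two_le : 2 ≤ X
  pos : 0 < q
  add_one_le : n + 1 ≤ X
  hash_le : q * n + q ≤ X
  threshold_le : T * q ≤ X
  four_mul_le : 4 * T + 1 ≤ X

theorem peak_hash_le {x : Var Γ .nat} {s : Var Γ (.list .nat)} {q : Var Γ .nat} {x' n q' T : ℕ}
    {s' : List ℕ} (hX : SamplingBound n q' T X) (hx : x.get e = x') (hs : s.get e = s')
    (hq : q.get e = q') (hxn : x' ≤ n) (hsq : ∀ c ∈ s', c ≤ q')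
    (hW : (Ty.list .nat).bits s' + Ty.nat.bits X ≤ W) : (hash x s q).peak inp e ≤ W := by
  have hb : ∀ {y : ℕ}, y ≤ X → Ty.nat.bits y ≤ W := fun hy => (bits_nat_mono hy).trans (by omega)
  obtain ⟨h2, h0, h1, hh, -, -⟩ := hX
  refine peak_fold_le ?_ (hb (Nat.zero_le X)) fun p c hp => ?_
  · simp only [Tm.peak, hs]
    omega
  · simp only [Tm.eval, hs] at hp
    have hc := hsq c (hp.subset (by simp))
    have hlt := horner_lt h0 p x'
    unfold horner at hlt
    simp only [Tm.eval, Op.eval, Var.get, hx, hq]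
    generalize p.foldl (fun h c => (h * x' + c) % q') 0 = h at hlt
    have hm : h * x' ≤ q' * n := Nat.mul_le_mul hlt.le hxn
    have hm2 : (h * x' + c) % q' ≤ X := (Nat.mod_le _ _).trans (by omega)
    simp only [Tm.peak, Tm.eval, Op.eval, Var.get, hx, hq]
    refine max_le (hb hm2) (max_le (max_le (hb ?_) (max_le (max_le (hb ?_) (max_le (hb ?_)
      (hb ?_))) (hb ?_))) (hb ?_))
    all_goals omega

theorem peak_sampled_le {x : Var Γ .nat} {s : Var Γ (.list .nat)} {q T M : Var Γ .nat}
    {x' n q' T' M' : ℕ} {s' : List ℕ} (hX : SamplingBound n q' T' X) (hx : x.get e = x')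
    (hs : s.get e = s') (hq : q.get e = q') (hT : T.get e = T') (hM : M.get e = M')
    (hxn : x' ≤ n) (hMn : M' ≤ n) (hsq : ∀ c ∈ s', c ≤ q')
    (hW : (Ty.list .nat).bits s' + Ty.nat.bits X ≤ W) : (sampled x s q T M).peak inp e ≤ W := by
  have hb : ∀ {y : ℕ}, y ≤ X → Ty.nat.bits y ≤ W := fun hy => (bits_nat_mono hy).trans (by omega)
  have hh := peak_hash_le (inp := inp) hX hx hs hq hxn hsq hW
  have hlt := horner_lt hX.pos s' x'
  have h1 : horner q' s' x' * M' ≤ q' * n := Nat.mul_le_mul hlt.le hMn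
  obtain ⟨h2, h0, h3, h4, h5, h6⟩ := hX
  have h7 : q' ≤ X := by omega
  have h8 : T' ≤ X := by omega
  refine peak_op_le (hb ?_) (peak_op_le (hb ?_) hh (hb ?_)) (peak_op_le (hb ?_) (hb ?_) (hb ?_))
  · simp only [Op.eval]
    split_ifs <;> omega
  · simp only [Tm.eval, hash_eval, Op.eval, hx, hs, hq, hM]
    omega
  · rw [hM]; omega
  · simp only [Tm.eval, Op.eval, hq, hT]
    exact h5
  · rw [hT]; exact h8
  · rw [hq]; exact h7

theorem peak_arrivingSize_le {n : Var Γ .nat} {n' : ℕ} (hn : n.get e = n') (hX : n' + 1 ≤ X)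
    (hinp : ∀ x, inp x ≤ 1) (hW : 2 * Ty.nat.bits X ≤ W) :
    (arrivingSize n).peak inp e ≤ W := by
  have hb : ∀ {y : ℕ}, y ≤ X → Ty.nat.bits y ≤ W := fun hy => (bits_nat_mono hy).trans (by omega)
  have hsum : ∀ j, ∑ x ∈ range j, inp x ≤ j := sum_range_le_of_le_one hinp
  refine forN_peak_le (R := n') hn (hb ?_) (hb (Nat.zero_le X)) (fun j hj => ?_) fun j hj => ?_
  · rw [hn]; omega
  · rw [arrivingSize_forAcc]
    have h1 := bits_nat_mono (max_le (by omega : j ≤ X) (by omega : 1 ≤ X))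
    have h2 := bits_nat_mono ((hsum j).trans (by omega : j ≤ X))
    omega
  · rw [arrivingSize_forAcc]
    have h1 := hsum j
    have h2 := hinp j
    refine peak_op_le (hb ?_) (hb ?_) (peak_read_le (hb ?_) (hb ?_))
    · exact (by omega : (∑ x ∈ range j, inp x) + inp j ≤ X)
    · exact (by omega : (∑ x ∈ range j, inp x) ≤ X)
    · simp only [Tm.eval, Var.get]
      omega
    · exact (by omega : j ≤ X)

end Peak

end Machine

namespace Machine

open Finset Hashing

/-! ### Space of the programs on lists of stored sets -/

section

variable {Γ : List Ty} {σ τ : Ty} {inp : ℕ → ℕ} {e : Env Γ} {W X S : ℕ}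

theorem bits_reverse (l : List τ.Val) : (Ty.list τ).bits l.reverse = (Ty.list τ).bits l := by
  simp only [Ty.bits, List.map_reverse, List.sum_reverse]

theorem bits_fst_le (x : σ.Val × τ.Val) : σ.bits x.1 ≤ (Ty.prod σ τ).bits x := Nat.le_add_right _ _

theorem bits_snd_le (x : σ.Val × τ.Val) : τ.bits x.2 ≤ (Ty.prod σ τ).bits x := Nat.le_add_left _ _

theorem bits_map_fst_le (l : List Entry) :
    (Ty.list .nat).bits (l.map Prod.fst) ≤ (Ty.list EntryTy).bits l := by
  induction l with
  | nil => exact le_rfl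
  | cons x l ih =>
    have h := bits_fst_le (σ := .nat) (τ := .prod .nat (.list .nat)) x
    have h1 := bits_cons (τ := .nat) x.1 (l.map Prod.fst)
    have h2 := bits_cons (τ := EntryTy) x l
    rw [List.map_cons, h1, h2]
    exact Nat.add_le_add (Nat.add_le_add_left h 1) ih

theorem bits_bool_le {P : Prop} [Decidable P] (h : 3 ≤ W) :
    Ty.nat.bits (if P then 1 else 0) ≤ W := by
  refine (bits_nat_mono (b := 1) (by split_ifs <;> omega)).trans ?_
  rw [bits_nat, Nat.size_one]
  exact h

theorem three_le_bits (hX : 1 ≤ X) : 3 ≤ Ty.nat.bits X :=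
  le_trans (by rw [bits_nat, Nat.size_one]) (bits_nat_mono hX)

theorem bits_of_prefix {l p : List τ.Val} {x : τ.Val} (h : (p ++ [x]) <+: l) :
    (Ty.list τ).bits p ≤ (Ty.list τ).bits l ∧ τ.bits x ≤ (Ty.list τ).bits l ∧
      p.length + 1 ≤ l.length :=
  ⟨bits_list_le_of_sublist ((List.sublist_append_left p [x]).trans h.sublist),
    bits_le_of_mem (h.subset (by simp)), by simpa using h.length_le⟩

theorem peak_collect_le {n : Var Γ .nat} {s : Var Γ (.list .nat)} {q T M : Var Γ .nat}
    {n' q' T' M' : ℕ} {s' : List ℕ} (hX : SamplingBound n' q' T' X) (hn : n.get e = n')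
    (hs : s.get e = s') (hq : q.get e = q') (hT : T.get e = T') (hM : M.get e = M')
    (hMn : M' ≤ n') (hinp : ∀ x, inp x ≤ 1) (hsq : ∀ c ∈ s', c ≤ q')
    (hS : 4 * T' * (Ty.nat.bits n' + 1) + 1 ≤ S)
    (hW : (Ty.list .nat).bits s' + 4 * Ty.nat.bits X + S ≤ W) :
    (collect n s q T M).peak inp e ≤ W := by
  have hb : ∀ {y : ℕ}, y ≤ X → Ty.nat.bits y ≤ Ty.nat.bits X := bits_nat_mono
  have hbW : ∀ {y : ℕ}, y ≤ X → Ty.nat.bits y ≤ W := fun hy => (hb hy).trans (by omega)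
  have h3 := three_le_bits (X := X) (by have := hX.two_le; omega)
  have hnX := hX.add_one_le
  have h4 := hX.four_mul_le
  have hval : ∀ j ≤ n', Ty.nat.bits (collectVal inp s' q' T' M' j).1 ≤ Ty.nat.bits X ∧
      (collectVal inp s' q' T' M' j).1 + 1 ≤ X ∧
      (Ty.list .nat).bits (collectVal inp s' q' T' M' j).2 ≤ S := by
    intro j hj
    obtain ⟨h1, h2, -, h5, -⟩ := collectVal_spec inp s' q' T' M' j
    refine ⟨hb (by omega), by omega, ?_⟩
    refine (bits_list_le (τ := .nat) (b := Ty.nat.bits n') fun x hx =>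
      bits_nat_mono ((h5 x hx).1.le.trans hj)).trans (le_trans ?_ hS)
    rw [← h1]
    exact Nat.add_le_add_right (Nat.mul_le_mul_right _ h2) 1
  refine forN_peak_le (R := n') hn (hbW ?_) (peak_pair_le ?_ (hbW (Nat.zero_le X))
    (peak_nil_le (by omega))) (fun j hj => ?_) fun j hj => ?_
  · rw [hn]; omega
  · have h0 := hb (Nat.zero_le X)
    exact (Nat.add_le_add h0 (le_of_eq bits_nil)).trans (by omega)
  · rw [collect_forAcc, hs, hq, hT, hM]
    obtain ⟨h5, -, h6⟩ := hval j hj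
    have h7 := hb (max_le (by omega : j ≤ X) (by omega : 1 ≤ X))
    refine (Nat.add_le_add h7 (Nat.add_le_add h5 h6)).trans (by omega)
  · rw [collect_forAcc, hs, hq, hT, hM]
    obtain ⟨h5, h5', h6⟩ := hval j hj.le
    have hj1 := hb (by omega : j ≤ X)
    generalize collectVal inp s' q' T' M' j = z at *
    obtain ⟨z1, z2⟩ := z
    change Ty.nat.bits z1 ≤ _ at h5
    change z1 + 1 ≤ X at h5'
    change (Ty.list .nat).bits z2 ≤ S at h6
    have hz : (Ty.prod .nat (.list .nat)).bits (z1, z2) ≤ W :=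
      (Nat.add_le_add h5 h6).trans (by omega)
    have hz1 := hb h5'
    have hTX : Ty.nat.bits T' ≤ W := hbW (by omega)
    have hT4 : Ty.nat.bits (4 * T') ≤ W := hbW (by omega)
    have hjW : Ty.nat.bits j ≤ W := hbW (by omega)
    have h4W : Ty.nat.bits 4 ≤ W := by
      rw [bits_nat, show Nat.size 4 = 3 by decide]
      omega
    refine peak_ite_le (peak_read_le (hbW ((hinp j).trans (by omega))) hjW)
      (peak_ite_le ?_ (peak_ite_le (peak_op_le ?_ hz (peak_op_le ?_ h4W ?_))
      (peak_pair_le ?_ (peak_op_le ?_ hz (hbW (by omega : 1 ≤ X))) (peak_cons_le ?_ hjW hz))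
        hz) hz) hz
    · exact peak_sampled_le (n := n') (x' := j) hX rfl (by exact hs) (by exact hq) (by exact hT)
        (by exact hM) hj.le hMn hsq (by omega)
    · exact bits_bool_le (by omega)
    · simp only [Tm.eval, Op.eval, Var.get, hT]
      exact hT4
    · simp only [Tm.peak, Var.get, hT]
      exact hTX
    · have hc := bits_cons (τ := .nat) j z2
      refine (Nat.add_le_add hz1 (le_of_eq hc)).trans ?_
      omega
    · exact hz1.trans (by omega)
    · exact (Nat.add_le_add (Nat.add_le_add_left hj1 1) h6).trans (by omega)

theorem peak_leastEntry_le {x : Var Γ EntryTy} {l : Var Γ (.list EntryTy)} {x' : Entry}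
    {l' : List Entry} (hx : x.get e = x') (hl : l.get e = l') (hxS : EntryTy.bits x' ≤ S)
    (hlS : (Ty.list EntryTy).bits l' ≤ S) (hW : S + 3 ≤ W) : (leastEntry x l).peak inp e ≤ W := by
  refine peak_fold_le ?_ ?_ fun p y hp => ?_
  · simp only [Tm.peak, hl]; omega
  · simp only [Tm.peak, hx]; omega
  · simp only [Tm.eval, hl] at hp
    obtain ⟨h1, h2, -⟩ := bits_of_prefix hp
    have hev := leastEntry_eval inp (x0 : Var (EntryTy :: .list EntryTy :: Γ) EntryTy) x1 (x', p, e)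
    subst hx
    generalize hA : List.foldl _ _ p = A
    obtain rfl : A = leastVal (x.get e) p := hA.symm.trans hev
    clear hA
    have hmem := (leastVal_spec (x.get e) p).1
    have ha : EntryTy.bits (leastVal (x.get e) p) ≤ W := by
      rcases List.mem_cons.1 hmem with h | h
      · rw [h]; omega
      · have := bits_le_of_mem (τ := EntryTy) h
        omega
    have hy : EntryTy.bits y ≤ W := by omega
    exact peak_ite_le (peak_op_le (bits_bool_le (by omega)) hy ha) hy ha

theorem bits_removeVal_le (i : ℕ) (l : List Entry) :
    (Ty.list EntryTy).bits (removeVal i l) ≤ (Ty.list EntryTy).bits l := by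
  rw [removeVal_eq]
  have h1 := bits_reverse (τ := EntryTy) (l.filter fun y => y.1 ≠ i)
  have h2 := bits_list_le_of_sublist (τ := EntryTy) (List.filter_sublist (l := l)
    (p := fun y => y.1 ≠ i))
  exact (le_of_eq h1).trans h2

theorem peak_removeEntry_le {x : Var Γ EntryTy} {l : Var Γ (.list EntryTy)} {x' : Entry}
    {l' : List Entry} (hx : x.get e = x') (hl : l.get e = l') (hxS : EntryTy.bits x' ≤ S)
    (hlS : (Ty.list EntryTy).bits l' ≤ S) (hW : 2 * S + 3 ≤ W) :
    (removeEntry x l).peak inp e ≤ W := by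
  refine peak_fold_le ?_ (peak_nil_le (by omega)) fun p y hp => ?_
  · simp only [Tm.peak, hl]; omega
  · simp only [Tm.eval, hl] at hp
    obtain ⟨h1, h2, -⟩ := bits_of_prefix hp
    have hev :=
      removeEntry_eval inp (x0 : Var (EntryTy :: .list EntryTy :: Γ) EntryTy) x1 (x', p, e)
    subst hx
    generalize hA : List.foldl _ _ p = A
    obtain rfl : A = removeVal (x.get e).1 p := hA.symm.trans hev
    clear hA
    have ha := (bits_removeVal_le (x.get e).1 p).trans h1
    have ha' : (Ty.list EntryTy).bits (removeVal (x.get e).1 p) ≤ W := by omega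
    have hy : EntryTy.bits y ≤ W := by omega
    refine peak_ite_le (peak_op_le (bits_bool_le (by omega)) hy ?_) ha' (peak_cons_le ?_ hy ha')
    · exact hxS.trans (by omega)
    · exact (Nat.add_le_add (Nat.add_le_add_left h2 1) ha).trans (by omega)

theorem bits_evictVal_le (l : List Entry) :
    (Ty.list EntryTy).bits (evictVal l) ≤ (Ty.list EntryTy).bits l := by
  cases l with
  | nil => exact le_rfl
  | cons x l => exact bits_removeVal_le _ _

theorem peak_evict_le {l : Var Γ (.list EntryTy)} {l' : List Entry} (hl : l.get e = l')
    (hlS : (Ty.list EntryTy).bits l' ≤ S) (hW : 2 * S + 3 ≤ W) : (evict l).peak inp e ≤ W := by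
  simp only [evict, Tm.peak, Tm.eval, hl]
  cases l' with
  | nil =>
    refine max_le (by omega) ?_
    change (Ty.list EntryTy).bits [] ≤ W
    rw [bits_nil]
    omega
  | cons x xs =>
    have h1 := bits_cons (τ := EntryTy) x xs
    rw [h1] at hlS
    refine max_le (by rw [h1]; omega) (max_le ?_ ?_)
    · exact peak_leastEntry_le (x' := x) (l' := xs) (S := S) rfl rfl (by omega) (by omega)
        (by omega)
    · rw [leastEntry_eval]
      refine peak_removeEntry_le (x' := leastVal x xs) (l' := x :: xs) (S := S) rfl (by exact hl) ?_
        (by rw [h1]; exact hlS) hW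
      have h2 := bits_le_of_mem (τ := EntryTy) (leastVal_spec x xs).1
      rw [h1] at h2
      exact h2.trans hlS

theorem bits_trimVal_le (l : List Entry) (K : ℕ) :
    (Ty.list EntryTy).bits (trimVal l K) ≤ (Ty.list EntryTy).bits l := by
  unfold trimVal
  split_ifs
  exacts [bits_evictVal_le l, le_rfl]

theorem peak_length_le {l : Var Γ (.list EntryTy)} {l' : List Entry} (hl : l.get e = l')
    (hlX : l'.length + 1 ≤ X) (hW : (Ty.list EntryTy).bits l' + Ty.nat.bits X ≤ W) :
    (Tm.fold (.var l) (.lit 0) (.op .add v1 (.lit 1)) : Tm Γ .nat).peak inp e ≤ W := by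
  have hbW : ∀ {y : ℕ}, y ≤ X → Ty.nat.bits y ≤ W := fun hy => (bits_nat_mono hy).trans (by omega)
  refine peak_fold_le ?_ (hbW (Nat.zero_le X)) fun p y hp => ?_
  · simp only [Tm.peak, hl]; omega
  · simp only [Tm.eval, hl] at hp
    obtain ⟨-, h2, h3⟩ := bits_of_prefix hp
    have h0 := foldl_length p 0
    simp only [Tm.eval, Op.eval, Var.get]
    rw [h0, zero_add]
    exact peak_op_le (hbW (by omega : p.length + 1 ≤ X))
      (hbW (by omega : p.length ≤ X)) (hbW (by omega : 1 ≤ X))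

theorem peak_trim_le {l : Var Γ (.list EntryTy)} {K : Var Γ .nat} {l' : List Entry} {K' : ℕ}
    (hl : l.get e = l') (hK : K.get e = K') (hKX : K' ≤ X) (hlX : l'.length + 1 ≤ X)
    (hlS : (Ty.list EntryTy).bits l' ≤ S) (hW : 2 * S + Ty.nat.bits X ≤ W) :
    (trim l K).peak inp e ≤ W := by
  have h3 := three_le_bits (X := X) (by omega)
  refine peak_ite_le (peak_op_le (bits_bool_le (by omega)) ?_ (peak_length_le hl hlX (by omega)))
    (peak_evict_le hl hlS (by omega)) ?_
  · simp only [Tm.peak, hK]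
    exact (bits_nat_mono hKX).trans (by omega)
  · simp only [Tm.peak, hl]
    omega

theorem peak_member_le {x : Var Γ .nat} {l : Var Γ (.list .nat)} {x' : ℕ} {l' : List ℕ}
    (hx : x.get e = x') (hl : l.get e = l') (hxX : x' ≤ X) (hX : 1 ≤ X)
    (hW : (Ty.list .nat).bits l' + Ty.nat.bits X ≤ W) : (member x l).peak inp e ≤ W := by
  have h3 := three_le_bits hX
  have hbW : ∀ {y : ℕ}, y ≤ X → Ty.nat.bits y ≤ W := fun hy => (bits_nat_mono hy).trans (by omega)
  refine peak_fold_le ?_ (hbW (Nat.zero_le X)) fun p y hp => ?_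
  · simp only [Tm.peak, hl]; omega
  · simp only [Tm.eval, hl] at hp
    obtain ⟨-, h2, -⟩ := bits_of_prefix hp
    have hev := foldl_mem p x'
    simp only [Tm.eval, Op.eval, Var.get, hx]
    rw [hev]
    refine peak_ite_le (peak_op_le (bits_bool_le (by omega)) (h2.trans (by omega)) (hbW ?_))
      (hbW hX) (bits_bool_le (by omega))
    simp only [Var.get, hx]
    exact hxX

theorem occurrences_le (l : List Entry) (x : ℕ) : occurrences l x ≤ l.length := by
  unfold occurrences
  refine (List.sum_le_card_nsmul _ 1 fun y hy => ?_).trans (by simp)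
  obtain ⟨z, -, rfl⟩ := List.mem_map.1 hy
  split_ifs <;> omega

theorem estimateVal_le (l : List Entry) (s : List ℕ) (q T M j : ℕ) :
    estimateVal l s q T M j ≤ j :=
  sum_range_le_of_le_one (fun x => by split_ifs <;> omega) j

theorem peak_estimate_le {l : Var Γ (.list EntryTy)} {n : Var Γ .nat} {s : Var Γ (.list .nat)}
    {q T M : Var Γ .nat} {n' q' T' M' : ℕ} {s' : List ℕ} {l' : List Entry}
    (hX : SamplingBound n' q' T' X) (hl : l.get e = l') (hn : n.get e = n')
    (hs : s.get e = s') (hq : q.get e = q') (hT : T.get e = T') (hM : M.get e = M')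
    (hMn : M' ≤ n') (hsq : ∀ c ∈ s', c ≤ q') (hlX : l'.length + 1 ≤ X)
    (hlS : (Ty.list EntryTy).bits l' ≤ S)
    (hW : (Ty.list .nat).bits s' + 2 * Ty.nat.bits X + S ≤ W) :
    (estimate l n s q T M).peak inp e ≤ W := by
  have hb : ∀ {y : ℕ}, y ≤ X → Ty.nat.bits y ≤ Ty.nat.bits X := bits_nat_mono
  have hbW : ∀ {y : ℕ}, y ≤ X → Ty.nat.bits y ≤ W := fun hy => (hb hy).trans (by omega)
  have h3 := three_le_bits (X := X) (by have := hX.two_le; omega)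
  have hnX := hX.add_one_le
  refine forN_peak_le (R := n') hn (hbW ?_) (hbW (Nat.zero_le X)) (fun j hj => ?_) fun j hj => ?_
  · rw [hn]; omega
  · rw [estimate_forAcc]
    have h7 := hb (max_le (by omega : j ≤ X) (by omega : 1 ≤ X))
    have h5 := hb ((estimateVal_le (l.get e) (s.get e) (q.get e) (T.get e) (M.get e) j).trans
      (by omega : j ≤ X))
    exact (Nat.add_le_add h7 h5).trans (by omega)
  · rw [estimate_forAcc]
    have h5 := estimateVal_le (l.get e) (s.get e) (q.get e) (T.get e) (M.get e) j
    generalize estimateVal (l.get e) (s.get e) (q.get e) (T.get e) (M.get e) j = z at h5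
    have hlW : Ty.nat.bits z ≤ W := hbW (by omega)
    refine peak_ite_le ?_ (peak_op_le (hbW ?_) hlW (peak_op_le (bits_bool_le (by omega))
      (hbW (by omega : 1 ≤ X)) (peak_fold_le ?_ (hbW (Nat.zero_le X)) fun p y hp => ?_))) hlW
    · exact peak_sampled_le (n := n') (x' := j) hX rfl (by exact hs) (by exact hq) (by exact hT)
        (by exact hM) hj.le hMn hsq (by omega)
    · have : ∀ (P : Prop) [Decidable P], z + (if P then 1 else 0) ≤ X := fun P _ => by
        split_ifs <;> omega
      exact this _
    · simp only [Tm.peak, Var.get, hl]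
      omega
    · simp only [Tm.eval, Var.get, hl] at hp
      obtain ⟨h6, h8, h9⟩ := bits_of_prefix hp
      have hocc := estimate_fold inp p e j z (j, z)
      have ho := occurrences_le p j
      have hy : EntryTy.bits y ≤ W := by omega
      simp only [Tm.eval, member_eval, Op.eval, Var.get] at hocc ⊢
      rw [hocc]
      refine peak_bind_le hy (peak_op_le (hbW ?_) (hbW (by omega : occurrences p j ≤ X)) ?_)
      · have h10 := member_eval inp (x3 : Var (.list .nat :: EntryTy :: .nat :: .nat :: .nat ::
          .prod .nat .nat :: Γ) .nat) x0 (y.2.2, y, occurrences p j, j, z, (j, z), e)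
        simp only [Tm.eval, Op.eval, Var.get] at h10 ⊢
        rw [h10]
        have : ∀ (P : Prop) [Decidable P], occurrences p j + (if P then 1 else 0) ≤ X :=
          fun P _ => by split_ifs <;> omega
        exact this _
      · refine peak_member_le (x' := j) (l' := y.2.2) (X := X) rfl rfl (by omega) (by omega) ?_
        have h11 := bits_snd_le (σ := .nat) (τ := .prod .nat (.list .nat)) y
        have h12 := bits_snd_le (σ := .nat) (τ := .list .nat) y.2
        have h13 := (h12.trans h11).trans h8
        exact (Nat.add_le_add_right h13 _).trans (by omega)

theorem bits_picked_le (l : List Entry) (c : ℕ) :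
    (Ty.list EntryTy).bits (picked l c) ≤ (Ty.list EntryTy).bits l :=
  bits_list_le_of_sublist (picked_sublist l c)

theorem peak_select_le {l : Var Γ (.list EntryTy)} {c : Var Γ .nat} {l' : List Entry} {c' C : ℕ}
    (hl : l.get e = l') (hc : c.get e = c') (hlX : l'.length + 2 ≤ X)
    (hlS : (Ty.list EntryTy).bits l' ≤ S) (hcC : Ty.nat.bits c' ≤ C)
    (hW : C + 2 * Ty.nat.bits X + 2 * S ≤ W) : (select l c).peak inp e ≤ W := by
  have hb : ∀ {y : ℕ}, y ≤ X → Ty.nat.bits y ≤ Ty.nat.bits X := bits_nat_mono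
  have hbW : ∀ {y : ℕ}, y ≤ X → Ty.nat.bits y ≤ W := fun hy => (hb hy).trans (by omega)
  have h3 := three_le_bits (X := X) (by omega)
  have h0 := hb (Nat.zero_le X)
  have hS1 := one_le_bits_list (τ := EntryTy) l'
  refine peak_fold_le ?_ (peak_pair_le ?_ ?_ (peak_pair_le ?_ (hbW (Nat.zero_le X))
    (peak_nil_le (by omega)))) fun p y hp => ?_
  · simp only [Tm.peak, hl]; omega
  · simp only [Tm.eval, hc]
    exact (Nat.add_le_add hcC (Nat.add_le_add h0 (le_of_eq bits_nil))).trans (by omega)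
  · simp only [Tm.peak, hc]; omega
  · exact (Nat.add_le_add h0 (le_of_eq bits_nil)).trans (by omega)
  · simp only [Tm.eval, hl] at hp
    obtain ⟨h4, h5, h6⟩ := bits_of_prefix hp
    have hev :=
      select_eval inp (x1 : Var (.nat :: .list EntryTy :: Γ) (.list EntryTy)) x0 (c', p, e)
    subst hc
    generalize hA : List.foldl _ _ p = A
    obtain rfl : A = (c.get e / 2 ^ p.length, (picked p (c.get e)).length,
      (picked p (c.get e)).reverse) := hA.symm.trans hev
    clear hA hev
    set c' := c.get e
    have h7 : c' / 2 ^ p.length ≤ c' := Nat.div_le_self _ _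
    have h8 : (picked p c').length ≤ p.length := (picked_sublist p c').length_le
    have h9 : (Ty.list EntryTy).bits (picked p c').reverse ≤ S := by
      have h10 := bits_reverse (τ := EntryTy) (picked p c')
      exact (le_of_eq h10).trans ((bits_picked_le p c').trans (h4.trans hlS))
    generalize c' / 2 ^ p.length = u at h7
    generalize (picked p c').length = w at h8
    generalize (picked p c').reverse = L at h9
    have hu := (bits_nat_mono h7).trans hcC
    have hw1 := hb (by omega : w + 1 ≤ X)
    have hw := hb (by omega : w ≤ X)
    have hst : (Ty.prod .nat (.prod .nat (.list EntryTy))).bits (u, w, L) ≤ W :=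
      (Nat.add_le_add hu (Nat.add_le_add hw h9)).trans (by omega)
    have hu2 : Ty.nat.bits (u / 2) ≤ C := (bits_nat_mono (Nat.div_le_self u 2)).trans hu
    have hum : Ty.nat.bits (u % 2) ≤ C := (bits_nat_mono (Nat.mod_le u 2)).trans hu
    have h2W : Ty.nat.bits 2 ≤ W := hbW (by omega)
    have hy : EntryTy.bits y ≤ W := by omega
    have hc1 := bits_cons (τ := EntryTy) y L
    have hres : ∀ (P : Prop) [Decidable P], (Ty.prod .nat (.list EntryTy)).bits
        (if P then (w + 1, y :: L) else (w, L)) ≤ Ty.nat.bits X + 1 + 2 * S := fun P _ => by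
      split_ifs
      · exact (Nat.add_le_add hw1 (le_of_eq hc1)).trans (by omega)
      · exact (Nat.add_le_add hw h9).trans (by omega)
    refine peak_pair_le ?_ (peak_op_le (hu2.trans (by omega)) hst h2W) (peak_ite_le
      (peak_op_le (hum.trans (by omega)) hst h2W) (peak_pair_le ?_ (peak_op_le ?_ hst
      (hbW (by omega : 1 ≤ X))) (peak_cons_le ?_ hy hst)) hst)
    · exact (Nat.add_le_add hu2 (hres _)).trans (by omega)
    · exact (Nat.add_le_add hw1 (le_of_eq hc1)).trans (by omega)
    · exact hw1.trans (by omega)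
    · exact (Nat.add_le_add (Nat.add_le_add_left h5 1) h9).trans (by omega)

theorem peak_idList_le {l : Var Γ (.list EntryTy)} {l' : List Entry} (hl : l.get e = l')
    (hlS : (Ty.list EntryTy).bits l' ≤ S) (hW : 2 * S + 1 ≤ W) : (idList l).peak inp e ≤ W := by
  have hS1 := one_le_bits_list (τ := EntryTy) l'
  refine peak_fold_le ?_ (peak_nil_le (by omega)) fun p y hp => ?_
  · simp only [Tm.peak, hl]; omega
  · simp only [Tm.eval, hl] at hp
    obtain ⟨h4, h5, h6⟩ := bits_of_prefix hp
    have hev := idList_eval inp (x0 : Var (.list EntryTy :: Γ) (.list EntryTy)) (p, e)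
    simp only [idList, Tm.eval, Var.get] at hev
    simp only [Tm.eval, Var.get]
    rw [hev]
    have h7 := bits_reverse (τ := .nat) (p.map Prod.fst)
    have h8 := (le_of_eq h7).trans ((bits_map_fst_le p).trans (h4.trans hlS))
    have h9 := bits_fst_le (σ := .nat) (τ := .prod .nat (.list .nat)) y
    refine peak_cons_le ?_ (h5.trans (by omega)) (h8.trans (by omega))
    exact (Nat.add_le_add (Nat.add_le_add_left (h9.trans h5) 1) h8).trans (by omega)

theorem peak_twoPowLength_le {l : Var Γ (.list EntryTy)} {l' : List Entry} (hl : l.get e = l')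
    (hlX : l'.length + 1 ≤ X)
    (hW : (Ty.list EntryTy).bits l' + Ty.nat.bits (2 ^ l'.length) + Ty.nat.bits X ≤ W) :
    (twoPowLength l).peak inp e ≤ W := by
  have h1 := bits_nat_mono (Nat.one_le_two_pow (n := l'.length))
  refine peak_loop_le (peak_length_le hl hlX (by omega)) (h1.trans (by omega)) fun j hj => ?_
  have h0 := foldl_length l' 0
  rw [zero_add] at h0
  have hj' : j < l'.length := by
    simp only [Tm.eval, Op.eval, Var.get, hl] at hj
    rw [h0] at hj
    exact hj
  have h2 := double_iterate inp e j
  simp only [Tm.eval, Op.eval, Var.get] at h2 ⊢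
  rw [h2]
  have h3 : ∀ {y : ℕ}, y ≤ 2 ^ l'.length → Ty.nat.bits y ≤ W := fun hy =>
    (bits_nat_mono hy).trans (by omega)
  have h4 : 2 ^ (j + 1) ≤ 2 ^ l'.length := Nat.pow_le_pow_right (by norm_num) hj'
  rw [pow_succ] at h4
  have h5 : 2 ^ j + 2 ^ j ≤ 2 ^ l'.length := by omega
  have h6 : 2 ^ j ≤ 2 ^ l'.length := by omega
  exact peak_op_le (h3 h5) (h3 h6) (h3 h6)

theorem bits_searchVal_le (l : List Entry) (n k : ℕ) (s : List ℕ) (q T M j : ℕ) :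
    (searchVal l n k s q T M j).1 ≤ n ∧
      (Ty.list .nat).bits (searchVal l n k s q T M j).2 ≤ (Ty.list EntryTy).bits l := by
  rcases (searchVal_spec l n k s q T M j).1 with h | ⟨c, -, h⟩
  · rw [h]
    exact ⟨Nat.zero_le _, (le_of_eq bits_nil).trans (one_le_bits_list (τ := EntryTy) l)⟩
  · rw [h]
    exact ⟨estimateVal_le _ _ _ _ _ _, (bits_map_fst_le _).trans (bits_picked_le l c)⟩

theorem peak_search_le {l : Var Γ (.list EntryTy)} {n k : Var Γ .nat} {s : Var Γ (.list .nat)}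
    {q T M : Var Γ .nat} {n' k' q' T' M' : ℕ} {s' : List ℕ} {l' : List Entry}
    (hX : SamplingBound n' q' T' X) (hl : l.get e = l') (hn : n.get e = n') (hk : k.get e = k')
    (hs : s.get e = s') (hq : q.get e = q') (hT : T.get e = T') (hM : M.get e = M')
    (hMn : M' ≤ n') (hkX : k' ≤ X) (hsq : ∀ c ∈ s', c ≤ q') (hlX : l'.length + 2 ≤ X)
    (hlS : (Ty.list EntryTy).bits l' ≤ S)
    (hW : (Ty.list .nat).bits s' + Ty.nat.bits (2 ^ l'.length) + 2 * Ty.nat.bits X + 2 * S ≤ W) :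
    (search l n k s q T M).peak inp e ≤ W := by
  have hb : ∀ {y : ℕ}, y ≤ X → Ty.nat.bits y ≤ Ty.nat.bits X := bits_nat_mono
  have hbW : ∀ {y : ℕ}, y ≤ X → Ty.nat.bits y ≤ W := fun hy => (hb hy).trans (by omega)
  have h3 := three_le_bits (X := X) (by omega)
  have hnX := hX.add_one_le
  have hS1 := one_le_bits_list (τ := EntryTy) l'
  have hev : (twoPowLength l).eval inp e = 2 ^ l'.length := by rw [twoPowLength_eval, hl]
  have h0 := hb (Nat.zero_le X)
  refine forN_peak_le hev (peak_twoPowLength_le (X := X) hl (by omega) (by omega)) (peak_pair_le ?_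
    (hbW (Nat.zero_le X)) (peak_nil_le (by omega))) (fun j hj => ?_) fun j hj => ?_
  · exact (Nat.add_le_add h0 (le_of_eq bits_nil)).trans (by omega)
  · rw [search_forAcc, hl, hn]
    obtain ⟨h1, h2⟩ := bits_searchVal_le l' n' (k.get e) (s.get e) (q.get e) (T.get e) (M.get e) j
    have h4 := bits_nat_mono (max_le hj Nat.one_le_two_pow)
    have h5 := hb (h1.trans (by omega))
    exact (Nat.add_le_add h4 (Nat.add_le_add h5 (h2.trans hlS))).trans (by omega)
  · rw [search_forAcc, hl, hn]
    obtain ⟨h1, h2⟩ := bits_searchVal_le l' n' (k.get e) (s.get e) (q.get e) (T.get e) (M.get e) j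
    generalize searchVal l' n' (k.get e) (s.get e) (q.get e) (T.get e) (M.get e) j = b at h1 h2
    have hjb := bits_nat_mono hj.le
    have h5 := hb (h1.trans (by omega))
    have hbb : (Ty.prod .nat (.list .nat)).bits b ≤ W :=
      (Nat.add_le_add h5 (h2.trans hlS)).trans (by omega)
    refine peak_bind_le ?_ ?_
    · exact peak_select_le (l' := l') (c' := j) (C := Ty.nat.bits (2 ^ l'.length)) (X := X) (S := S)
        (by exact hl) rfl hlX hlS hjb (by omega)
    rw [select_eval]
    simp only [Var.get, hl]
    have h7 : j / 2 ^ l'.length ≤ j := Nat.div_le_self _ _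
    have h8 : (picked l' j).length ≤ l'.length := (picked_sublist l' j).length_le
    have h9 : (Ty.list EntryTy).bits (picked l' j).reverse ≤ S := by
      have h10 := bits_reverse (τ := EntryTy) (picked l' j)
      exact (le_of_eq h10).trans ((bits_picked_le l' j).trans hlS)
    have h11 : (picked l' j).reverse.length + 1 ≤ X := by
      rw [List.length_reverse]
      omega
    generalize j / 2 ^ l'.length = u at h7
    generalize (picked l' j).length = w at h8
    generalize (picked l' j).reverse = L at h9 h11
    have hu := (bits_nat_mono h7).trans hjb
    have hw := hb (by omega : w ≤ X)
    have hst : (Ty.prod .nat (.prod .nat (.list EntryTy))).bits (u, w, L) ≤ W :=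
      (Nat.add_le_add hu (Nat.add_le_add hw h9)).trans (by omega)
    refine peak_bind_le hst (peak_ite_le (peak_op_le (bits_bool_le (by omega)) ?_ hst) hbb
      (peak_bind_le ?_ ?_))
    · simp only [Tm.peak, Var.get, hk]
      exact hbW hkX
    · exact peak_estimate_le (l' := L) (n' := n') (X := X) (S := S) hX rfl (by exact hn)
        (by exact hs) (by exact hq) (by exact hT) (by exact hM) hMn hsq h11 h9 (by omega)
    · rw [estimate_eval]
      simp only [Tm.eval, Var.get, hn]
      have h12 := estimateVal_le L (s.get e) (q.get e) (T.get e) (M.get e) n'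
      generalize estimateVal L (s.get e) (q.get e) (T.get e) (M.get e) n' = v at h12
      have hv := hb (by omega : v ≤ X)
      have hvW : Ty.nat.bits v ≤ W := by omega
      refine peak_ite_le (peak_op_le (bits_bool_le (by omega)) hbb hvW) (peak_pair_le ?_ hvW
        (peak_idList_le (l' := L) (S := S) rfl h9 (by omega))) hbb
      rw [idList_eval]
      simp only [Tm.eval, Var.get]
      have h13 := bits_reverse (τ := .nat) (L.map Prod.fst)
      have h14 := (le_of_eq h13).trans ((bits_map_fst_le L).trans h9)
      exact (Nat.add_le_add hv h14).trans (by omega)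

end

end Machine

namespace Machine

open Finset Hashing

/-! ### Space of the streaming algorithm -/

section

variable {inp : ℕ → ℕ} {W X S : ℕ} {s : List ℕ} {q T M : ℕ} {E : List Entry} {n m k r f d : ℕ}

theorem peak_start_le {a : ℕ} (hn0 : n ≠ 0) (hn : 2 * n + 2 ≤ X)
    (hX : 2 * (2 * k + (a + 3)) * (m + 2) ≤ X) (h576 : 576 ≤ X) (hd : d * d ≤ X)
    (hT : thresholdVal a m k d ≤ X) (hW : (Ty.list .nat).bits s + 4 * Ty.nat.bits X + 1 ≤ W) :
    (streamAlg a).start.peak inp (s, n, m, k, r, f, d, ()) ≤ W := by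
  have hb : ∀ {y : ℕ}, y ≤ X → Ty.nat.bits y ≤ Ty.nat.bits X := bits_nat_mono
  have h1 : (nextPrime x1 : Tm (.list .nat :: Params) .nat).eval inp
      (s, n, m, k, r, f, d, ()) ≤ X := by
    have hev :=
      nextPrime_eval inp (x1 : Var (.list .nat :: Params) .nat) (s, n, m, k, r, f, d, ()) hn0
    rw [hev]
    exact (primeAbove_le hn0).trans (by omega)
  have h2 : (threshold a x2 x3 x1.up5 : Tm (.list .nat :: Params) .nat).eval inp
      (s, n, m, k, r, f, d, ()) ≤ X := by
    rw [threshold_eval]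
    exact hT
  have h1 := hb h1
  have h2 := hb h2
  have h0 := hb (Nat.zero_le X)
  have h3 : Ty.nat.bits 0 + (Ty.list EntryTy).bits [] ≤ Ty.nat.bits X + 1 :=
    Nat.add_le_add h0 (le_of_eq bits_nil)
  refine peak_pair_le ?_ ?_ (peak_pair_le ?_ (peak_nextPrime_le rfl hn0 hn (by omega))
    (peak_pair_le ?_ (peak_threshold_le rfl rfl rfl hX h576 hd hT (by omega))
    (peak_pair_le ?_ (h0.trans (by omega)) (peak_nil_le (by omega)))))
  · exact (Nat.add_le_add (le_refl ((Ty.list .nat).bits s))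
      (Nat.add_le_add h1 (Nat.add_le_add h2 h3))).trans (by omega)
  · exact (by omega : (Ty.list .nat).bits s ≤ W)
  · exact (Nat.add_le_add h1 (Nat.add_le_add h2 h3)).trans (by omega)
  · exact (Nat.add_le_add h2 h3).trans (by omega)
  · exact h3.trans (by omega)

theorem bits_memory_le (hX : SamplingBound n q T X) (hMn : M ≤ n)
    (hE : (Ty.list EntryTy).bits E ≤ S) :
    MemTy.bits (s, q, T, M, E) ≤ (Ty.list .nat).bits s + 3 * Ty.nat.bits X + S := by
  obtain ⟨h1, h2, h3, h4, h5, h6⟩ := hX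
  have hq := bits_nat_mono (by omega : q ≤ X)
  have hT := bits_nat_mono (by omega : T ≤ X)
  have hM := bits_nat_mono (by omega : M ≤ X)
  exact (Nat.add_le_add (le_refl ((Ty.list .nat).bits s)) (Nat.add_le_add hq (Nat.add_le_add hT
    (Nat.add_le_add hM hE)))).trans (by omega)

theorem peak_store_le {j z : ℕ} (hX : SamplingBound n q T X) (hMn : M ≤ n) (hz : z ≤ n)
    (hinp : ∀ x, inp x ≤ 1) (hsq : ∀ c ∈ s, c ≤ q) (hj : j ≤ X) (hEX : E.length + 2 ≤ X)
    (hcap : k + r + k * r + ((f + 1) * d + f + 1 + d) + capacityVal k r f d + 2 ≤ X)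
    (hS : (4 * T * (Ty.nat.bits n + 1) + 1) + (Ty.list EntryTy).bits E + 2 * Ty.nat.bits X + 1 ≤ S)
    {mem : MemTy.Val} (hE : mem.2.2.2.2 = E) (hmem : MemTy.bits mem ≤ W)
    (hW : (Ty.list .nat).bits s + 4 * Ty.nat.bits X + 2 * S ≤ W) :
    store.peak inp (M, z, T, q, s, j, mem, n, m, k, r, f, d, ()) ≤ W ∧
    (Ty.list EntryTy).bits (store.eval inp (M, z, T, q, s, j, mem, n, m, k, r, f, d, ())) ≤ S := by
  have h3 := three_le_bits (X := X) (by have := hX.two_le; omega)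
  have hn1 := hX.add_one_le
  have hzX := bits_nat_mono (by omega : z ≤ X)
  have hjX := bits_nat_mono hj
  obtain ⟨e1, e2, -, e3, -⟩ := collectVal_spec inp s q T M n
  have hcev : (collect x2.up5 x4 x3 x2 x0 : Tm (.nat :: .nat :: .nat :: .nat :: .list .nat ::
      .nat :: MemTy :: Params) _).eval inp (M, z, T, q, s, j, mem, n, m, k, r, f, d, ()) =
      collectVal inp s q T M n := by
    rw [collect_eval]
    rfl
  have hels : (Ty.list .nat).bits (collectVal inp s q T M n).2 ≤
      4 * T * (Ty.nat.bits n + 1) + 1 := by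
    refine (bits_list_le (τ := .nat) (b := Ty.nat.bits n) fun x hx =>
      bits_nat_mono (e3 x hx).1.le).trans ?_
    rw [← e1]
    exact Nat.add_le_add_right (Nat.mul_le_mul_right _ e2) 1
  have hcol : (collect x2.up5 x4 x3 x2 x0 : Tm (.nat :: .nat :: .nat :: .nat :: .list .nat ::
      .nat :: MemTy :: Params) _).peak inp
        (M, z, T, q, s, j, mem, n, m, k, r, f, d, ()) ≤ W :=
    peak_collect_le (n' := n) (q' := q) (T' := T) (M' := M) (s' := s) (X := X) (S := S) hX rfl rfl
      rfl rfl rfl hMn hinp hsq (by omega) (by omega)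
  generalize collectVal inp s q T M n = y at hcev hels
  obtain ⟨y1, y2⟩ := y
  change (Ty.list .nat).bits y2 ≤ _ at hels
  have hentry : EntryTy.bits (j, z, y2) ≤
      2 * Ty.nat.bits X + (4 * T * (Ty.nat.bits n + 1) + 1) :=
    (Nat.add_le_add hjX (Nat.add_le_add hzX hels)).trans (by omega)
  have hE' : (Ty.list EntryTy).bits ((j, z, y2) :: E) ≤ S := by
    have h := bits_cons (τ := EntryTy) (j, z, y2) E
    exact (le_of_eq h).trans (by omega)
  constructor
  · refine peak_bind_le (peak_cons_le ?_ (peak_pair_le ?_ (hjX.trans (by omega)) (peak_pair_le ?_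
      (hzX.trans (by omega)) hcol)) hmem) (peak_bind_le ?_ ?_)
    · simp only [Tm.eval, Var.get]
      rw [hcev, hE]
      exact (Nat.add_le_add_right (Nat.add_le_add_left hentry 1)
        ((Ty.list EntryTy).bits E)).trans (by omega)
    · simp only [Tm.eval, Var.get]
      rw [hcev]
      exact hentry.trans (by omega)
    · simp only [Tm.eval, Var.get]
      rw [hcev]
      exact (Nat.add_le_add hzX hels).trans (by omega)
    · exact peak_capacity_le (k' := k) (r' := r) (f' := f) (d' := d) (X := X) rfl rfl rfl rfl hcap
        (by omega)
    · rw [capacity_eval]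
      simp only [Tm.eval, Var.get]
      rw [hcev, hE]
      refine peak_trim_le (l' := (j, z, y2) :: E)
        (K' := capacityVal k r f d) (X := X) (S := S) rfl rfl (by omega) ?_ hE' (by omega)
      rw [List.length_cons]
      omega
  · simp only [store, Tm.eval, trim_eval, capacity_eval, Var.get]
    rw [hcev, hE]
    exact (bits_trimVal_le _ _).trans hE'

theorem peak_memory_le {Γ : List Ty} {e : Env Γ} (hX : SamplingBound n q T X) (hMn : M ≤ n)
    {vs : Var Γ (.list .nat)} {vq vT vM : Var Γ .nat} {t : Tm Γ (.list EntryTy)}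
    (hs : vs.get e = s) (hq : vq.get e = q) (hT : vT.get e = T) (hM : vM.get e = M)
    (ht : t.peak inp e ≤ W) (hS : (Ty.list EntryTy).bits (t.eval inp e) ≤ S)
    (hW : (Ty.list .nat).bits s + 4 * Ty.nat.bits X + 2 * S ≤ W) :
    (Tm.pair (.var vs) (.pair (.var vq) (.pair (.var vT) (.pair (.var vM) t)))).peak inp e ≤ W := by
  obtain ⟨h1, h2, h3, h4, h5, h6⟩ := hX
  have hq1 := bits_nat_mono (by omega : q ≤ X)
  have hT1 := bits_nat_mono (by omega : T ≤ X)
  have hM1 := bits_nat_mono (by omega : M ≤ X)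
  subst hs hq hT hM
  refine peak_pair_le ?_ ?_ (peak_pair_le ?_ (hq1.trans (by omega)) (peak_pair_le ?_
    (hT1.trans (by omega)) (peak_pair_le ?_ (hM1.trans (by omega)) ht)))
  · exact (Nat.add_le_add (le_refl ((Ty.list .nat).bits (vs.get e))) (Nat.add_le_add hq1
      (Nat.add_le_add hT1 (Nat.add_le_add hM1 hS)))).trans (by omega)
  · exact (by omega : (Ty.list .nat).bits (vs.get e) ≤ W)
  · exact (Nat.add_le_add hq1 (Nat.add_le_add hT1 (Nat.add_le_add hM1 hS))).trans (by omega)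
  · exact (Nat.add_le_add hT1 (Nat.add_le_add hM1 hS)).trans (by omega)
  · exact (Nat.add_le_add hM1 hS).trans (by omega)

theorem peak_streamStep_le {j : ℕ} (hX : SamplingBound n q T X) (hMn : M ≤ n)
    (hinp : ∀ x, inp x ≤ 1) (hsq : ∀ c ∈ s, c ≤ q) (hj : j ≤ X) (hEX : E.length + 2 ≤ X)
    (hcap : k + r + k * r + ((f + 1) * d + f + 1 + d) + capacityVal k r f d + 2 ≤ X)
    (hS : (4 * T * (Ty.nat.bits n + 1) + 1) + (Ty.list EntryTy).bits E + 2 * Ty.nat.bits X + 1 ≤ S)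
    (hW : (Ty.list .nat).bits s + 4 * Ty.nat.bits X + 2 * S ≤ W) :
    streamStep.peak inp (j, (s, q, T, M, E), n, m, k, r, f, d, ()) ≤ W := by
  have hbW : ∀ {y : ℕ}, y ≤ X → Ty.nat.bits y ≤ W := fun hy =>
    (bits_nat_mono hy).trans (by omega)
  have h3 := three_le_bits (X := X) (by have := hX.two_le; omega)
  have hn1 := hX.add_one_le
  have hmem := (bits_memory_le (s := s) hX hMn (by omega : (Ty.list EntryTy).bits E ≤ S)).trans
    (by omega : _ ≤ W)
  refine peak_bind_le hmem (peak_bind_le hmem (peak_bind_le hmem (peak_bind_le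
    (peak_arrivingSize_le (n' := n) rfl hn1 hinp (by omega)) ?_)))
  rw [arrivingSize_eval]
  have hz : ∑ x ∈ range n, inp x ≤ n := sum_range_le_of_le_one hinp n
  simp only [Tm.eval, Var.get]
  generalize (∑ x ∈ range n, inp x) = z at hz
  refine peak_bind_le (peak_bind_le hmem (peak_ite_le (peak_op_le (bits_bool_le (by omega))
    (hbW (by omega : M ≤ X)) (hbW (by omega : z ≤ X))) (hbW (by omega : z ≤ X))
    (hbW (by omega : M ≤ X)))) ?_
  have hmax : (if (if M < z then 1 else 0) ≠ 0 then z else M) = max M z := by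
    split_ifs <;> omega
  generalize hA : Tm.eval inp _ _ = A
  obtain rfl : A = max M z := hA.symm.trans hmax
  clear hA
  have hM' : max M z ≤ n := max_le hMn hz
  obtain ⟨h4, h5⟩ := peak_store_le (m := m) (mem := (s, q, T, M, E)) hX hM' hz hinp hsq hj hEX hcap
    hS rfl hmem hW
  exact peak_memory_le (s := s) (q := q) (T := T) (X := X) hX hM' rfl rfl rfl rfl h4 h5 hW

theorem peak_streamOutput_le (hX : SamplingBound n q T X) (hMn : M ≤ n) (hsq : ∀ c ∈ s, c ≤ q)
    (hkX : k ≤ X) (hEX : E.length + 2 ≤ X) (hS : (Ty.list EntryTy).bits E ≤ S)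
    (hW : (Ty.list .nat).bits s + Ty.nat.bits (2 ^ E.length) + 3 * Ty.nat.bits X + 2 * S ≤ W) :
    streamOutput.peak inp ((s, q, T, M, E), n, m, k, r, f, d, ()) ≤ W := by
  have hmem := (bits_memory_le (s := s) hX hMn hS).trans (by omega : _ ≤ W)
  refine peak_bind_le hmem (peak_bind_le hmem (peak_bind_le hmem (peak_bind_le hmem
    (peak_bind_le hmem ?_))))
  exact peak_search_le (n' := n) (k' := k) (q' := q) (T' := T) (M' := M) (s' := s)
    (l' := E) (X := X)
    (S := S) hX rfl rfl rfl rfl rfl rfl rfl hMn hkX hsq hEX hS (by omega)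

end

end Machine

/-! ### The numbers and values in a run of the streaming algorithm -/

namespace Machine

open Finset Hashing

section

variable {m n k r f d : ℕ} (V : Fin m → Finset (Fin n))

/-- The numbers that occur in a run of the streaming algorithm are at most `X`. -/
structure NumberBound (a m n k r f d X : ℕ) : Prop where
  degree_le : 2 * (2 * k + (a + 3)) * (m + 2) ≤ X
  const_le : 576 ≤ X
  sq_le : d * d ≤ X
  threshold_le : 4 * thresholdVal a m k d + 1 ≤ X
  threshold_mul_le : thresholdVal a m k d * (2 * n) ≤ X
  hash_le : 2 * n * n + 2 * n + 2 ≤ X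
  capacity_le : k + r + k * r + ((f + 1) * d + f + 1 + d) + capacityVal k r f d + 2 ≤ X

/-- A bound for the number of bits of the list of elements of a stored set. -/
def elementsBits (a m n k d : ℕ) : ℕ := 4 * thresholdVal a m k d * (Ty.nat.bits n + 1) + 1

/-- A bound for the number of bits of the stored sets. -/
def entriesBits (a m n k r f d : ℕ) : ℕ :=
  capacityVal k r f d * (Ty.nat.bits m + Ty.nat.bits n + elementsBits a m n k d + 1) + 1

/-- A bound for the number of bits of a random string. -/
def seedBits (a m n k : ℕ) : ℕ := degreeVal a m k * (Ty.nat.bits (2 * n) + 1) + 1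

/-- A bound for the number of bits of each value that occurs in a run. -/
def valueBits (a m n k r f d X : ℕ) : ℕ :=
  seedBits a m n k + Ty.nat.bits (2 ^ capacityVal k r f d) + 12 * Ty.nat.bits X +
    2 * (elementsBits a m n k d + entriesBits a m n k r f d + 2 * Ty.nat.bits X + 1) + 1

variable {a X : ℕ}

theorem NumberBound.samplingBound (h : NumberBound a m n k r f d X) (hn : n ≠ 0) :
    SamplingBound n (primeAbove n) (thresholdVal a m k d) X := by
  have hq := primeAbove_le hn
  have h1 : primeAbove n * n ≤ 2 * n * n := Nat.mul_le_mul_right _ hq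
  have h2 : thresholdVal a m k d * primeAbove n ≤ thresholdVal a m k d * (2 * n) :=
    Nat.mul_le_mul_left _ hq
  obtain ⟨g1, g2, g3, g4, g5, g6, g7⟩ := h
  exact ⟨by omega, (primeAbove_prime n).pos, by omega, by omega, by omega, by omega⟩

/-- The stored sets fit into the memory set aside for them, whatever the random numbers are: longer
lists of sampled elements are cut off. -/
theorem bits_storedAfter_le (s : List ℕ) (q j : ℕ) (hj : j ≤ m) :
    (Ty.list EntryTy).bits (storedAfter V s q (thresholdVal a m k d) (capacityVal k r f d) j) ≤
      entriesBits a m n k r f d ∧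
    (storedAfter V s q (thresholdVal a m k d) (capacityVal k r f d) j).length ≤
      capacityVal k r f d := by
  obtain ⟨I, hI⟩ := exists_isStored V s q (thresholdVal a m k d) (capacityVal k r f d) j
  have hlen : (storedAfter V s q (thresholdVal a m k d) (capacityVal k r f d) j).length ≤
      capacityVal k r f d := by
    rw [hI.eq, List.length_map, hI.length]
    exact min_le_left _ _
  refine ⟨(bits_list_le (τ := EntryTy) fun y hy => ?_).trans
    (Nat.add_le_add_right (Nat.mul_le_mul_right _ hlen) 1), hlen⟩
  rw [hI.eq] at hy
  obtain ⟨i, hi, rfl⟩ := List.mem_map.1 hy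
  have h1 : Ty.nat.bits i ≤ Ty.nat.bits m := bits_nat_mono ((hI.lt i hi).le.trans hj)
  have h2 : Ty.nat.bits (sizeOfId V i) ≤ Ty.nat.bits n := bits_nat_mono (sizeOfId_le V i)
  have h3 : (Ty.list .nat).bits (storedElements V s q (thresholdVal a m k d) i) ≤
      elementsBits a m n k d := by
    obtain ⟨e1, e2, -, e3, -⟩ := collectVal_spec (MUC.incidence V i) s q (thresholdVal a m k d)
      (maxSize V (i + 1)) n
    refine (bits_list_le (τ := .nat) (b := Ty.nat.bits n) fun x hx =>
      bits_nat_mono (e3 x hx).1.le).trans ?_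
    rw [← e1]
    exact Nat.add_le_add_right (Nat.mul_le_mul_right _ e2) 1
  exact (Nat.add_le_add h1 (Nat.add_le_add h2 h3)).trans (by omega)

/-- The number of nodes of the streaming algorithm. -/
def streamNodes (a : ℕ) : ℕ :=
  (streamAlg a).seedLen.nodes + (streamAlg a).seedMod.nodes + (streamAlg a).start.nodes +
    (streamAlg a).step.nodes + (streamAlg a).output.nodes

theorem space_le_of {Γ : List Ty} {τ : Ty} {inp : ℕ → ℕ} {t : Tm Γ τ} {e : Env Γ} {N W : ℕ}
    (he : Env.bits e ≤ W) (hp : t.peak inp e ≤ W) (hN : t.nodes ≤ N) :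
    t.space inp e ≤ (N + 1) * W := by
  have := Nat.mul_le_mul hN hp
  rw [Tm.space, add_mul, one_mul]
  omega

/-- All values in a run have at most `valueBits` bits, and besides the context the space counts one
of them for each node of the programs. -/
theorem streamAlg_space_le (h : NumberBound a m n k r f d X) (hn : n ≠ 0) (hm : m ≤ X)
    (σ : (streamAlg a).Seed (n, m, k, r, f, d, ())) :
    (streamAlg a).space (n, m, k, r, f, d, ()) V σ ≤
      (streamNodes a + 1) * valueBits a m n k r f d X := by
  have hS := h.samplingBound hn
  unfold StreamAlg.space
  obtain ⟨g1, g2, g3, g4, g5, g6, g7⟩ := id h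
  have hmem := streamAlg_memory V a k r f d hn σ
  have hN : (streamAlg a).numSeeds (n, m, k, r, f, d, ()) = degreeVal a m k :=
    degree_eval _ _ _ _ _
  have hR : (streamAlg a).seedRange (n, m, k, r, f, d, ()) = primeAbove n :=
    nextPrime_eval _ _ _ hn
  have hlen : ((streamAlg a).seedList (n, m, k, r, f, d, ()) σ).length = degreeVal a m k := by
    rw [StreamAlg.seedList, List.length_map, List.length_ofFn, hN]
  have hsq : ∀ c ∈ (streamAlg a).seedList (n, m, k, r, f, d, ()) σ, c ≤ primeAbove n := by
    intro c hc
    obtain ⟨y, -, rfl⟩ := List.mem_map.1 hc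
    exact hR ▸ y.2.le
  generalize (streamAlg a).seedList (n, m, k, r, f, d, ()) σ = s at hmem hlen hsq
  have hL : (Ty.list .nat).bits s ≤ seedBits a m n k := by
    rw [seedBits, ← hlen]
    exact bits_list_le (τ := .nat) fun c hc =>
      bits_nat_mono ((hsq c hc).trans (primeAbove_le hn))
  have hM : ∀ j, maxSize V j ≤ n := fun j => maxSize_le V fun i _ => sizeOfId_le V i
  have hinp : ∀ j x, MUC.incidence V j x ≤ 1 := fun j x => incidence_le_one V j x
  have hb : ∀ {y : ℕ}, y ≤ X → Ty.nat.bits y ≤ Ty.nat.bits X := bits_nat_mono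
  have hbn := hb (by omega : n ≤ X)
  have hbm := hb hm
  have hbk := hb (by omega : k ≤ X)
  have hbr := hb (by omega : r ≤ X)
  have hbf := hb (by omega : f ≤ X)
  have hbd := hb (by omega : d ≤ X)
  have henv : Env.bits (Γ := Params) (n, m, k, r, f, d, ()) ≤ 6 * Ty.nat.bits X := by
    simp only [Env.bits]
    omega
  have hmemb : ∀ j ≤ m, MemTy.bits (s, primeAbove n, thresholdVal a m k d, maxSize V j,
      storedAfter V s (primeAbove n) (thresholdVal a m k d) (capacityVal k r f d) j) ≤
      seedBits a m n k + 3 * Ty.nat.bits X + entriesBits a m n k r f d := fun j hj =>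
    (bits_memory_le hS (hM j) (bits_storedAfter_le V s _ j hj).1).trans (by omega)
  have hE : elementsBits a m n k d =
    4 * thresholdVal a m k d * (Ty.nat.bits n + 1) + 1 := rfl
  have hv : valueBits a m n k r f d X = seedBits a m n k +
    Ty.nat.bits (2 ^ capacityVal k r f d) + 12 * Ty.nat.bits X +
    2 * (elementsBits a m n k d + entriesBits a m n k r f d + 2 * Ty.nat.bits X + 1) + 1 := rfl
  generalize valueBits a m n k r f d X = W at hv
  have hnodes : streamNodes a = (streamAlg a).seedLen.nodes + (streamAlg a).seedMod.nodes +
    (streamAlg a).start.nodes + (streamAlg a).step.nodes + (streamAlg a).output.nodes := rfl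
  refine max_le (max_le ?_ ?_) (max_le ?_ (max_le (Finset.sup_le fun j hj => ?_) ?_))
  · exact space_le_of (by omega) (peak_degree_le (X := X) (m' := m) (k' := k) rfl rfl g1
      (by omega)) (by omega)
  · exact space_le_of (by omega) (peak_nextPrime_le (X := X) (n' := n) rfl hn (by omega)
      (by omega)) (by omega)
  · refine space_le_of ?_ ?_ (by omega)
    · exact (Nat.add_le_add hL henv).trans (by omega)
    · exact peak_start_le (X := X) hn (by omega) g1 g2 g3 (by omega) (by omega)
  · have hj := Finset.mem_range.1 hj
    rw [hmem j]
    obtain ⟨h1, h2⟩ := bits_storedAfter_le (a := a) (k := k) (r := r) (f := f) (d := d) V s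
      (primeAbove n) j hj.le
    have h3 := hmemb j hj.le
    have hbj := hb (hj.le.trans hm)
    refine space_le_of ?_ ?_ (by omega)
    · exact (Nat.add_le_add hbj (Nat.add_le_add h3 henv)).trans (by omega)
    · exact peak_streamStep_le (X := X)
        (S := elementsBits a m n k d + entriesBits a m n k r f d + 2 * Ty.nat.bits X + 1) hS (hM j)
        (hinp j) hsq (hj.le.trans hm) (by omega) g7 (by omega) (by omega)
  · rw [hmem m]
    obtain ⟨h1, h2⟩ := bits_storedAfter_le (a := a) (k := k) (r := r) (f := f) (d := d) V s
      (primeAbove n) m le_rfl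
    have h3 := hmemb m le_rfl
    have hpow := bits_nat_mono (Nat.pow_le_pow_right (by norm_num : 1 ≤ 2) h2)
    refine space_le_of ?_ ?_ (by omega)
    · exact (Nat.add_le_add h3 henv).trans (by omega)
    · exact peak_streamOutput_le (X := X) (S := entriesBits a m n k r f d) hS (hM m) hsq (by omega)
        (by omega) h1 (by omega)

end

end Machine

/-! ### The space bound -/

namespace Machine

open Finset Hashing

theorem size_mul_le (x y : ℕ) : Nat.size (x * y) ≤ Nat.size x + Nat.size y := by
  rw [Nat.size_le, pow_add]
  exact Nat.mul_lt_mul'' (Nat.lt_size_self x) (Nat.lt_size_self y)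

theorem size_succ_le (x : ℕ) : Nat.size (x + 1) ≤ Nat.size x + 1 := by
  rw [Nat.size_le, pow_succ]
  have := Nat.lt_size_self x
  omega

theorem size_pow_le (x j : ℕ) : Nat.size (x ^ (j + 1)) ≤ (j + 1) * Nat.size x := by
  induction j with
  | zero => simp
  | succ j ih =>
    rw [pow_succ, add_mul, one_mul]
    exact (size_mul_le _ _).trans (Nat.add_le_add_right ih _)

/-- A number whose sixth power bounds all numbers that occur in a run of the streaming algorithm. -/
def numberBase (a m n f d : ℕ) : ℕ := (a + 600) * ((m + 1) * ((n + 1) * ((f + 1) * (d + 1))))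

theorem numberBound_pow {a m n k r f d : ℕ} (hk : k ≤ m) (hr : r ≤ m) (hm : 1 ≤ m) :
    NumberBound a m n k r f d (numberBase a m n f d ^ 6) ∧ m ≤ numberBase a m n f d ^ 6 := by
  have h1 : 0 < (m + 1) * ((n + 1) * ((f + 1) * (d + 1))) := by positivity
  have hY : 600 * ((m + 1) * ((n + 1) * ((f + 1) * (d + 1)))) ≤ numberBase a m n f d :=
    Nat.mul_le_mul_right _ (Nat.le_add_left _ _)
  have hm1 : m + 1 ≤ (m + 1) * ((n + 1) * ((f + 1) * (d + 1))) :=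
    Nat.le_mul_of_pos_right _ (by positivity)
  have hn1 : n + 1 ≤ (m + 1) * ((n + 1) * ((f + 1) * (d + 1))) :=
    (Nat.le_mul_of_pos_right _ (by positivity)).trans (Nat.le_mul_of_pos_left _ (by positivity))
  have hfd : (f + 1) * (d + 1) ≤ (m + 1) * ((n + 1) * ((f + 1) * (d + 1))) :=
    (Nat.le_mul_of_pos_left _ (by positivity)).trans (Nat.le_mul_of_pos_left _ (by positivity))
  have hf1 : f + 1 ≤ (f + 1) * (d + 1) := Nat.le_mul_of_pos_right _ (by positivity)
  have hd1 : d + 1 ≤ (f + 1) * (d + 1) := Nat.le_mul_of_pos_left _ (by positivity)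
  have hak : 2 * (2 * k + (a + 3)) ≤ numberBase a m n f d := by
    have h2 : (a + 600) * (m + 1) ≤ numberBase a m n f d := Nat.mul_le_mul_left _ hm1
    have h3 : a * 2 ≤ a * (m + 1) := Nat.mul_le_mul_left _ (by omega)
    have h4 : (a + 600) * (m + 1) = a * (m + 1) + 600 * (m + 1) := add_mul _ _ _
    omega
  generalize numberBase a m n f d = Y at hY hak
  have hs : Nat.size m ≤ Y := (size_le_self m).trans (by omega)
  have hT : thresholdVal a m k d ≤ Y ^ 5 := by
    calc thresholdVal a m k d = 576 * (2 * (2 * k + (a + 3))) * Nat.size m * d * d := by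
          unfold thresholdVal degreeVal; ring
      _ ≤ Y * Y * Y * Y * Y := by
          refine Nat.mul_le_mul (Nat.mul_le_mul (Nat.mul_le_mul (Nat.mul_le_mul ?_ hak) hs) ?_) ?_
          all_goals omega
      _ = Y ^ 5 := by ring
  have hc : capacityVal k r f d ≤ Y ^ 5 := by
    calc capacityVal k r f d = 2 * k * r * (f + 1) * d := by unfold capacityVal; ring
      _ ≤ Y * Y * Y * Y := by
          refine Nat.mul_le_mul (Nat.mul_le_mul (Nat.mul_le_mul ?_ ?_) ?_) ?_
          all_goals omega
      _ = Y ^ 4 := by ring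
      _ ≤ Y ^ 5 := Nat.pow_le_pow_right (by omega) (by norm_num)
  have h6 : 600 * Y ^ 5 ≤ Y ^ 6 := by
    rw [pow_succ Y 5, mul_comm]
    exact Nat.mul_le_mul_left _ (by omega)
  have hY2 : Y * Y ≤ Y ^ 5 := by
    rw [← pow_two]
    exact Nat.pow_le_pow_right (by omega) (by norm_num)
  have hY1 : Y ≤ Y * Y := Nat.le_mul_self Y
  have hprod : ∀ {x y : ℕ}, x ≤ Y → y ≤ Y → x * y ≤ Y * Y := fun hx hy => Nat.mul_le_mul hx hy
  have e1 := hprod hak (by omega : m + 2 ≤ Y)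
  have e2 := hprod (by omega : d ≤ Y) (by omega : d ≤ Y)
  have e3 := hprod (by omega : 2 * n ≤ Y) (by omega : n ≤ Y)
  have e4 := hprod (by omega : k ≤ Y) (by omega : r ≤ Y)
  have e5 := hprod (by omega : f + 1 ≤ Y) (by omega : d ≤ Y)
  have e6 : thresholdVal a m k d * (2 * n) ≤ Y ^ 6 := by
    rw [pow_succ]
    exact Nat.mul_le_mul hT (by omega)
  exact ⟨⟨by omega, by omega, by omega, by omega, e6, by omega, by omega⟩, by omega⟩

/-- The order of magnitude of the space of the streaming algorithm, with `f = ⌈φ⌉` and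
`d = ⌈1 / ε⌉`. -/
def spaceScale (m n k r f d : ℕ) : ℕ :=
  k ^ 2 * r * f * d ^ 3 * (Nat.size m + Nat.size n) ^ 2

/-- The main term is `capacity * threshold * log n`, which is `k ^ 2 r ⌈φ⌉ ⌈1 / ε⌉ ^ 3` up to a
constant and two logarithms. -/
theorem exists_valueBits_le (a : ℕ) : ∃ c : ℕ, ∀ m n k r f d : ℕ, 1 ≤ m → 1 ≤ n → 1 ≤ k → 1 ≤ r →
    1 ≤ f → 1 ≤ d →
    valueBits a m n k r f d (numberBase a m n f d ^ 6) ≤ c * spaceScale m n k r f d := by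
  refine ⟨7 * (a + 5) + 11 + 16 * (12 * (a + 608)) + 2 * (9217 * (a + 5)) +
    2 * (4 * (9217 * (a + 5) + 4) + 1) + 3, fun m n k r f d hm hn hk hr hf hd => ?_⟩
  have hsm : 1 ≤ Nat.size m := Nat.size_pos.2 hm
  have hsn : 1 ≤ Nat.size n := Nat.size_pos.2 hn
  unfold spaceScale
  set l := Nat.size m + Nat.size n with hl
  set G := k ^ 2 * r * f * d ^ 3 * l ^ 2 with hG
  have hl1 : 1 ≤ l := by omega
  have hG1 : 1 ≤ G := by rw [hG]; exact Nat.succ_le_of_lt (by positivity)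
  have hlfd : l * f * d ≤ G := by
    have : G = l * f * d * (k ^ 2 * r * d ^ 2 * l) := by rw [hG]; ring
    rw [this]
    exact Nat.le_mul_of_pos_right _ (by positivity)
  have hkl : k * l ^ 2 ≤ G := by
    have : G = k * l ^ 2 * (k * r * f * d ^ 3) := by rw [hG]; ring
    rw [this]
    exact Nat.le_mul_of_pos_right _ (by positivity)
  have hkld : k * l ^ 2 * d ^ 2 ≤ G := by
    have : G = k * l ^ 2 * d ^ 2 * (k * r * f * d) := by rw [hG]; ring
    rw [this]
    exact Nat.le_mul_of_pos_right _ (by positivity)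
  have hkrfd : k * r * f * d ≤ G := by
    have : G = k * r * f * d * (k * d ^ 2 * l ^ 2) := by rw [hG]; ring
    rw [this]
    exact Nat.le_mul_of_pos_right _ (by positivity)
  -- the numbers have few digits
  have hX : Ty.nat.bits (numberBase a m n f d ^ 6) ≤ 12 * (a + 608) * G := by
    have h1 : Nat.size (numberBase a m n f d ^ 6) ≤ 6 * Nat.size (numberBase a m n f d) :=
      size_pow_le (numberBase a m n f d) 5
    have h2 : Nat.size (numberBase a m n f d) ≤
        (a + 600) + ((Nat.size m + 1) + ((Nat.size n + 1) + ((f + 1) + (d + 1)))) := by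
      refine (size_mul_le _ _).trans (Nat.add_le_add (size_le_self _) ?_)
      refine (size_mul_le _ _).trans (Nat.add_le_add (size_succ_le _) ?_)
      refine (size_mul_le _ _).trans (Nat.add_le_add (size_succ_le _) ?_)
      exact (size_mul_le _ _).trans (Nat.add_le_add (size_le_self _) (size_le_self _))
    have h3 : l ≤ l * f * d :=
      (Nat.le_mul_of_pos_right _ hf).trans (Nat.le_mul_of_pos_right _ hd)
    have h4 : f ≤ l * f * d :=
      (Nat.le_mul_of_pos_left _ hl1).trans (Nat.le_mul_of_pos_right _ hd)
    have h5 : d ≤ l * f * d := Nat.le_mul_of_pos_left _ (Nat.mul_pos hl1 hf)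
    have h6 : a + 605 ≤ (a + 605) * G := Nat.le_mul_of_pos_right _ hG1
    have h7 : 12 * (a + 608) * G = 12 * ((a + 605) * G) + 36 * G := by ring
    rw [bits_nat, h7]
    omega
  have ht : degreeVal a m k ≤ 2 * (a + 5) * (k * l) := by
    have h1 : 2 * k + (a + 3) ≤ (a + 5) * k := by
      have : a + 3 ≤ (a + 3) * k := Nat.le_mul_of_pos_right _ hk
      have h2 : (a + 5) * k = 2 * k + (a + 3) * k := by ring
      omega
    have h2 : (2 * k + (a + 3)) * Nat.size m ≤ (a + 5) * k * l := Nat.mul_le_mul h1 (by omega)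
    have h3 : 2 * (a + 5) * (k * l) = 2 * ((a + 5) * k * l) := by ring
    rw [h3]
    exact Nat.mul_le_mul_left 2 h2
  have hseed : seedBits a m n k ≤ 7 * (a + 5) * G := by
    have h1 : Ty.nat.bits (2 * n) + 1 ≤ 3 * l := by
      have h2 := size_mul_le 2 n
      rw [show Nat.size 2 = 2 by decide] at h2
      have h3 : Nat.size (2 * n) ≤ Nat.size n + 1 := by
        rw [Nat.size_le, pow_succ]
        have := Nat.lt_size_self n
        omega
      rw [bits_nat]
      omega
    have h2 : degreeVal a m k * (Ty.nat.bits (2 * n) + 1) ≤ 6 * ((a + 5) * G) :=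
      calc degreeVal a m k * (Ty.nat.bits (2 * n) + 1) ≤ 2 * (a + 5) * (k * l) * (3 * l) :=
            Nat.mul_le_mul ht h1
        _ = 6 * ((a + 5) * (k * l ^ 2)) := by ring
        _ ≤ 6 * ((a + 5) * G) := Nat.mul_le_mul_left _ (Nat.mul_le_mul_left _ hkl)
    have h3 : 1 ≤ (a + 5) * G := Nat.mul_pos (by omega) hG1
    have h4 : 7 * (a + 5) * G = 6 * ((a + 5) * G) + (a + 5) * G := by ring
    rw [seedBits, h4]
    omega
  have hcap : capacityVal k r f d ≤ 4 * (k * r * f * d) := by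
    calc capacityVal k r f d ≤ 2 * (k * r * ((f + f) * d)) :=
          Nat.mul_le_mul_left _ (Nat.mul_le_mul_left _ (Nat.mul_le_mul_right _ (by omega)))
      _ = 4 * (k * r * f * d) := by ring
  have hpow : Ty.nat.bits (2 ^ capacityVal k r f d) ≤ 11 * G := by
    rw [bits_nat, Nat.size_pow]
    omega
  have hels : elementsBits a m n k d ≤ 9217 * (a + 5) * (k * l ^ 2 * d ^ 2) := by
    have h1 : Ty.nat.bits n + 1 ≤ 2 * l := by rw [bits_nat]; omega
    have h2 : 4 * thresholdVal a m k d * (Ty.nat.bits n + 1) ≤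
        9216 * ((a + 5) * (k * l ^ 2 * d ^ 2)) :=
      calc 4 * thresholdVal a m k d * (Ty.nat.bits n + 1)
          ≤ 4 * (576 * (2 * (a + 5) * (k * l) * (d * d))) * (2 * l) :=
            Nat.mul_le_mul (Nat.mul_le_mul_left _ (Nat.mul_le_mul_left _
              (Nat.mul_le_mul_right _ ht))) h1
        _ = 9216 * ((a + 5) * (k * l ^ 2 * d ^ 2)) := by ring
    have h3 : 1 ≤ (a + 5) * (k * l ^ 2 * d ^ 2) := Nat.succ_le_of_lt (by positivity)
    have h4 : 9217 * (a + 5) * (k * l ^ 2 * d ^ 2) = 9216 * ((a + 5) * (k * l ^ 2 * d ^ 2)) +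
      (a + 5) * (k * l ^ 2 * d ^ 2) := by ring
    rw [elementsBits, h4]
    omega
  have hels' : elementsBits a m n k d ≤ 9217 * (a + 5) * G :=
    hels.trans (Nat.mul_le_mul_left _ hkld)
  have hent : entriesBits a m n k r f d ≤ (4 * (9217 * (a + 5) + 4) + 1) * G := by
    have h0 : l ≤ k * l ^ 2 * d ^ 2 := by
      have : k * l ^ 2 * d ^ 2 = l * (k * l * d ^ 2) := by ring
      rw [this]
      exact Nat.le_mul_of_pos_right _ (by positivity)
    have h1 : Ty.nat.bits m + Ty.nat.bits n + elementsBits a m n k d + 1 ≤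
        (9217 * (a + 5) + 4) * (k * l ^ 2 * d ^ 2) := by
      rw [add_mul, bits_nat, bits_nat]
      omega
    have h2 := Nat.mul_le_mul hcap h1
    have h3 : 4 * (k * r * f * d) * ((9217 * (a + 5) + 4) * (k * l ^ 2 * d ^ 2)) =
        4 * (9217 * (a + 5) + 4) * G := by rw [hG]; ring
    rw [h3] at h2
    rw [entriesBits, add_mul, one_mul]
    exact Nat.add_le_add h2 hG1
  unfold valueBits
  generalize Ty.nat.bits (numberBase a m n f d ^ 6) = β at hX
  have hsum : seedBits a m n k + Ty.nat.bits (2 ^ capacityVal k r f d) + 12 * β +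
      2 * (elementsBits a m n k d + entriesBits a m n k r f d + 2 * β + 1) + 1 ≤
      7 * (a + 5) * G + 11 * G + 16 * (12 * (a + 608) * G) + 2 * (9217 * (a + 5) * G) +
      2 * ((4 * (9217 * (a + 5) + 4) + 1) * G) + 3 * G := by omega
  refine hsum.trans (le_of_eq ?_)
  ring

theorem size_le_log {x : ℕ} (hx : 1 ≤ x) : (Nat.size x : ℝ) ≤ 2 * Real.log x + 1 := by
  obtain ⟨y, hy⟩ := Nat.exists_eq_succ_of_ne_zero (Nat.size_pos.2 hx).ne'
  have h1 : 2 ^ y ≤ x := Nat.lt_size.1 (by omega)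
  have h2 : (2 : ℝ) ^ y ≤ x := by exact_mod_cast h1
  have h3 := Real.log_le_log (by positivity) h2
  rw [Real.log_pow] at h3
  have h4 := Real.log_two_gt_d9
  have h5 : (y : ℝ) * (1 / 2) ≤ y * Real.log 2 :=
    mul_le_mul_of_nonneg_left (by linarith) (Nat.cast_nonneg y)
  rw [hy]
  push_cast
  linarith

/-- The rounding of `φ` and `1 / ε` costs constant factors, as `φ ≥ 1` and `1 / ε > 1`. -/
theorem exists_streamAlg_space (a : ℕ) : ∃ c : ℕ,
    ∀ (m n : ℕ) (V : Fin m → Finset (Fin n)) (k r : ℕ) (φ ε : ℝ), MUC.IsInstance V k r φ ε →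
      ∀ σ : (streamAlg a).Seed (n, m, k, r, ⌈φ⌉₊, ⌈1 / ε⌉₊, ()),
        ((streamAlg a).space (n, m, k, r, ⌈φ⌉₊, ⌈1 / ε⌉₊, ()) V σ : ℝ) ≤
          (c : ℝ) * (φ * (k : ℝ) ^ 2 * (r : ℝ) / ε ^ 3) *
            (Real.log ((m : ℝ) * (n : ℝ)) + 1) ^ c := by
  obtain ⟨c, hc⟩ := exists_valueBits_le a
  refine ⟨(streamNodes a + 1) * c * 64 + 2, fun m n V k r φ ε h σ => ?_⟩
  have hn := h.pos.1
  have hk := h.two_le_k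
  have hkm := h.k_le
  have hr := h.two_le_r
  have hrm : r ≤ m := by
    rw [h.r_eq]
    refine Finset.sup_le fun x _ => (card_le_univ _).trans (by rw [Fintype.card_fin])
  have hφ := h.one_le_ratio
  have hε := h.eps_pos
  have hε1 : 1 ≤ 1 / ε := (one_le_div hε).2 h.eps_lt_one.le
  have hf1 : 1 ≤ ⌈φ⌉₊ := Nat.one_le_ceil_iff.2 (by linarith)
  have hd1 : 1 ≤ ⌈1 / ε⌉₊ := Nat.one_le_ceil_iff.2 (by linarith)
  have hf : (⌈φ⌉₊ : ℝ) ≤ 2 * φ := by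
    have := Nat.ceil_lt_add_one (by linarith : 0 ≤ φ)
    linarith
  have hd : (⌈1 / ε⌉₊ : ℝ) ≤ 2 * (1 / ε) := by
    have := Nat.ceil_lt_add_one (by linarith : 0 ≤ 1 / ε)
    linarith
  obtain ⟨hb, hmX⟩ := numberBound_pow (a := a) (n := n) (f := ⌈φ⌉₊) (d := ⌈1 / ε⌉₊) hkm hrm
    (by omega)
  have h1 := streamAlg_space_le V hb hn.ne' hmX σ
  have h2 := h1.trans (Nat.mul_le_mul_left _ (hc m n k r ⌈φ⌉₊ ⌈1 / ε⌉₊ (by omega) hn (by omega)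
    (by omega) hf1 hd1))
  have h3 : ((streamAlg a).space (n, m, k, r, ⌈φ⌉₊, ⌈1 / ε⌉₊, ()) V σ : ℝ) ≤
      ((streamNodes a : ℝ) + 1) * (c * ((k : ℝ) ^ 2 * r * ⌈φ⌉₊ * (⌈1 / ε⌉₊ : ℝ) ^ 3 *
        (Nat.size m + Nat.size n : ℝ) ^ 2)) := by
    have : ((streamAlg a).space (n, m, k, r, ⌈φ⌉₊, ⌈1 / ε⌉₊, ()) V σ : ℝ) ≤
      (((streamNodes a + 1) * (c * spaceScale m n k r ⌈φ⌉₊ ⌈1 / ε⌉₊) : ℕ) : ℝ) := by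
      exact_mod_cast h2
    refine this.trans (le_of_eq ?_)
    unfold spaceScale
    push_cast
    ring
  refine h3.trans ?_
  clear h1 h2 h3 hc
  generalize streamNodes a = N
  have hm0 : (1 : ℝ) ≤ m := by exact_mod_cast (by omega : 1 ≤ m)
  have hn0 : (1 : ℝ) ≤ n := by exact_mod_cast hn
  set L := Real.log ((m : ℝ) * n) + 1 with hL
  have hlog : Real.log ((m : ℝ) * n) = Real.log m + Real.log n :=
    Real.log_mul (by positivity) (by positivity)
  have hL1 : 1 ≤ L := by
    have h4 := Real.log_nonneg hm0
    have h5 := Real.log_nonneg hn0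
    rw [hL, hlog]
    linarith
  have hl : (Nat.size m + Nat.size n : ℝ) ≤ 2 * L := by
    have h4 := size_le_log (by omega : 1 ≤ m)
    have h5 := size_le_log hn
    rw [hL, hlog]
    linarith
  obtain ⟨C, hC⟩ : ∃ C : ℕ, (N + 1) * c * 64 + 2 = C := ⟨_, rfl⟩
  have hC' : ((N : ℝ) + 1) * c * 64 + 2 = C := by exact_mod_cast hC
  have hLpow : L ^ 2 ≤ L ^ C := pow_le_pow_right₀ hL1 (by omega)
  rw [hC]
  have hB : 0 ≤ φ * (k : ℝ) ^ 2 * r / ε ^ 3 := by positivity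
  calc ((N : ℝ) + 1) * (c * ((k : ℝ) ^ 2 * r * ⌈φ⌉₊ * (⌈1 / ε⌉₊ : ℝ) ^ 3 *
        (Nat.size m + Nat.size n : ℝ) ^ 2))
      ≤ ((N : ℝ) + 1) * (c * ((k : ℝ) ^ 2 * r * (2 * φ) * (2 * (1 / ε)) ^ 3 *
        (2 * L) ^ 2)) := by gcongr
    _ = ((N : ℝ) + 1) * c * 64 * (φ * (k : ℝ) ^ 2 * r / ε ^ 3) * L ^ 2 := by
        field_simp
        ring
    _ ≤ C * (φ * (k : ℝ) ^ 2 * r / ε ^ 3) * L ^ C :=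
        mul_le_mul (mul_le_mul_of_nonneg_right (by linarith) hB) hLpow (by positivity)
          (by positivity)

end Machine

theorem theorem3p2 :
    -- every possible result of UniqueTopSets is a (1 - ε)-approximation
    (∀ (m n : ℕ) (V : Fin m → Finset (Fin n)) (k r : ℕ) (φ ε : ℝ),
      MUC.IsInstance V k r φ ε →
      ∀ B : Finset (Fin m), MUC.IsUniqueTopSetsOutput V k (MUC.kernelSize k r φ ε) B →
        MUC.IsApprox V k ε B) ∧
    -- UniqueTopSets can be carried out in time (e r (φ + 1) / ε) ^ k * poly(m, n, 1 / ε)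
    (∃ (P : Machine.Tm [.nat, .nat, .nat, .nat] (.list .nat)) (c : ℕ),
      ∀ (m n : ℕ) (V : Fin m → Finset (Fin n)) (k r : ℕ) (φ ε : ℝ),
        MUC.IsInstance V k r φ ε →
        let tape : ℕ → ℕ := fun a => MUC.incidence V (a / n) (a % n)
        let input : Machine.Env [.nat, .nat, .nat, .nat] :=
          (n, m, k, MUC.kernelSize k r φ ε, ())
        (∃ B : Finset (Fin m), MUC.Lists (P.eval tape input) B ∧
          MUC.IsUniqueTopSetsOutput V k (MUC.kernelSize k r φ ε) B ∧ MUC.IsApprox V k ε B) ∧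
        (P.time tape input : ℝ) ≤
          (Real.exp 1 * (r : ℝ) * (φ + 1) / ε) ^ k *
            ((c : ℝ) * ((m : ℝ) * (n : ℝ) * (1 / ε)) ^ c)) ∧
    -- streaming, with success probability 1 - 1 / m ^ a for any prescribed a
    (∀ a : ℕ, ∃ (A : Machine.StreamAlg) (c : ℕ),
      ∀ (m n : ℕ) (V : Fin m → Finset (Fin n)) (k r : ℕ) (φ ε : ℝ),
        MUC.IsInstance V k r φ ε →
        let p : Machine.Env Machine.Params := (n, m, k, r, ⌈φ⌉₊, ⌈1 / ε⌉₊, ())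
        1 - 1 / (m : ℝ) ^ a ≤
          A.prob p V (fun L => ∃ B : Finset (Fin m), MUC.Lists L B ∧ MUC.IsApprox V k ε B) ∧
        ∀ s : A.Seed p, (A.space p V s : ℝ) ≤
          (c : ℝ) * (φ * (k : ℝ) ^ 2 * (r : ℝ) / ε ^ 3) *
            (Real.log ((m : ℝ) * (n : ℝ)) + 1) ^ c) := by
  refine ⟨fun m n V k r φ ε h B hB => h.isApprox_of_isUniqueTopSetsOutput hB, ?_, fun a => ?_⟩
  · obtain ⟨c, hc⟩ := Machine.exists_uniqueTopSets_time
    refine ⟨Machine.uniqueTopSets, c, fun m n V k r φ ε h => ⟨?_, hc m n V k r φ ε h⟩⟩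
    obtain ⟨B, hL, hB⟩ := Machine.uniqueTopSets_correct V k (MUC.kernelSize k r φ ε)
    exact ⟨B, hL, hB, h.isApprox_of_isUniqueTopSetsOutput hB⟩
  · obtain ⟨c, hc⟩ := Machine.exists_streamAlg_space a
    exact ⟨Machine.streamAlg a, c, fun m n V k r φ ε h =>
      ⟨Machine.streamAlg_prob a V k r φ ε h, hc m n V k r φ ε h⟩⟩
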